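/- Let $p$ be an odd prime, $k$ a field of characteristic $p$, and $M=\begin{pmatrix}c_{11}&c_{12}&c_{13}\\ c_{21}&c_{22}&c_{23}\end{pmatrix}\in k^{2\times 3}$. Put $$\sigma(c_1,c_2)=\begin{pmatrix}1&2c_1&c_1^2+c_2\\0&1&c_1\\0&0&1\end{pmatrix},$$ and let $V_M$ be the representation of $G=(\mathbb Z/p)^3=\langle e_1,e_2,e_3\rangle$ on $k^3$ with $e_j\mapsto\sigma(c_{1j},c_{2j})$. The group acts on $k[V_M]=k[x,y,z]$ through $x\sigma(c_1,c_2)=x$, $y\sigma(c_1,c_2)=y+c_1x$, $z\sigma(c_1,c_2)=z+2c_1y+(c_1^2+c_2)x$; use the graded reverse lexicographic order with $x<y<z$. Let $\delta=y^2-xz$, and let $N_G(u)$ be the product of the elements of the $G$-orbit of $u$. Let $\Gamma$ be the matrix whose rows $2i+1$ and $2i+2$ are $(c_{1j}^{p^i})_{j=1,2,3}$ and $(c_{2j}^{p^i})_{j=1,2,3}$ $(i\ge 0)$, and let $\gamma_{abc}$ be its $3\times3$ minor on rows $a,b,c$. A representation $V$ has type $(1,1,1)$ if $\dim V^G=1$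 and $\dim (V/V^G)^G=1$. A finite set $B$ contained in a subalgebra $A\subseteq k[x,y,z]$ is a SAGBI basis for $A$ if the lead monomials of the elements of $B$ generate the lead term algebra of $A$. To subduct a polynomial over $B$ means to repeatedly cancel its lead term by a scalar multiple of a product of elements of $B$. Suppose $\gamma_{123}=0$. 1. If $V_M$ is faithful of type $(1,1,1)$, then $k[V_M]^G$ is a hypersurface: it is minimally generated by four homogeneous elements of positive degree, and the ideal of relations among these is principal and nonzero. If $c_{11}=c_{12}=c_{13}=0$, then $k[V_M]^G$ is the polynomial algebra $k[x,y,N_G(z)]$. 2. Suppose $\gamma_{124}\ne0$ and $\gamma_{135}\neq0$. Put $c=\gamma_{134}/\gamma_{124}$ and $$f=y^p+c\,\delta x^{p-2}+\frac{\gamma_{234}}{\gamma_{124}}\,y x^{p-1},$$ $$\tilde h=N_G(y)-f^{p^2}+c^{p^2}f^{2p}x^{p^3-2p^2}-2c^{p^2+p}f^{p+2}x^{p^3-p^2-2p}.$$ Then there is a polynomial $h$ with $\tilde h=-4c^{p^2+p+1}x^{p^3-p^2-p-2}\,h$, the set $\{x,f,h,N_G(z)\}$ is a SAGBI basis for $k[V_M]^G$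 and generates it, and the ideal of relations among these generators is generated by the single relation constructed by subducting $f^{p^2+p+2}-h^p$ to zero. 3. Suppose $V_M$ is faithful, $\gamma_{124}\ne0$ and $\gamma_{135}=0$. Then there are $T\in GL_3(\mathbb F_p)$, $\alpha\in k^*$ and $\gamma\in k$ such that $$\begin{pmatrix}\alpha&0\\ \alpha\gamma&\alpha^2\end{pmatrix}MT=\begin{pmatrix}1&*&0\\0&*&*\end{pmatrix};$$ this is the matrix of $V_M$ for a new set of generators of $G$ and the new basis $x$, $y'=\alpha y$, $z'=\alpha^2z+\alpha\gamma y$ of $V_M^*$. For every such choice put $\delta'=y'^2-xz'$ and $$\tilde g=N_G(\delta')-N_G(y')^{2p}-2N_G(y')^{p+1}x^{p(p-1)}.$$ Then there is a polynomial $g$ with $\tilde g=2x^{p^2-1}g$, the set $\{x,N_G(y'),g,N_G(z')\}$ is a SAGBI basis for $k[V_M]^G$ and generates it, and the ideal of relations among these generators is generated by the single relation constructed by subducting $N_G(y')^{p^2+1}-g^p$ to zero. 4. If $\gamma_{124}=0$ and $\gamma_{135}\ne0$, then $V_M$ is a symmetric square representation, i.e. it is equivalent to $e_j\mapsto\sigma(\varphi(e_j),0)$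 for some group homomorphism $\varphi:G\to(k,+)$. 5. If $V_M$ is of type $(1,1,1)$ and $\gamma_{124}=\gamma_{135}=0$, then $V_M$ is not faithful. -/

import Mathlib

open MvPolynomial

namespace ElemAbelian

/-! ### The graded reverse lexicographic order on `k[z, y, x]`

The variables are `X 0 = z`, `X 1 = y`, `X 2 = x`, with `x < y < z`. -/

/-- Exponent vectors, to be ordered by the graded reverse lexicographic order. -/
def GrevSyn : Type := Fin 3 →₀ ℕ

/-- The exponent vector underlying an element of `GrevSyn`. -/
def ofGrev : GrevSyn ≃ (Fin 3 →₀ ℕ) := Equiv.refl _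

noncomputable instance : AddCommMonoid GrevSyn := inferInstanceAs (AddCommMonoid (Fin 3 →₀ ℕ))

theorem ofGrev_add (a b : GrevSyn) : ofGrev (a + b) = ofGrev a + ofGrev b := rfl

/-- Comparing `(a₀ + a₁ + a₂, a₀ + a₁, a₀)` lexicographically is the same as comparing the total
degree, then (reversed) the exponent of `X 2 = x`, then (reversed) the exponent of `X 1 = y`. -/
def grevKey (a : GrevSyn) : ℕ ×ₗ (ℕ ×ₗ ℕ) :=
  toLex (ofGrev a 0 + ofGrev a 1 + ofGrev a 2, toLex (ofGrev a 0 + ofGrev a 1, ofGrev a 0))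

theorem grevKey_injective : Function.Injective grevKey := by
  intro a b h
  simp only [grevKey, toLex_inj, Prod.mk.injEq] at h
  obtain ⟨h1, h2, h3⟩ := h
  refine ofGrev.injective (Finsupp.ext (fun i => ?_))
  fin_cases i
  · exact h3
  · show ofGrev a 1 = ofGrev b 1
    omega
  · show ofGrev a 2 = ofGrev b 2
    omega

noncomputable instance : LinearOrder GrevSyn := LinearOrder.lift' grevKey grevKey_injective

theorem grevSyn_lt_iff (a b : GrevSyn) : a < b ↔
    ofGrev a 0 + ofGrev a 1 + ofGrev a 2 < ofGrev b 0 + ofGrev b 1 + ofGrev b 2 ∨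
      (ofGrev a 0 + ofGrev a 1 + ofGrev a 2 = ofGrev b 0 + ofGrev b 1 + ofGrev b 2 ∧
        (ofGrev b 2 < ofGrev a 2 ∨ (ofGrev a 2 = ofGrev b 2 ∧ ofGrev b 1 < ofGrev a 1))) := by
  change grevKey a < grevKey b ↔ _
  simp only [grevKey, Prod.Lex.toLex_lt_toLex]
  omega

instance : IsOrderedAddMonoid GrevSyn where
  add_le_add_left a b h c := by
    rw [← not_lt, grevSyn_lt_iff] at h ⊢
    simp only [ofGrev_add, Finsupp.add_apply]
    omega

instance : WellFoundedLT GrevSyn :=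
  ⟨InvImage.wf grevKey (wellFounded_lt (α := ℕ ×ₗ (ℕ ×ₗ ℕ)))⟩

/-- The graded reverse lexicographic order with `X 2 < X 1 < X 0`. -/
noncomputable def grevlex : MonomialOrder (Fin 3) where
  syn := GrevSyn
  toSyn := { ofGrev.symm with map_add' := fun _ _ => rfl }
  toSyn_monotone := by
    intro a b h
    have h0 := h 0
    have h1 := h 1
    have h2 := h 2
    change ofGrev.symm a ≤ ofGrev.symm b
    rw [← not_lt, grevSyn_lt_iff]
    simp only [Equiv.apply_symm_apply]
    omega

theorem grevlex_lt_iff (a b : Fin 3 →₀ ℕ) : grevlex.toSyn a < grevlex.toSyn b ↔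
    a 0 + a 1 + a 2 < b 0 + b 1 + b 2 ∨
      (a 0 + a 1 + a 2 = b 0 + b 1 + b 2 ∧ (b 2 < a 2 ∨ (a 2 = b 2 ∧ b 1 < a 1))) :=
  grevSyn_lt_iff (ofGrev.symm a) (ofGrev.symm b)

section Sagbi

variable {k : Type*} [Field k]

/-- The algebra generated by the lead monomials of the (nonzero) elements of `S`. For a subalgebra
`S` this is its lead term algebra. -/
noncomputable def leadAlgebra (S : Set (MvPolynomial (Fin 3) k)) :
    Subalgebra k (MvPolynomial (Fin 3) k) :=
  Algebra.adjoin k {m | ∃ f ∈ S, f ≠ 0 ∧ m = monomial (grevlex.degree f) 1}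

/-- `B` is a SAGBI basis of the subalgebra `A`: it lies in `A`, and its lead monomials generate the
lead term algebra of `A`. -/
def IsSagbiBasis (B : Set (MvPolynomial (Fin 3) k))
    (A : Subalgebra k (MvPolynomial (Fin 3) k)) : Prop :=
  B ⊆ A ∧ leadAlgebra B = leadAlgebra (A : Set (MvPolynomial (Fin 3) k))

/-- `SubductsToZero g q S`: the polynomial `q` can be subducted to zero over the family `g`, and
`S` records the subtracted terms, as a polynomial in variables standing for the `g i`. In each step
the lead term of the current polynomial is cancelled by a scalar multiple of a product of
elements of the family that has the same lead term. -/
inductive SubductsToZero {ι : Type*} (g : ι → MvPolynomial (Fin 3) k) :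
    MvPolynomial (Fin 3) k → MvPolynomial ι k → Prop
  | zero : SubductsToZero g 0 0
  | step (q : MvPolynomial (Fin 3) k) (I : ι →₀ ℕ) (c : k) (S : MvPolynomial ι k)
      (hq : q ≠ 0)
      (hlt : grevlex.leadingTerm (aeval g (monomial I c)) = grevlex.leadingTerm q)
      (hS : SubductsToZero g (q - aeval g (monomial I c)) S) :
      SubductsToZero g q (monomial I c + S)

/-- The elements `g i` generate `A`, the tête-à-tête `(g^I, g^J)` has equal lead monomials and the
difference `g^I - g^J` subducts to zero; and for each such subduction the ideal of all relations
among the `g i` is generated by the one (nonzero) relation that the subduction produces. -/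
def SingleRelationBySubducting {ι : Type*} (g : ι → MvPolynomial (Fin 3) k)
    (A : Subalgebra k (MvPolynomial (Fin 3) k)) (I J : ι →₀ ℕ) : Prop :=
  Algebra.adjoin k (Set.range g) = A ∧
  grevlex.degree (aeval g (monomial I (1 : k))) = grevlex.degree (aeval g (monomial J (1 : k))) ∧
  (∃ S, SubductsToZero g (aeval g (monomial I (1 : k) - monomial J 1)) S) ∧
  ∀ S, SubductsToZero g (aeval g (monomial I (1 : k) - monomial J 1)) S →
    monomial I (1 : k) - monomial J 1 - S ≠ 0 ∧
    RingHom.ker (aeval g : MvPolynomial ι k →ₐ[k] MvPolynomial (Fin 3) k) =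
      Ideal.span {monomial I (1 : k) - monomial J 1 - S}

/-- `A` is a hypersurface: it is minimally generated by four homogeneous elements of positive degree
and the ideal of relations among these is principal and nonzero. -/
def IsHypersurface (A : Subalgebra k (MvPolynomial (Fin 3) k)) : Prop :=
  ∃ g : Fin 4 → MvPolynomial (Fin 3) k,
    (∀ i, ∃ d, 0 < d ∧ (g i).IsHomogeneous d) ∧
    Algebra.adjoin k (Set.range g) = A ∧
    (∀ i, g i ∉ Algebra.adjoin k (g '' {i}ᶜ)) ∧
    ∃ F : MvPolynomial (Fin 4) k, F ≠ 0 ∧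
      RingHom.ker (aeval g : MvPolynomial (Fin 4) k →ₐ[k] MvPolynomial (Fin 3) k) = Ideal.span {F}

end Sagbi

section Representations

variable {k : Type*} [Field k]

/-- The homomorphism `σ : k² → GL₃(k)`, as a matrix-valued function. -/
def sigma (c : k × k) : Matrix (Fin 3) (Fin 3) k :=
  !![1, 2 * c.1, c.1 ^ 2 + c.2;
     0, 1, c.1;
     0, 0, 1]

theorem sigma_zero : sigma (0 : k × k) = 1 := by
  ext i j; fin_cases i <;> fin_cases j <;> simp [sigma]

theorem sigma_add (c d : k × k) : sigma (c + d) = sigma c * sigma d := by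
  ext i j
  fin_cases i <;> fin_cases j <;> simp [sigma, Matrix.mul_apply, Fin.sum_univ_three] <;> ring

variable (p : ℕ) [CharP k p]

/-- The column combination `∑ⱼ aⱼ · (c₁ⱼ, c₂ⱼ)` of the columns of `M` with coefficients in `𝔽_p`. -/
noncomputable def colComb (M : Matrix (Fin 2) (Fin 3) k) : (Fin 3 → ZMod p) →+ k × k where
  toFun a := (∑ j, ZMod.castHom (dvd_refl p) k (a j) * M 0 j,
    ∑ j, ZMod.castHom (dvd_refl p) k (a j) * M 1 j)
  map_zero' := by simp
  map_add' a b := by simp [add_mul, Finset.sum_add_distrib]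

/-- The matrix representation of `G = (ℤ/p)³ = ⟨e₁, e₂, e₃⟩` given by `eⱼ ↦ σ(c₁ⱼ, c₂ⱼ)`. -/
noncomputable def repMat (M : Matrix (Fin 2) (Fin 3) k) :
    Multiplicative (Fin 3 → ZMod p) →* Matrix (Fin 3) (Fin 3) k where
  toFun g := sigma (colComb p M g.toAdd)
  map_one' := by simp [sigma_zero]
  map_mul' g h := by simp [sigma_add]

/-- The representation `V_M` of `G` on column vectors. -/
noncomputable def repV (M : Matrix (Fin 2) (Fin 3) k) :
    Representation k (Multiplicative (Fin 3 → ZMod p)) (Fin 3 → k) :=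
  ((Matrix.toLinAlgEquiv' : Matrix (Fin 3) (Fin 3) k ≃ₐ[k] _) :
    Matrix (Fin 3) (Fin 3) k →* ((Fin 3 → k) →ₗ[k] (Fin 3 → k))).comp (repMat p M)

/-- `V_M` is faithful. -/
def Faithful (M : Matrix (Fin 2) (Fin 3) k) : Prop := Function.Injective (repV p M)

/-- The fixed space of a representation is a subrepresentation. -/
theorem invariants_le_comap {G V : Type*} [Group G] [AddCommGroup V] [Module k V]
    (ρ : Representation k G V) (g : G) : ρ.invariants ≤ ρ.invariants.comap (ρ g) := by
  intro v hv h
  rw [hv g, hv h]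

/-- A three dimensional representation is of type `(1,1,1)` if `dim V^G = 1` and
`dim (V/V^G)^G = 1`. -/
def IsTypeOneOneOne {G : Type*} [Group G] (ρ : Representation k G (Fin 3 → k)) : Prop :=
  Module.finrank k ρ.invariants = 1 ∧
  Module.finrank k (ρ.quotient ρ.invariants (invariants_le_comap ρ)).invariants = 1

/-- The representation `V₃` of `(k,+)`, dual to the symmetric square of `V₂^*`. -/
def symSquare (c : k) : Matrix (Fin 3) (Fin 3) k :=
  !![1, 2 * c, c ^ 2;
     0, 1, c;
     0, 0, 1]

/-- The rows of `symSquare c` express the images of `y², xy, x²` under `x ↦ x`, `y ↦ y + c x`. -/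
theorem symSquare_mulVec (c x y : k) :
    (symSquare c).mulVec ![y ^ 2, x * y, x ^ 2] =
      ![(y + c * x) ^ 2, x * (y + c * x), x ^ 2] := by
  ext i
  fin_cases i <;> simp [symSquare, Matrix.mulVec, dotProduct, Fin.sum_univ_three] <;> ring

/-- `V_M` is a symmetric square representation: it is equivalent to the restriction of `V₃`
along a group homomorphism `G → (k,+)`. -/
def IsSymmetricSquare (M : Matrix (Fin 2) (Fin 3) k) : Prop :=
  ∃ φ : (Fin 3 → ZMod p) →+ k, ∃ P : GL (Fin 3) k, ∀ g : Multiplicative (Fin 3 → ZMod p),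
    (P : Matrix (Fin 3) (Fin 3) k) * repMat p M g * ((P⁻¹ : GL (Fin 3) k) : Matrix _ _ k) =
      symSquare (φ g.toAdd)

/-- The right action of a matrix on polynomials: the variables `X 0 = z`, `X 1 = y`, `X 2 = x` are
the row vectors `[1 0 0]`, `[0 1 0]`, `[0 0 1]`, on which matrices act from the right. -/
noncomputable def polyAct (A : Matrix (Fin 3) (Fin 3) k) :
    MvPolynomial (Fin 3) k →ₐ[k] MvPolynomial (Fin 3) k :=
  aeval fun i => ∑ j, C (A i j) * X j

/-- The ring of invariants `k[V_M]^G`. -/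
noncomputable def invariantRing (M : Matrix (Fin 2) (Fin 3) k) :
    Subalgebra k (MvPolynomial (Fin 3) k) where
  carrier := {f | ∀ g, polyAct (repMat p M g) f = f}
  mul_mem' hf hh g := by rw [map_mul, hf g, hh g]
  add_mem' hf hh g := by rw [map_add, hf g, hh g]
  algebraMap_mem' r g := by simp

open Classical in
/-- `N_G(f)`: the product of the elements of the `G`-orbit of `f`. -/
noncomputable def orbitProd [NeZero p] (M : Matrix (Fin 2) (Fin 3) k)
    (f : MvPolynomial (Fin 3) k) : MvPolynomial (Fin 3) k :=
  ∏ h ∈ Finset.univ.image (fun g : Multiplicative (Fin 3 → ZMod p) => polyAct (repMat p M g) f), h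

/-- The rows of the matrix `Γ`, numbered from `1`: row `2i+1` is `(c₁ⱼ^(p^i))ⱼ` and row `2i+2` is
`(c₂ⱼ^(p^i))ⱼ`. -/
def gammaRow (M : Matrix (Fin 2) (Fin 3) k) (n : ℕ) (j : Fin 3) : k :=
  M (if n % 2 = 1 then 0 else 1) j ^ p ^ ((n - 1) / 2)

/-- The `3 × 3` minor `γ_{abc}` of `Γ` on the rows `a, b, c`. -/
def gammaMinor (M : Matrix (Fin 2) (Fin 3) k) (a b c : ℕ) : k :=
  (Matrix.of ![gammaRow p M a, gammaRow p M b, gammaRow p M c]).det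

end Representations

section Invariants

variable {k : Type*} [Field k]

/-- `δ = y² - xz`. -/
noncomputable def delta : MvPolynomial (Fin 3) k := X 1 ^ 2 - X 2 * X 0

/-- `f = y^p + (γ₁₃₄/γ₁₂₄) δ x^{p-2} + (γ₂₃₄/γ₁₂₄) y x^{p-1}`. -/
noncomputable def invF (p : ℕ) [CharP k p] (M : Matrix (Fin 2) (Fin 3) k) :
    MvPolynomial (Fin 3) k :=
  X 1 ^ p + C (gammaMinor p M 1 3 4 / gammaMinor p M 1 2 4) * delta * X 2 ^ (p - 2)
    + C (gammaMinor p M 2 3 4 / gammaMinor p M 1 2 4) * X 1 * X 2 ^ (p - 1)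

/-- With `c = γ₁₃₄/γ₁₂₄`, the polynomial
`h̃ = N_G(y) - f^{p²} + c^{p²} f^{2p} x^{p³-2p²} - 2 c^{p²+p} f^{p+2} x^{p³-p²-2p}`. -/
noncomputable def invHTilde (p : ℕ) [CharP k p] [NeZero p] (M : Matrix (Fin 2) (Fin 3) k) :
    MvPolynomial (Fin 3) k :=
  orbitProd p M (X 1) - invF p M ^ p ^ 2
    + C ((gammaMinor p M 1 3 4 / gammaMinor p M 1 2 4) ^ p ^ 2) * invF p M ^ (2 * p)
        * X 2 ^ (p ^ 3 - 2 * p ^ 2)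
    - C (2 * (gammaMinor p M 1 3 4 / gammaMinor p M 1 2 4) ^ (p ^ 2 + p)) * invF p M ^ (p + 2)
        * X 2 ^ (p ^ 3 - p ^ 2 - 2 * p)

/-- `h = h̃ / (-4 c^{p²+p+1} x^{p³-p²-p-2})`, where the quotient is exact. -/
def IsInvH (p : ℕ) [CharP k p] [NeZero p] (M : Matrix (Fin 2) (Fin 3) k)
    (h : MvPolynomial (Fin 3) k) : Prop :=
  C (-4 * (gammaMinor p M 1 3 4 / gammaMinor p M 1 2 4) ^ (p ^ 2 + p + 1))
    * X 2 ^ (p ^ 3 - p ^ 2 - p - 2) * h = invHTilde p M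

/-- The matrix of `V_M` after changing the generators of `G` by `T ∈ GL₃(𝔽_p)` and the basis of
`V_M` by `(γ, α) ∈ k ⋊ k^*`. -/
noncomputable def changeOf (p : ℕ) [CharP k p] (M : Matrix (Fin 2) (Fin 3) k) (α γ : k)
    (T : GL (Fin 3) (ZMod p)) : Matrix (Fin 2) (Fin 3) k :=
  !![α, 0; α * γ, α ^ 2] * M * (T : Matrix (Fin 3) (Fin 3) (ZMod p)).map (ZMod.castHom (dvd_refl p) k)

/-- These changes bring `M` into the form `[1 * 0; 0 * *]`. -/
def IsNormalizing (p : ℕ) [CharP k p] (M : Matrix (Fin 2) (Fin 3) k) (α γ : k)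
    (T : GL (Fin 3) (ZMod p)) : Prop :=
  α ≠ 0 ∧ changeOf p M α γ T 0 0 = 1 ∧ changeOf p M α γ T 1 0 = 0 ∧ changeOf p M α γ T 0 2 = 0

/-- The element `y' = α y` of the basis `{x, y', z'}` of `V_M^*` that belongs to `(γ, α)`. -/
noncomputable def newY (α : k) : MvPolynomial (Fin 3) k := C α * X 1

/-- The element `z' = α² z + αγ y` of the basis `{x, y', z'}` of `V_M^*` that belongs to
`(γ, α)`. -/
noncomputable def newZ (α γ : k) : MvPolynomial (Fin 3) k := C (α ^ 2) * X 0 + C (α * γ) * X 1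

/-- In the basis `{x, y', z'}` the group acts through the matrix transformed by `(γ, α)`. -/
theorem polyAct_newBasis (α γ : k) (c : k × k) :
    polyAct (sigma c) (X 2) = X 2 ∧
    polyAct (sigma c) (newY α) = newY α + C (α * c.1) * X 2 ∧
    polyAct (sigma c) (newZ α γ) = newZ α γ + C (2 * (α * c.1)) * newY α
      + C ((α * c.1) ^ 2 + (α * γ * c.1 + α ^ 2 * c.2)) * X 2 := by
  refine ⟨?_, ?_, ?_⟩ <;>
    simp [polyAct, sigma, newY, newZ, Fin.sum_univ_three] <;> ring

/-- `g = g̃ / (2 x^{p²-1})`, where the quotient is exact and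
`g̃ = N_G(δ') - N_G(y')^{2p} - 2 N_G(y')^{p+1} x^{p(p-1)}` with `δ' = y'² - x z'`. -/
def IsInvG (p : ℕ) [CharP k p] [NeZero p] (M : Matrix (Fin 2) (Fin 3) k) (α γ : k)
    (g : MvPolynomial (Fin 3) k) : Prop :=
  C 2 * X 2 ^ (p ^ 2 - 1) * g =
    orbitProd p M (newY α ^ 2 - X 2 * newZ α γ) - orbitProd p M (newY α) ^ (2 * p)
      - C 2 * orbitProd p M (newY α) ^ (p + 1) * X 2 ^ (p * (p - 1))

end Invariants

end ElemAbelian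

namespace ElemAbelian

/-! ### Lead monomials of polynomial expressions in a family. -/

section LeadMonomials

variable {k : Type*} [Field k]

/-! Let c₁, c₂ : G → k be the additive maps given by the rows of M. In every faithful case of type
(1,1,1) there are homogeneous invariants f and h with lead monomials y^a and y^b, where a and b are
coprime; the pair (a, b) is (2, p³), (p, p²+p+2) or (p, p²+1). Together with x and an invariant N
with lead monomial z^(p³) they generate everything, for the following reason.

The products x^i f^j h^l N^m with l < a have distinct lead monomials, because b is invertible modulo
a. If h^a is a combination of such products, they span the algebra they generate. This algebra is
then closed under division by x: a nonzero combination of products without a factor x has a lead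
monomial free of x, so its value is not divisible by x. Hence it is the full ring of invariants as
soon as the two agree after inverting x (`LeadShape.exists_degree_eq`). The relation obtained by
subducting f^b - h^a is, up to sign, monic of degree a in h, and division by it shows that it
generates all relations (`LeadShape.singleRelation`).

After inverting x, the variable z can be traded for a polynomial linear in z (f itself or δ'), and
in the new coordinates G acts by translations. Invariants of translations are generated by products
of translates (`mem_adjoin_of_translation`).

The expression for h^a is found with an auxiliary invariant E of lead monomial z^(p³) in place of
the orbit product of z. If c₁ is injective, E is what remains of f^b - h^a after repeated
subtraction of products f^i h^l and division by x (`exists_invariant_degree_eq`): at x = 0 the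
remainder is a multiple of a power of y, and the exponent is large enough to be a combination of a
and b. Otherwise E is explicit (`NormalizedAction.exists_eq`). Since E and the orbit product have
the same lead monomial, one can replace the other.

The minors enter through additive polynomials: one of degree less than p^n that vanishes on a group
of order p^n is zero. So γ₁₃₅ ≠ 0 means that c₁ is injective, and then γ₁₂₃ = 0 gives c₂ = a c₁ + b
c₁^p with γ₁₂₄ = b^(p+1) γ₁₃₅; the symmetric squares are the case b = 0. If γ₁₃₅ = 0, then c₁ has a
kernel, and for faithful V_M with c₁ ≠ 0 the relation γ₁₂₃ = 0 makes c₁ a multiple of a map to 𝔽_p.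
-/

theorem aeval_monomial_ne_zero {ι : Type*} {g : ι → MvPolynomial (Fin 3) k} (hg : ∀ i, g i ≠ 0)
    (I : ι →₀ ℕ) {c : k} (hc : c ≠ 0) : aeval g (monomial I c) ≠ 0 := by
  rw [aeval_monomial]
  refine mul_ne_zero (by simpa using hc) ?_
  exact Finset.prod_ne_zero_iff.2 fun i _ => pow_ne_zero _ (hg i)

/-- The lead monomial of a product of powers of the elements of a family. -/
theorem degree_aeval_monomial {ι : Type*} {g : ι → MvPolynomial (Fin 3) k}
    (hg : ∀ i, g i ≠ 0) (I : ι →₀ ℕ) {c : k} (hc : c ≠ 0) :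
    grevlex.degree (aeval g (monomial I c)) = I.sum fun i n => n • grevlex.degree (g i) := by
  have h0 : (algebraMap k (MvPolynomial (Fin 3) k)) c ≠ 0 := by simpa using hc
  have h1 : (I.prod fun i n => g i ^ n) ≠ 0 :=
    Finset.prod_ne_zero_iff.2 fun i _ => pow_ne_zero _ (hg i)
  rw [aeval_monomial, grevlex.degree_mul h0 h1, MvPolynomial.algebraMap_eq, grevlex.degree_C,
    zero_add, Finsupp.prod, grevlex.degree_prod (fun i _ => pow_ne_zero _ (hg i))]
  simp [Finsupp.sum, MonomialOrder.degree_pow]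

/-- If the products of powers occurring in `P` have distinct lead monomials, one of these is the
lead monomial of the value of `P`. -/
theorem exists_degree_aeval_eq {ι : Type*} {g : ι → MvPolynomial (Fin 3) k}
    (hg : ∀ i, g i ≠ 0) {P : MvPolynomial ι k} (hP : P ≠ 0)
    (hinj : Set.InjOn (fun I => grevlex.degree (aeval g (monomial I (1 : k)))) P.support) :
    ∃ I ∈ P.support, aeval g P ≠ 0 ∧
      grevlex.degree (aeval g P) = grevlex.degree (aeval g (monomial I (1 : k))) := by
  classical
  set w : (ι →₀ ℕ) → (Fin 3 →₀ ℕ) := fun I => grevlex.degree (aeval g (monomial I (1 : k))) with hw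
  obtain ⟨I, hI, hmax⟩ := Finset.exists_max_image P.support (fun I => grevlex.toSyn (w I))
    (support_nonempty.2 hP)
  have hdeg : ∀ J ∈ P.support, grevlex.degree (aeval g (monomial J (P.coeff J))) = w J := by
    intro J hJ
    simp only [hw]
    rw [degree_aeval_monomial hg J (mem_support_iff.1 hJ),
      degree_aeval_monomial hg J one_ne_zero]
  have hsum : aeval g P = ∑ J ∈ P.support, aeval g (monomial J (P.coeff J)) := by
    conv_lhs => rw [P.as_sum]
    rw [map_sum]
  -- By injectivity the largest lead monomial occurs in one term only, so nothing can cancel it.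
  have hcoeff : coeff (w I) (aeval g P) ≠ 0 := by
    rw [hsum, coeff_sum, Finset.sum_eq_single_of_mem I hI]
    · rw [← hdeg I hI]
      exact grevlex.coeff_degree_ne_zero_iff.2
        (aeval_monomial_ne_zero hg I (mem_support_iff.1 hI))
    · intro J hJ hJI
      apply grevlex.coeff_eq_zero_of_lt
      rw [hdeg J hJ]
      refine lt_of_le_of_ne (hmax J hJ) fun h => hJI (hinj hJ hI (grevlex.toSyn.injective h))
  have hne : aeval g P ≠ 0 := fun h => hcoeff (by rw [h, coeff_zero])
  refine ⟨I, hI, hne, grevlex.toSyn.injective (le_antisymm ?_ ?_)⟩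
  · rw [hsum, grevlex.degree_le_iff]
    intro c hc
    obtain ⟨J, hJ, hc⟩ := Finset.mem_biUnion.1 (support_sum hc)
    refine le_trans (grevlex.le_degree hc) ?_
    rw [hdeg J hJ]
    exact hmax J hJ
  · exact grevlex.le_degree (mem_support_iff.2 hcoeff)

theorem X_two_dvd_degree {q : MvPolynomial (Fin 3) k} (hq : q ≠ 0) :
    1 ≤ grevlex.degree (X 2 * q) 2 := by
  rw [grevlex.degree_mul (X_ne_zero _) hq, grevlex.degree_X]
  simp

end LeadMonomials

/-! ### Setting a variable to zero, and lead monomials of homogeneous polynomials. -/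

section Vanishing

variable {k : Type*} [Field k]

/-- The endomorphism replacing the variable `i` by `v`. -/
noncomputable def substVar (i : Fin 3) (v : MvPolynomial (Fin 3) k) :
    MvPolynomial (Fin 3) k →ₐ[k] MvPolynomial (Fin 3) k :=
  aeval (Function.update X i v)

theorem substVar_X_self (i : Fin 3) (v : MvPolynomial (Fin 3) k) : substVar i v (X i) = v := by
  simp [substVar]

theorem substVar_X_of_ne {i j : Fin 3} (h : j ≠ i) (v : MvPolynomial (Fin 3) k) :
    substVar i v (X j) = X j := by
  simp [substVar, h]

theorem substVar_C (i : Fin 3) (v : MvPolynomial (Fin 3) k) (c : k) :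
    substVar i v (C c) = C c := by
  rw [← algebraMap_eq, AlgHom.commutes]

theorem substVar_zero_monomial (i : Fin 3) (I : Fin 3 →₀ ℕ) (c : k) :
    substVar i 0 (monomial I c) = if I i = 0 then monomial I c else 0 := by
  have h : substVar i 0 (monomial I c) =
      C c * ∏ j, substVar i 0 (X j : MvPolynomial (Fin 3) k) ^ I j := by
    rw [monomial_eq, Finsupp.prod_fintype _ _ (by simp), map_mul, substVar_C, map_prod]
    simp only [map_pow]
  by_cases h0 : I i = 0
  · have h1 : ∏ j, substVar i 0 (X j : MvPolynomial (Fin 3) k) ^ I j = ∏ j, X j ^ I j := by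
      refine Finset.prod_congr rfl fun j _ => ?_
      by_cases hj : j = i
      · rw [hj, h0, pow_zero, pow_zero]
      · rw [substVar_X_of_ne hj]
    rw [if_pos h0, h, h1, monomial_eq, Finsupp.prod_fintype _ _ (by simp)]
  · have h1 : ∏ j, substVar i 0 (X j : MvPolynomial (Fin 3) k) ^ I j = 0 :=
      Finset.prod_eq_zero (Finset.mem_univ i) (by rw [substVar_X_self, zero_pow h0])
    rw [if_neg h0, h, h1, mul_zero]

theorem coeff_substVar_zero (i : Fin 3) (I : Fin 3 →₀ ℕ) (q : MvPolynomial (Fin 3) k) :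
    coeff I (substVar i 0 q) = if I i = 0 then coeff I q else 0 := by
  induction q using MvPolynomial.induction_on' with
  | monomial J c =>
    classical
    rw [substVar_zero_monomial]
    by_cases hJ : J = I
    · subst hJ
      split_ifs <;> simp
    · split_ifs <;> simp [coeff_monomial, hJ]
  | add p q hp hq =>
    rw [map_add, coeff_add, hp, hq]
    split_ifs <;> simp

theorem exists_eq_X_mul {i : Fin 3} {q : MvPolynomial (Fin 3) k} (h : substVar i 0 q = 0) :
    ∃ r, q = X i * r := by
  suffices ∀ q : MvPolynomial (Fin 3) k, ∃ r, q = substVar i 0 q + X i * r by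
    obtain ⟨r, hr⟩ := this q
    exact ⟨r, by rw [hr, h, zero_add]⟩
  intro q
  induction q using MvPolynomial.induction_on with
  | C a => exact ⟨0, by rw [substVar_C, mul_zero, add_zero]⟩
  | add p q hp hq =>
    obtain ⟨r, hr⟩ := hp
    obtain ⟨s, hs⟩ := hq
    refine ⟨r + s, ?_⟩
    rw [map_add]
    linear_combination hr + hs
  | mul_X p j hp =>
    obtain ⟨r, hr⟩ := hp
    rw [map_mul]
    by_cases hj : j = i
    · exact ⟨p, by rw [hj, substVar_X_self]; ring⟩
    · refine ⟨r * X j, ?_⟩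
      rw [substVar_X_of_ne hj]
      linear_combination X j * hr

theorem degreeOf_substVar_zero_le (i j : Fin 3) (q : MvPolynomial (Fin 3) k) :
    (substVar i 0 q).degreeOf j ≤ q.degreeOf j := by
  rw [degreeOf_le_iff]
  intro I hI
  rw [mem_support_iff, coeff_substVar_zero] at hI
  exact monomial_le_degreeOf j (mem_support_iff.2 (ite_ne_right_iff.1 hI).2)

theorem degreeOf_le_of_X_mul {i j : Fin 3} (hij : i ≠ j) {q : MvPolynomial (Fin 3) k} :
    q.degreeOf j ≤ (X i * q).degreeOf j := by
  rw [degreeOf_le_iff]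
  intro I hI
  have : I + Finsupp.single i 1 ∈ (X i * q).support := by
    rw [mem_support_iff, mul_comm, coeff_mul_X]
    exact mem_support_iff.1 hI
  simpa [hij] using monomial_le_degreeOf j this

theorem isHomogeneous_of_X_mul {i : Fin 3} {q : MvPolynomial (Fin 3) k} {n : ℕ}
    (h : (X i * q).IsHomogeneous (n + 1)) : q.IsHomogeneous n := by
  intro I hI
  have : coeff (I + Finsupp.single i 1) (X i * q) ≠ 0 := by rwa [mul_comm, coeff_mul_X]
  have := h this
  rw [map_add, Finsupp.weight_single] at this
  simpa using this

theorem isHomogeneous_of_X_pow_mul {i : Fin 3} {q : MvPolynomial (Fin 3) k} {n m : ℕ}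
    (h : (X i ^ m * q).IsHomogeneous (n + m)) : q.IsHomogeneous n := by
  induction m with
  | zero => simpa using h
  | succ m ih =>
    refine ih (isHomogeneous_of_X_mul (i := i) ?_)
    rwa [← mul_assoc, ← pow_succ']

theorem IsHomogeneous.sum_eq {q : MvPolynomial (Fin 3) k} {n : ℕ} (hq : q.IsHomogeneous n)
    {I : Fin 3 →₀ ℕ} (hI : coeff I q ≠ 0) : I 0 + I 1 + I 2 = n := by
  have h1 := hq hI
  rw [Finsupp.weight_apply, Finsupp.sum_fintype _ _ (by simp), Fin.sum_univ_three] at h1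
  simpa using h1

/-- A homogeneous polynomial with a pure power of `y` as value at `x = 0`. -/
theorem degree_eq_single_one {q : MvPolynomial (Fin 3) k} {n : ℕ} {c : k} (hq : q.IsHomogeneous n)
    (hc : c ≠ 0) (h : substVar 2 0 q = C c * X 1 ^ n) :
    grevlex.degree q = Finsupp.single 1 n ∧ grevlex.leadingCoeff q = c := by
  have key : ∀ I : Fin 3 →₀ ℕ, I 2 = 0 →
      coeff I q = coeff I (C c * X 1 ^ n : MvPolynomial (Fin 3) k) := by
    intro I hI
    rw [← h, coeff_substVar_zero, if_pos hI]
  have hlead : coeff (Finsupp.single 1 n) q = c := by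
    rw [key _ (by simp), coeff_C_mul, coeff_X_pow, if_pos rfl, mul_one]
  have hdeg : grevlex.degree q = Finsupp.single 1 n := by
    apply grevlex.toSyn.injective
    refine le_antisymm ?_ (grevlex.le_degree (mem_support_iff.2 (by rw [hlead]; exact hc)))
    rw [grevlex.degree_le_iff]
    intro I hI
    by_cases hI2 : I 2 = 0
    · have h1 := mem_support_iff.1 hI
      rw [key I hI2, coeff_C_mul, coeff_X_pow] at h1
      by_cases h2 : Finsupp.single 1 n = I
      · rw [h2]
      · simp [h2] at h1
    -- Among monomials of one degree, those divisible by x lie below those that are not.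
    · apply le_of_lt
      rw [grevlex_lt_iff]
      have h1 := IsHomogeneous.sum_eq hq (mem_support_iff.1 hI)
      simp at h1 ⊢
      omega
  refine ⟨hdeg, ?_⟩
  rw [MonomialOrder.leadingCoeff, hdeg, hlead]

/-- In this order z^n is the largest of all monomials of degree n. -/
theorem degree_eq_single_zero {q : MvPolynomial (Fin 3) k} {n : ℕ} (hq : q.IsHomogeneous n)
    (h : coeff (Finsupp.single 0 n) q ≠ 0) : grevlex.degree q = Finsupp.single 0 n := by
  apply grevlex.toSyn.injective
  refine le_antisymm ?_ (grevlex.le_degree (mem_support_iff.2 h))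
  rw [grevlex.degree_le_iff]
  intro I hI
  rw [← not_lt, grevlex_lt_iff]
  have := IsHomogeneous.sum_eq hq (mem_support_iff.1 hI)
  simp
  omega

/-- The coefficient of the pure power of `z` is the value at `z = 1`, `y = x = 0`. -/
theorem coeff_single_zero {q : MvPolynomial (Fin 3) k} {n : ℕ} (hq : q.IsHomogeneous n) :
    coeff (Finsupp.single 0 n) q = aeval ![(1 : k), 0, 0] q := by
  have hval : ∀ (I : Fin 3 →₀ ℕ) (c : k), aeval ![(1 : k), 0, 0] (monomial I c) =
      c * (0 ^ I 1 * 0 ^ I 2) := by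
    intro I c
    rw [aeval_monomial, Finsupp.prod_fintype _ _ (by simp), Fin.prod_univ_three]
    simp
  conv_rhs => rw [q.as_sum]
  rw [map_sum, Finset.sum_eq_single (Finsupp.single 0 n)]
  · rw [hval]
    simp
  · intro I hI hne
    have hsum := IsHomogeneous.sum_eq hq (mem_support_iff.1 hI)
    rw [hval]
    by_cases h1 : I 1 = 0
    · by_cases h2 : I 2 = 0
      · refine absurd (Finsupp.ext fun i => ?_) hne
        fin_cases i <;> simp <;> omega
      · simp [h2]
    · simp [h1]
  · intro h
    rw [notMem_support_iff.1 h, monomial_zero, map_zero]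

end Vanishing

/-! ### Subduction and SAGBI bases. -/

section Subduction

variable {k : Type*} [Field k]

theorem degree_sub_lt_of_leadingTerm_eq {p q : MvPolynomial (Fin 3) k}
    (h : grevlex.leadingTerm p = grevlex.leadingTerm q) (hpq : p - q ≠ 0) :
    grevlex.toSyn (grevlex.degree (p - q)) < grevlex.toSyn (grevlex.degree q) := by
  have hd : grevlex.degree p = grevlex.degree q := by
    rw [← grevlex.degree_leadingTerm p, h, grevlex.degree_leadingTerm]
  have hc : grevlex.leadingCoeff p = grevlex.leadingCoeff q := by
    rw [← grevlex.leadingCoeff_leadingTerm p, h, grevlex.leadingCoeff_leadingTerm]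
  refine lt_of_le_of_ne ?_ fun he => ?_
  · have := grevlex.degree_sub_le (f := p) (g := q)
    rwa [hd, sup_idem] at this
  · have h1 := grevlex.coeff_degree_ne_zero_iff.2 hpq
    rw [grevlex.toSyn.injective he, coeff_sub] at h1
    apply h1
    have h2 : coeff (grevlex.degree q) p = grevlex.leadingCoeff p := by
      rw [MonomialOrder.leadingCoeff, hd]
    rw [h2, hc]
    exact sub_self _

theorem SubductsToZero.aeval_eq {ι : Type*} {g : ι → MvPolynomial (Fin 3) k}
    {q : MvPolynomial (Fin 3) k} {S : MvPolynomial ι k} (h : SubductsToZero g q S) :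
    aeval g S = q := by
  induction h with
  | zero => simp
  | step q I c S hq hlt hS ih => rw [map_add, ih]; ring

theorem SubductsToZero.coeff_ne_zero {ι : Type*} {g : ι → MvPolynomial (Fin 3) k}
    {q : MvPolynomial (Fin 3) k} {I : ι →₀ ℕ} {c : k} (hq : q ≠ 0)
    (hlt : grevlex.leadingTerm (aeval g (monomial I c)) = grevlex.leadingTerm q) : c ≠ 0 := by
  rintro rfl
  rw [monomial_zero, map_zero, grevlex.leadingTerm_zero, eq_comm,
    grevlex.leadingTerm_eq_zero_iff] at hlt
  exact hq hlt

/-- Lead monomials strictly decrease along a subduction. This bounds the exponents in an arbitrary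
subduction record `S`, about which nothing else is known. -/
theorem SubductsToZero.degree_le {ι : Type*} {g : ι → MvPolynomial (Fin 3) k}
    (hg : ∀ i, g i ≠ 0) {q : MvPolynomial (Fin 3) k} {S : MvPolynomial ι k}
    (h : SubductsToZero g q S) :
    ∀ I ∈ S.support, grevlex.toSyn (grevlex.degree (aeval g (monomial I (1 : k)))) ≤
      grevlex.toSyn (grevlex.degree q) := by
  classical
  induction h with
  | zero => simp
  | step q I c S hq hlt hS ih =>
    intro J hJ
    have hd : grevlex.degree (aeval g (monomial I c)) = grevlex.degree q := by
      rw [← grevlex.degree_leadingTerm, hlt, grevlex.degree_leadingTerm]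
    rcases Finset.mem_union.1 (support_add hJ) with h1 | h1
    · have := support_monomial_subset h1
      rw [Finset.mem_singleton] at this
      rw [this, ← hd, degree_aeval_monomial hg I one_ne_zero,
        degree_aeval_monomial hg I (SubductsToZero.coeff_ne_zero hq hlt)]
    · refine le_trans (ih J h1) ?_
      by_cases h0 : aeval g (monomial I c) - q = 0
      · rw [← neg_sub, h0, neg_zero, grevlex.degree_zero, map_zero]
        exact grevlex.zero_le _
      · rw [← neg_sub, grevlex.degree_neg]
        exact (degree_sub_lt_of_leadingTerm_eq hlt h0).le

theorem isHomogeneous_aeval_monomial {ι : Type*} {g : ι → MvPolynomial (Fin 3) k} {w : ι → ℕ}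
    (hw : ∀ i, (g i).IsHomogeneous (w i)) (I : ι →₀ ℕ) (c : k) :
    (aeval g (monomial I c)).IsHomogeneous (I.sum fun i n => w i * n) := by
  rw [aeval_monomial, algebraMap_eq]
  refine IsHomogeneous.C_mul ?_ c
  exact IsHomogeneous.prod _ _ _ fun i _ => (hw i).pow _

/-- Each cancelled term shares its lead monomial with a homogeneous polynomial of degree `D`, so its
weight is `D`. The relation that is produced is thus weighted homogeneous, which is needed for the
minimality of the generators. -/
theorem SubductsToZero.sum_eq {ι : Type*} {g : ι → MvPolynomial (Fin 3) k}
    (hg : ∀ i, g i ≠ 0) {w : ι → ℕ} (hw : ∀ i, (g i).IsHomogeneous (w i)) {D : ℕ}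
    {q : MvPolynomial (Fin 3) k} {S : MvPolynomial ι k} (h : SubductsToZero g q S)
    (hD : q.IsHomogeneous D) : ∀ I ∈ S.support, (I.sum fun i n => w i * n) = D := by
  classical
  induction h with
  | zero => simp
  | step q I c S hq hlt hS ih =>
    have hc := SubductsToZero.coeff_ne_zero hq hlt
    have hd : grevlex.degree (aeval g (monomial I c)) = grevlex.degree q := by
      rw [← grevlex.degree_leadingTerm, hlt, grevlex.degree_leadingTerm]
    have hI : (I.sum fun i n => w i * n) = D := by
      have h1 := hD (grevlex.coeff_degree_ne_zero_iff.2 hq)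
      have h2 := (isHomogeneous_aeval_monomial hw I c)
        (grevlex.coeff_degree_ne_zero_iff.2 (aeval_monomial_ne_zero hg I hc))
      rw [← h1, ← h2, hd]
    intro J hJ
    rcases Finset.mem_union.1 (support_add hJ) with h1 | h1
    · have := support_monomial_subset h1
      rw [Finset.mem_singleton] at this
      rw [this, hI]
    · exact ih (hD.sub (hI ▸ isHomogeneous_aeval_monomial hw I c)) J h1

/-- The order is a well-order on monomials, and the remainder stays in `R`, so its lead monomial is
again one of a product of generators. -/
theorem exists_subductsToZero {ι : Type*} {g : ι → MvPolynomial (Fin 3) k}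
    (hg : ∀ i, g i ≠ 0) {R : Subalgebra k (MvPolynomial (Fin 3) k)} (hR : ∀ i, g i ∈ R)
    (hlead : ∀ F ∈ R, F ≠ 0 →
      ∃ I : ι →₀ ℕ, grevlex.degree F = grevlex.degree (aeval g (monomial I (1 : k)))) :
    ∀ q ∈ R, ∃ S, SubductsToZero g q S := by
  suffices ∀ s : grevlex.syn, ∀ q ∈ R, grevlex.toSyn (grevlex.degree q) = s →
      ∃ S, SubductsToZero g q S from fun q hq => this _ q hq rfl
  intro s
  induction s using WellFoundedLT.induction with
  | ind s ih =>
  intro q hq hs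
  by_cases h0 : q = 0
  · exact ⟨0, h0 ▸ .zero⟩
  obtain ⟨I, hI⟩ := hlead q hq h0
  set m := aeval g (monomial I (1 : k)) with hm
  have hm0 : m ≠ 0 := aeval_monomial_ne_zero hg I one_ne_zero
  set c := grevlex.leadingCoeff q / grevlex.leadingCoeff m with hc
  have hlm := grevlex.leadingCoeff_ne_zero_iff.2 hm0
  have hc0 : c ≠ 0 := div_ne_zero (grevlex.leadingCoeff_ne_zero_iff.2 h0) hlm
  have hcm : aeval g (monomial I c) = C c * m := by
    rw [hm, aeval_monomial, aeval_monomial, map_one, one_mul, algebraMap_eq]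
  have hlt : grevlex.leadingTerm (aeval g (monomial I c)) = grevlex.leadingTerm q := by
    rw [hcm, grevlex.leadingTerm_mul, grevlex.leadingTerm_C, MonomialOrder.leadingTerm,
      C_mul_monomial, MonomialOrder.leadingTerm, ← hI, hc, div_mul_cancel₀ _ hlm]
  by_cases h1 : aeval g (monomial I c) - q = 0
  · refine ⟨_, .step q I c 0 h0 hlt ?_⟩
    rw [← neg_sub, h1, neg_zero]
    exact .zero
  · have h2 := degree_sub_lt_of_leadingTerm_eq hlt h1
    rw [← grevlex.degree_neg, neg_sub, hs] at h2
    have hmR : aeval g (monomial I c) ∈ R := by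
      rw [aeval_monomial]
      exact R.mul_mem (R.algebraMap_mem c) (R.prod_mem fun i _ => R.pow_mem (hR i) _)
    obtain ⟨S, hS⟩ := ih _ h2 _ (R.sub_mem hq hmR) rfl
    exact ⟨_, .step q I c S h0 hlt hS⟩

theorem isSagbiBasis_range {ι : Type*} {g : ι → MvPolynomial (Fin 3) k}
    (hg : ∀ i, g i ≠ 0) {R : Subalgebra k (MvPolynomial (Fin 3) k)} (hR : ∀ i, g i ∈ R)
    (hlead : ∀ F ∈ R, F ≠ 0 →
      ∃ I : ι →₀ ℕ, grevlex.degree F = grevlex.degree (aeval g (monomial I (1 : k)))) :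
    IsSagbiBasis (Set.range g) R := by
  have hsub : Set.range g ⊆ R := by
    rintro _ ⟨i, rfl⟩
    exact hR i
  refine ⟨hsub, le_antisymm ?_ ?_⟩
  · refine Algebra.adjoin_mono ?_
    rintro m ⟨f, hf, h⟩
    exact (show _ ∈ {m | ∃ f ∈ (R : Set (MvPolynomial (Fin 3) k)), f ≠ 0 ∧
      m = monomial (grevlex.degree f) (1 : k)} from ⟨f, hsub hf, h⟩)
  · refine Algebra.adjoin_le ?_
    rintro _ ⟨F, hF, hF0, rfl⟩
    obtain ⟨I, hI⟩ := hlead F hF hF0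
    rw [hI, degree_aeval_monomial hg I one_ne_zero, Finsupp.sum, monomial_sum_one]
    refine Subalgebra.prod_mem _ fun i _ => ?_
    have : monomial (I i • grevlex.degree (g i)) (1 : k) =
        monomial (grevlex.degree (g i)) 1 ^ I i := by rw [monomial_pow, one_pow]
    rw [this]
    exact Subalgebra.pow_mem _ (Algebra.subset_adjoin
      (show _ ∈ {m | ∃ f ∈ Set.range g, f ≠ 0 ∧ m = monomial (grevlex.degree f) (1 : k)} from
        ⟨g i, ⟨i, rfl⟩, hg i, rfl⟩)) _

theorem adjoin_range_eq {ι : Type*} {g : ι → MvPolynomial (Fin 3) k}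
    (hg : ∀ i, g i ≠ 0) {R : Subalgebra k (MvPolynomial (Fin 3) k)} (hR : ∀ i, g i ∈ R)
    (hlead : ∀ F ∈ R, F ≠ 0 →
      ∃ I : ι →₀ ℕ, grevlex.degree F = grevlex.degree (aeval g (monomial I (1 : k)))) :
    Algebra.adjoin k (Set.range g) = R := by
  refine le_antisymm (Algebra.adjoin_le ?_) fun q hq => ?_
  · rintro _ ⟨i, rfl⟩
    exact hR i
  · obtain ⟨S, hS⟩ := exists_subductsToZero hg hR hlead q hq
    rw [← hS.aeval_eq, Algebra.adjoin_range_eq_range_aeval]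
    exact ⟨S, rfl⟩

end Subduction

/-! ### Four generators with lead monomials x, y^a, y^b, z^d. -/

section LeadShape

variable {k : Type*} [Field k]

/-- A family `x, f, h, N` with lead monomials `x`, `y^a`, `y^b`, `z^d`, where `a` and `b` are
coprime. -/
structure LeadShape (g : Fin 4 → MvPolynomial (Fin 3) k) (a b d : ℕ) : Prop where
  zero : g 0 = X 2
  ne_zero : ∀ i, g i ≠ 0
  one : grevlex.degree (g 1) = Finsupp.single 1 a
  two : grevlex.degree (g 2) = Finsupp.single 1 b
  three : grevlex.degree (g 3) = Finsupp.single 0 d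
  coprime : a.Coprime b
  a_pos : 0 < a
  d_pos : 0 < d

variable {g : Fin 4 → MvPolynomial (Fin 3) k} {a b d : ℕ}

theorem LeadShape.degree_eq (hg : LeadShape g a b d) (I : Fin 4 →₀ ℕ) {c : k} (hc : c ≠ 0) :
    grevlex.degree (aeval g (monomial I c)) =
      Finsupp.single 2 (I 0) + Finsupp.single 1 (a * I 1 + b * I 2)
        + Finsupp.single 0 (d * I 3) := by
  rw [degree_aeval_monomial hg.ne_zero I hc, Finsupp.sum_fintype _ _ (by simp),
    Fin.sum_univ_four, hg.zero, hg.one, hg.two, hg.three, grevlex.degree_X]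
  ext i
  fin_cases i <;> simp <;> ring

/-- The exponent of y is a I₁ + b I₂. Modulo a it determines I₂, as b is invertible modulo a and I₂
< a; then I₁ follows. -/
theorem LeadShape.injOn (hg : LeadShape g a b d) :
    Set.InjOn (fun I => grevlex.degree (aeval g (monomial I (1 : k)))) {I | I 2 < a} := by
  intro I hI J hJ h
  simp only [Set.mem_ofPred_eq] at hI hJ
  simp only [hg.degree_eq _ one_ne_zero] at h
  have h0 := DFunLike.congr_fun h 0
  have h1 := DFunLike.congr_fun h 1
  have h2 := DFunLike.congr_fun h 2
  simp at h0 h1 h2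
  have h3 : I 3 = J 3 := h0.resolve_right hg.d_pos.ne'
  have h4 : I 2 = J 2 := by
    have : b * I 2 ≡ b * J 2 [MOD a] := by
      have e1 : a * I 1 + b * I 2 ≡ b * I 2 [MOD a] := by simp [Nat.ModEq]
      have e2 : a * J 1 + b * J 2 ≡ b * J 2 [MOD a] := by simp [Nat.ModEq]
      exact e1.symm.trans (h1 ▸ e2)
    exact Nat.ModEq.eq_of_lt_of_lt (Nat.ModEq.cancel_left_of_coprime hg.coprime this) hI hJ
  have h5 : I 1 = J 1 := by
    rw [h4] at h1
    exact Nat.eq_of_mul_eq_mul_left hg.a_pos (by omega)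
  ext i
  fin_cases i <;> assumption

theorem LeadShape.degreeOf_lt_iff (hg : LeadShape g a b d) {P : MvPolynomial (Fin 4) k} :
    P.degreeOf 2 < a ↔ ∀ I ∈ P.support, I 2 < a := MvPolynomial.degreeOf_lt_iff hg.a_pos

theorem LeadShape.exists_degree_aeval_eq (hg : LeadShape g a b d) {P : MvPolynomial (Fin 4) k}
    (hP : P ≠ 0) (hPa : P.degreeOf 2 < a) :
    ∃ I ∈ P.support, aeval g P ≠ 0 ∧
      grevlex.degree (aeval g P) = grevlex.degree (aeval g (monomial I (1 : k))) :=
  ElemAbelian.exists_degree_aeval_eq hg.ne_zero hP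
    (hg.injOn.mono fun _ hI => hg.degreeOf_lt_iff.1 hPa _ hI)

/-- Division by a polynomial that is monic of degree `a` in the third variable. -/
theorem exists_degreeOf_lt_sub_mem (ha : 0 < a) {Q : MvPolynomial (Fin 4) k}
    (hQ : Q.degreeOf 2 < a) (P : MvPolynomial (Fin 4) k) :
    ∃ P' : MvPolynomial (Fin 4) k, P'.degreeOf 2 < a ∧ P - P' ∈ Ideal.span {X 2 ^ a - Q} := by
  set J : Ideal (MvPolynomial (Fin 4) k) := Ideal.span {X 2 ^ a - Q} with hJ
  have hadd : ∀ P₁ P₂ : MvPolynomial (Fin 4) k,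
      (∃ P' : MvPolynomial (Fin 4) k, P'.degreeOf 2 < a ∧ P₁ - P' ∈ J) →
      (∃ P' : MvPolynomial (Fin 4) k, P'.degreeOf 2 < a ∧ P₂ - P' ∈ J) →
      ∃ P' : MvPolynomial (Fin 4) k, P'.degreeOf 2 < a ∧ P₁ + P₂ - P' ∈ J := by
    rintro P₁ P₂ ⟨A, hA, hA'⟩ ⟨B, hB, hB'⟩
    refine ⟨A + B, lt_of_le_of_lt (degreeOf_add_le _ _ _) (max_lt hA hB), ?_⟩
    have := J.add_mem hA' hB'
    rwa [sub_add_sub_comm] at this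
  have hself : ∀ P : MvPolynomial (Fin 4) k, P.degreeOf 2 < a →
      ∃ P' : MvPolynomial (Fin 4) k, P'.degreeOf 2 < a ∧ P - P' ∈ J :=
    fun P hP => ⟨P, hP, by simp⟩
  have hmon : ∀ (n : ℕ) (I : Fin 4 →₀ ℕ) (c : k), I 2 = 0 →
      ∃ P' : MvPolynomial (Fin 4) k, P'.degreeOf 2 < a ∧ monomial I c * X 2 ^ n - P' ∈ J := by
    have hX : ∀ P : MvPolynomial (Fin 4) k, P.degreeOf 2 < a →
        ∃ P' : MvPolynomial (Fin 4) k, P'.degreeOf 2 < a ∧ P * X 2 - P' ∈ J := by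
      intro P hP
      rw [P.as_sum, Finset.sum_mul]
      refine Finset.sum_induction _
        (fun P => ∃ P' : MvPolynomial (Fin 4) k, P'.degreeOf 2 < a ∧ P - P' ∈ J)
        hadd (hself 0 (by simpa using ha)) fun I hI => ?_
      have hI2 : I 2 < a := (degreeOf_lt_iff ha).1 hP I hI
      by_cases h : I 2 + 1 < a
      · refine hself _ (lt_of_le_of_lt (degreeOf_mul_le _ _ _) ?_)
        rw [degreeOf_monomial_eq _ _ (mem_support_iff.1 hI), degreeOf_X]
        simpa using h
      -- Multiplication by the variable overshoots only from exponent a - 1, and then the factor `X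
      -- 2 ^ a` is replaced by `Q`.
      · have h2 : I 2 + 1 = a := by omega
        refine ⟨monomial (I.erase 2) (coeff I P) * Q, lt_of_le_of_lt (degreeOf_mul_le _ _ _) ?_, ?_⟩
        · rw [degreeOf_monomial_eq _ _ (mem_support_iff.1 hI)]
          simpa using hQ
        · have h3 : monomial I (coeff I P) * X 2 =
              monomial (I.erase 2) (coeff I P) * X 2 ^ a := by
            have h4 : I + Finsupp.single 2 1 = I.erase 2 + Finsupp.single 2 (I 2 + 1) := by
              rw [Finsupp.single_add, ← add_assoc, Finsupp.erase_add_single]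
            rw [← h2, X_pow_eq_monomial, X, monomial_mul, monomial_mul, h4]
          rw [h3, ← mul_sub]
          exact J.mul_mem_left _ (Ideal.subset_span rfl)
    intro n I c hI
    induction n with
    | zero =>
      rw [pow_zero, mul_one]
      by_cases hc : c = 0
      · rw [hc, monomial_zero]
        exact hself 0 (by simpa using ha)
      · exact hself _ (by rw [degreeOf_monomial_eq _ _ hc, hI]; exact ha)
    | succ n ih =>
      obtain ⟨P', hP', hm⟩ := ih
      obtain ⟨P'', hP'', hm'⟩ := hX P' hP'
      refine ⟨P'', hP'', ?_⟩
      have := J.add_mem (J.mul_mem_right (X 2) hm) hm'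
      rwa [sub_mul, sub_add_sub_cancel, mul_assoc, ← pow_succ] at this
  rw [P.as_sum]
  refine Finset.sum_induction _
    (fun P => ∃ P' : MvPolynomial (Fin 4) k, P'.degreeOf 2 < a ∧ P - P' ∈ J)
    hadd (hself 0 (by simpa using ha)) fun I _ => ?_
  have : monomial I (coeff I P) = monomial (I.erase 2) (coeff I P) * X 2 ^ I 2 := by
    rw [X_pow_eq_monomial, monomial_mul, mul_one, Finsupp.erase_add_single]
  rw [this]
  exact hmon _ _ _ (by simp)

/-- If `h^a` is a combination of the products `x^i f^j h^l N^m` with `l < a`, and the algebra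
generated by the family agrees with `R` after inverting `x`, then the lead monomials of the family
generate those of `R`. -/
theorem LeadShape.exists_degree_eq (hg : LeadShape g a b d)
    {R : Subalgebra k (MvPolynomial (Fin 3) k)} {Q : MvPolynomial (Fin 4) k}
    (hQ : Q.degreeOf 2 < a) (hrel : aeval g Q = g 2 ^ a)
    (hloc : ∀ F ∈ R, ∃ n : ℕ, X 2 ^ n * F ∈ Algebra.adjoin k (Set.range g)) :
    ∀ F ∈ R, F ≠ 0 →
      ∃ I : Fin 4 →₀ ℕ, grevlex.degree F = grevlex.degree (aeval g (monomial I (1 : k))) := by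
  have hnormal : ∀ q ∈ Algebra.adjoin k (Set.range g),
      ∃ P : MvPolynomial (Fin 4) k, P.degreeOf 2 < a ∧ aeval g P = q := by
    intro q hq
    rw [Algebra.adjoin_range_eq_range_aeval] at hq
    obtain ⟨P, rfl⟩ := hq
    obtain ⟨P', hP', hm⟩ := exists_degreeOf_lt_sub_mem hg.a_pos hQ P
    refine ⟨P', hP', ?_⟩
    obtain ⟨A, hA⟩ := Ideal.mem_span_singleton'.1 hm
    have := congrArg (aeval g) hA
    rw [map_mul, map_sub, hrel, map_pow, aeval_X, sub_self, mul_zero, map_sub] at this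
    exact (sub_eq_zero.1 this.symm).symm
  -- Write P = X₀ P₁ + P₀ with P₀ free of X₀. The value of P₀ is divisible by x, but if P₀ ≠ 0 its
  -- lead monomial is that of a product without x. So P₀ = 0 and P₁ represents F.
  have hdiv : ∀ F : MvPolynomial (Fin 3) k,
      (∃ P : MvPolynomial (Fin 4) k, P.degreeOf 2 < a ∧ aeval g P = X 2 * F) →
      ∃ P : MvPolynomial (Fin 4) k, P.degreeOf 2 < a ∧ aeval g P = F := by
    rintro F ⟨P, hPa, hP⟩
    set P₁ := P.divMonomial (Finsupp.single 0 1)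
    set P₀ := P.modMonomial (Finsupp.single 0 1)
    have hsplit : X 0 * P₁ + P₀ = P := divMonomial_add_modMonomial_single P 0
    have hP₁ : P₁.degreeOf 2 < a := by
      rw [hg.degreeOf_lt_iff]
      intro I hI
      have : Finsupp.single 0 1 + I ∈ P.support := by
        rw [mem_support_iff, ← coeff_divMonomial]
        exact mem_support_iff.1 hI
      simpa using hg.degreeOf_lt_iff.1 hPa _ this
    have hI0 : ∀ I ∈ P₀.support, I 0 = 0 := by
      intro I hI
      by_contra h
      refine mem_support_iff.1 hI (coeff_modMonomial_of_le _ ?_)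
      rw [Finsupp.single_le_iff]
      omega
    have hP₀ : P₀.degreeOf 2 < a := by
      rw [hg.degreeOf_lt_iff]
      intro I hI
      refine hg.degreeOf_lt_iff.1 hPa _ ?_
      have hle : ¬ Finsupp.single 0 1 ≤ I := by
        rw [Finsupp.single_le_iff, hI0 I hI]
        omega
      rw [mem_support_iff, ← coeff_modMonomial_of_not_le _ hle]
      exact mem_support_iff.1 hI
    have hev : aeval g P₀ = X 2 * (F - aeval g P₁) := by
      rw [← hsplit, map_add, map_mul, aeval_X, hg.zero] at hP
      rw [mul_sub, ← hP]
      ring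
    by_cases h0 : P₀ = 0
    · refine ⟨P₁, hP₁, ?_⟩
      rw [h0, map_zero, eq_comm, mul_eq_zero] at hev
      exact (sub_eq_zero.1 (hev.resolve_left (X_ne_zero _))).symm
    · obtain ⟨I, hI, hne, hdeg⟩ := hg.exists_degree_aeval_eq h0 hP₀
      rw [hg.degree_eq I one_ne_zero, hev] at hdeg
      rw [hev] at hne
      have h1 := X_two_dvd_degree (right_ne_zero_of_mul hne)
      rw [hdeg] at h1
      simp [hI0 I hI] at h1
  intro F hF hF0
  obtain ⟨n, hn⟩ := hloc F hF
  obtain ⟨P, hPa, hP⟩ : ∃ P : MvPolynomial (Fin 4) k, P.degreeOf 2 < a ∧ aeval g P = F := by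
    -- The n factors x are removed one at a time.
    have h := hnormal _ hn
    clear hn
    induction n with
    | zero => simpa using h
    | succ n ih => exact ih (hdiv _ (by rwa [pow_succ', mul_assoc] at h))
  have hP0 : P ≠ 0 := by
    rintro rfl
    exact hF0 (by rw [← hP, map_zero])
  obtain ⟨I, _, _, hdeg⟩ := hg.exists_degree_aeval_eq hP0 hPa
  exact ⟨I, by rw [← hP, hdeg]⟩

/-- By `hlc` the lead terms of f^b and h^a agree, so the difference has a lead monomial below
y^(ab). Every product occurring in `S` is then too small to be f^b or to contain h^a. -/
theorem LeadShape.singleRelation_aux (hg : LeadShape g a b d)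
    (hlc : grevlex.leadingCoeff (g 1) ^ b = grevlex.leadingCoeff (g 2) ^ a)
    {S : MvPolynomial (Fin 4) k}
    (hS : SubductsToZero g (aeval g (monomial (Finsupp.single 1 b) (1 : k)
      - monomial (Finsupp.single 2 a) 1)) S) :
    ∀ I ∈ S.support, I 2 < a ∧ I ≠ Finsupp.single 1 b := by
  intro I hI
  have hd1 : grevlex.degree (aeval g (monomial (Finsupp.single 1 b) (1 : k))) =
      Finsupp.single 1 (a * b) := by
    rw [hg.degree_eq _ one_ne_zero]
    simp
  have hd2 : grevlex.degree (aeval g (monomial (Finsupp.single 2 a) (1 : k))) =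
      Finsupp.single 1 (b * a) := by
    rw [hg.degree_eq _ one_ne_zero]
    simp
  have hle := hS.degree_le hg.ne_zero I hI
  rw [map_sub] at hle
  by_cases h0 : aeval g (monomial (Finsupp.single 1 b) (1 : k))
      - aeval g (monomial (Finsupp.single 2 a) (1 : k)) = 0
  -- If f^b = h^a, the only subduction is the empty one.
  · rw [map_sub, h0] at hS
    cases hS with
    | zero => simp at hI
    | step _ _ _ _ hq => exact absurd rfl hq
  have hlt : grevlex.leadingTerm (aeval g (monomial (Finsupp.single 1 b) (1 : k))) =
      grevlex.leadingTerm (aeval g (monomial (Finsupp.single 2 a) (1 : k))) := by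
    have e1 : aeval g (monomial (Finsupp.single 1 b) (1 : k)) = g 1 ^ b := by
      rw [aeval_monomial]
      simp
    have e2 : aeval g (monomial (Finsupp.single 2 a) (1 : k)) = g 2 ^ a := by
      rw [aeval_monomial]
      simp
    rw [MonomialOrder.leadingTerm, MonomialOrder.leadingTerm, hd1, hd2, e1, e2,
      grevlex.leadingCoeff_pow, grevlex.leadingCoeff_pow, hlc, mul_comm]
  have h1 := degree_sub_lt_of_leadingTerm_eq hlt h0
  have h2 := lt_of_le_of_lt hle h1
  rw [hd2, hg.degree_eq I one_ne_zero] at h2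
  -- Otherwise the lead monomial of the product would be a multiple of y^(ab), and divisibility is
  -- compatible with the order.
  have h3 : a * I 1 + b * I 2 < b * a := by
    by_contra h
    refine absurd h2 (not_lt.2 (grevlex.toSyn_monotone ?_))
    intro i
    fin_cases i <;> simp
    omega
  refine ⟨?_, ?_⟩
  · by_contra h
    push Not at h
    have := Nat.mul_le_mul_left b h
    omega
  · rintro rfl
    simp at h3
    rw [mul_comm] at h3
    omega

/-- A family whose lead monomials generate those of `R` generates `R`, with a single relation. -/
theorem LeadShape.singleRelation (hg : LeadShape g a b d)
    {R : Subalgebra k (MvPolynomial (Fin 3) k)} (hR : ∀ i, g i ∈ R)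
    (hlead : ∀ F ∈ R, F ≠ 0 →
      ∃ I : Fin 4 →₀ ℕ, grevlex.degree F = grevlex.degree (aeval g (monomial I (1 : k))))
    (hlc : grevlex.leadingCoeff (g 1) ^ b = grevlex.leadingCoeff (g 2) ^ a) :
    SingleRelationBySubducting g R (Finsupp.single 1 b) (Finsupp.single 2 a) := by
  refine ⟨adjoin_range_eq hg.ne_zero hR hlead, ?_, ?_, ?_⟩
  · rw [hg.degree_eq _ one_ne_zero, hg.degree_eq _ one_ne_zero]
    simp [mul_comm]
  · refine exists_subductsToZero hg.ne_zero hR hlead _ ?_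
    have hmem : ∀ I : Fin 4 →₀ ℕ, aeval g (monomial I (1 : k)) ∈ R := by
      intro I
      rw [aeval_monomial]
      exact R.mul_mem (R.algebraMap_mem _) (R.prod_mem fun i _ => R.pow_mem (hR i) _)
    rw [map_sub]
    exact R.sub_mem (hmem _) (hmem _)
  · intro S hS
    have haux := hg.singleRelation_aux hlc hS
    have hne : Finsupp.single (2 : Fin 4) a ≠ Finsupp.single 1 b := by
      intro h
      have := DFunLike.congr_fun h 2
      simp at this
      exact hg.a_pos.ne' this
    refine ⟨?_, ?_⟩
    · intro h
      -- The term h^a survives in the relation because `S` contains no power of h as high as a.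
      have h1 := congrArg (coeff (Finsupp.single (2 : Fin 4) a)) h
      have h2 : coeff (Finsupp.single (2 : Fin 4) a) S = 0 := by
        by_contra h3
        have := (haux _ (mem_support_iff.2 h3)).1
        simp at this
      simp [coeff_monomial, hne.symm, h2] at h1
    · set Q := monomial (Finsupp.single (1 : Fin 4) b) (1 : k) - S with hQ
      have hQa : Q.degreeOf 2 < a := by
        classical
        rw [hg.degreeOf_lt_iff]
        intro I hI
        rcases Finset.mem_union.1 (support_sub _ _ _ hI) with h | h
        · have := support_monomial_subset h
          rw [Finset.mem_singleton] at this
          rw [this]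
          simpa using hg.a_pos
        · exact (haux I h).1
      have hF : monomial (Finsupp.single (1 : Fin 4) b) (1 : k)
          - monomial (Finsupp.single (2 : Fin 4) a) 1 - S = -(X 2 ^ a - Q) := by
        rw [X_pow_eq_monomial, hQ]
        ring
      have hQev : aeval g (X 2 ^ a - Q) = 0 := by
        have := hS.aeval_eq
        rw [← sub_eq_zero, ← map_sub, ← neg_eq_zero, ← map_neg, neg_sub, hF, map_neg,
          neg_eq_zero] at this
        exact this
      rw [hF, Ideal.span_singleton_neg]
      refine le_antisymm (fun P hP => ?_) ?_
      -- Modulo the relation, P becomes a polynomial P' of degree less than a in h, with the same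
      -- value zero. Distinct lead monomials then force P' = 0.
      · obtain ⟨P', hP', hm⟩ := exists_degreeOf_lt_sub_mem hg.a_pos hQa P
        have h0 : P' = 0 := by
          by_contra h0
          obtain ⟨I, _, h1, _⟩ := hg.exists_degree_aeval_eq h0 hP'
          apply h1
          obtain ⟨A, hA⟩ := Ideal.mem_span_singleton'.1 hm
          have := congrArg (aeval g) hA
          rw [map_mul, hQev, mul_zero, map_sub, RingHom.mem_ker.1 hP, zero_sub, eq_comm,
            neg_eq_zero] at this
          exact this
        rwa [h0, sub_zero] at hm
      · rw [Ideal.span_singleton_le_iff_mem, RingHom.mem_ker]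
        exact hQev

/-- Homogeneous generators with a single relation of a degree that none of them has. -/
theorem LeadShape.isHypersurface (hg : LeadShape g a b d)
    {R : Subalgebra k (MvPolynomial (Fin 3) k)}
    (hrel : SingleRelationBySubducting g R (Finsupp.single 1 b) (Finsupp.single 2 a))
    {w : Fin 4 → ℕ} (hw : ∀ i, (g i).IsHomogeneous (w i)) (hpos : ∀ i, 0 < w i)
    (h1 : w 1 = a) (h2 : w 2 = b) (hne : ∀ i, w i ≠ a * b) (ha : 2 ≤ a) (hb : 2 ≤ b) :
    IsHypersurface R := by
  classical
  obtain ⟨hadj, -, ⟨S, hS⟩, hker⟩ := hrel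
  obtain ⟨hF0, hFker⟩ := hker S hS
  refine ⟨g, fun i => ⟨w i, hpos i, hw i⟩, hadj, ?_, _, hF0, hFker⟩
  have hhom : (aeval g (monomial (Finsupp.single 1 b) (1 : k)
      - monomial (Finsupp.single 2 a) 1)).IsHomogeneous (a * b) := by
    rw [map_sub]
    refine IsHomogeneous.sub ?_ ?_
    · simpa [h1] using isHomogeneous_aeval_monomial hw (Finsupp.single 1 b) (1 : k)
    · simpa [h2, mul_comm] using isHomogeneous_aeval_monomial hw (Finsupp.single 2 a) (1 : k)
  have hsum := hS.sum_eq hg.ne_zero hw hhom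
  have hab : a * b ≠ 0 := by positivity
  -- By weighted homogeneity of degree ab, which is neither zero nor the degree of a generator, the
  -- relation has no constant and no linear terms.
  have hc0 : coeff 0 (monomial (Finsupp.single (1 : Fin 4) b) (1 : k)
      - monomial (Finsupp.single 2 a) 1 - S) = 0 := by
    have e1 : coeff 0 S = 0 := by
      by_contra h
      have := hsum _ (mem_support_iff.2 h)
      simp at this
      omega
    have e2 : Finsupp.single (1 : Fin 4) b ≠ 0 := by simp; omega
    have e3 : Finsupp.single (2 : Fin 4) a ≠ 0 := by simp; omega
    simp [coeff_monomial, e1, e2, e3]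
  have hc1 : ∀ i, coeff (Finsupp.single i 1) (monomial (Finsupp.single (1 : Fin 4) b) (1 : k)
      - monomial (Finsupp.single 2 a) 1 - S) = 0 := by
    intro i
    have e1 : coeff (Finsupp.single i 1) S = 0 := by
      by_contra h
      have := hsum _ (mem_support_iff.2 h)
      simp at this
      exact hne i this
    have e2 : Finsupp.single (1 : Fin 4) b ≠ Finsupp.single i 1 := by
      intro h
      have := congrArg Finsupp.degree h
      simp at this
      omega
    have e3 : Finsupp.single (2 : Fin 4) a ≠ Finsupp.single i 1 := by
      intro h
      have := congrArg Finsupp.degree h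
      simp at this
      omega
    simp [coeff_monomial, e1, e2, e3]
  generalize monomial (Finsupp.single (1 : Fin 4) b) (1 : k)
      - monomial (Finsupp.single 2 a) 1 - S = F at hF0 hFker hc0 hc1
  intro i hi
  have himage : g '' {i}ᶜ = aeval g '' (X '' {i}ᶜ : Set (MvPolynomial (Fin 4) k)) := by
    rw [Set.image_image]
    simp
  rw [himage, ← AlgHom.map_adjoin] at hi
  obtain ⟨P, hP, hPg⟩ := hi
  have hPi : coeff (Finsupp.single i 1) P = 0 := by
    by_contra h
    have hmem : i ∈ P.vars := (mem_vars_iff_mem_support i).2 ⟨_, mem_support_iff.2 h, by simp⟩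
    have := mem_supported.1 (show P ∈ supported k ({i}ᶜ : Set (Fin 4)) from hP) hmem
    simp at this
  -- A redundant generator would give a relation in which X_i has coefficient 1, but no multiple of
  -- F has a linear term.
  have hmem : X i - P ∈ RingHom.ker (aeval g : MvPolynomial (Fin 4) k →ₐ[k] _) := by
    rw [RingHom.mem_ker, map_sub, aeval_X]
    exact sub_eq_zero.2 hPg.symm
  rw [hFker] at hmem
  obtain ⟨A, hA⟩ := Ideal.mem_span_singleton'.1 hmem
  have h := congrArg (coeff (Finsupp.single i 1)) hA
  rw [coeff_mul, Finsupp.antidiagonal_single] at h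
  simp [Finset.Nat.antidiagonal_succ, hc0, hc1, hPi] at h

end LeadShape

/-! ### Invariants of a finite group of translations of one variable. -/

section Translation

/-- The polynomial `r - r(0)` vanishes at all `φ a`, and these are more points than its degree. -/
theorem taylor_eq_self_eq_C {B A : Type*} [CommRing B] [IsDomain B] [AddCommGroup A] [Fintype A]
    (φ : A →+ B) (hφ : Function.Injective φ) {r : Polynomial B}
    (hr : ∀ a, Polynomial.taylor (φ a) r = r) (hdeg : r.natDegree < Fintype.card A) :
    r = Polynomial.C (r.eval 0) := by
  rw [← sub_eq_zero]
  refine Polynomial.eq_zero_of_natDegree_lt_card_of_eval_eq_zero _ hφ (fun a => ?_) ?_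
  · have : r.eval (φ a) = r.eval 0 := by
      conv_rhs => rw [← hr a, Polynomial.taylor_eval, zero_add]
    simp [this]
  · rwa [Polynomial.natDegree_sub_C]

/-- A polynomial that is invariant under translation by the elements of a finite group is a
polynomial in the product of the translates of the variable. -/
theorem exists_comp_eq_of_taylor_eq_self {B A : Type*} [CommRing B] [IsDomain B] [AddCommGroup A]
    [Fintype A] (φ : A →+ B) (hφ : Function.Injective φ) (r : Polynomial B)
    (hr : ∀ a, Polynomial.taylor (φ a) r = r) :
    ∃ q : Polynomial B, r = q.comp (∏ a, (Polynomial.X + Polynomial.C (φ a))) := by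
  set N : Polynomial B := ∏ a, (Polynomial.X + Polynomial.C (φ a)) with hN
  have hmonic : N.Monic := Polynomial.monic_prod_of_monic _ _ fun a _ => Polynomial.monic_X_add_C _
  have hNdeg : N.natDegree = Fintype.card A := by
    rw [hN, Polynomial.natDegree_prod_of_monic _ _ fun a _ => Polynomial.monic_X_add_C _]
    simp
  have hNinv : ∀ a, Polynomial.taylor (φ a) N = N := by
    intro a
    rw [hN, Polynomial.taylor_apply, Polynomial.prod_comp]
    refine Fintype.prod_equiv (Equiv.addLeft a) _ _ fun b => ?_
    simp [add_assoc]
  have hcard : 0 < Fintype.card A := Fintype.card_pos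
  suffices ∀ n, ∀ r : Polynomial B, r.natDegree < n → (∀ a, Polynomial.taylor (φ a) r = r) →
      ∃ q : Polynomial B, r = q.comp N from this _ r (Nat.lt_succ_self _) hr
  intro n
  induction n with
  | zero => intro r hr; omega
  | succ n ih =>
    intro r hrn hr
    by_cases hlt : r.natDegree < Fintype.card A
    · exact ⟨Polynomial.C (r.eval 0), by
        rw [Polynomial.C_comp]; exact taylor_eq_self_eq_C φ hφ hr hlt⟩
    have hdecomp := Polynomial.modByMonic_add_div r N
    have hinv : ∀ a, Polynomial.taylor (φ a) (r /ₘ N) = r /ₘ N ∧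
        Polynomial.taylor (φ a) (r %ₘ N) = r %ₘ N := by
      intro a
      -- The divisor `N` is itself invariant, so uniqueness of division passes the invariance of r
      -- to quotient and remainder.
      have h := Polynomial.div_modByMonic_unique (f := r) (Polynomial.taylor (φ a) (r /ₘ N))
        (Polynomial.taylor (φ a) (r %ₘ N)) hmonic ⟨?_, ?_⟩
      · exact ⟨h.1.symm, h.2.symm⟩
      · conv_rhs => rw [← hr a, ← hdecomp]
        rw [map_add, Polynomial.taylor_mul, hNinv]
      · rw [Polynomial.degree_taylor]
        exact Polynomial.degree_modByMonic_lt _ hmonic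
    obtain ⟨q, hq⟩ := ih (r /ₘ N) (by
      rw [Polynomial.natDegree_divByMonic _ hmonic]; omega) fun a => (hinv a).1
    have hmod := taylor_eq_self_eq_C φ hφ (fun a => (hinv a).2) (by
      rw [← hNdeg]
      exact Polynomial.natDegree_modByMonic_lt _ hmonic fun h => by
        rw [h, Polynomial.natDegree_one] at hNdeg; omega)
    refine ⟨Polynomial.C ((r %ₘ N).eval 0) + Polynomial.X * q, ?_⟩
    conv_lhs => rw [← hdecomp, hmod, hq]
    simp

variable {k : Type*} [Field k]

theorem substVar_zero_mem (i : Fin 3) (P : MvPolynomial (Fin 3) k) :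
    substVar i 0 P ∈ Algebra.adjoin k (X '' {i}ᶜ : Set (MvPolynomial (Fin 3) k)) := by
  induction P using MvPolynomial.induction_on with
  | C a =>
    rw [← algebraMap_eq, AlgHom.commutes]
    exact Subalgebra.algebraMap_mem _ a
  | add p q hp hq => rw [map_add]; exact add_mem hp hq
  | mul_X p j hp =>
    rw [map_mul]
    refine mul_mem hp ?_
    by_cases h : j = i
    · rw [h, substVar_X_self]
      exact zero_mem _
    · rw [substVar_X_of_ne h]
      exact Algebra.subset_adjoin ⟨j, h, rfl⟩

/-- A polynomial regarded as a polynomial in the variable `i`. -/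
noncomputable def toPoly (i : Fin 3) : MvPolynomial (Fin 3) k →ₐ[k]
    Polynomial (MvPolynomial (Fin 3) k) :=
  aeval (Function.update (fun j => Polynomial.C (X j)) i Polynomial.X)

theorem toPoly_X_self (i : Fin 3) : toPoly i (X i : MvPolynomial (Fin 3) k) = Polynomial.X := by
  simp [toPoly]

theorem toPoly_X_of_ne {i j : Fin 3} (h : j ≠ i) :
    toPoly i (X j : MvPolynomial (Fin 3) k) = Polynomial.C (X j) := by
  simp [toPoly, h]

theorem toPoly_C (i : Fin 3) (c : k) : toPoly i (C c) = Polynomial.C (C c) := by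
  simp [toPoly]

/-- The hypothesis `substVar i 0 t = t` is used throughout to say that `t` does not involve the
variable `i`. -/
theorem toPoly_of_subst {i : Fin 3} {t : MvPolynomial (Fin 3) k} (ht : substVar i 0 t = t) :
    toPoly i t = Polynomial.C t := by
  rw [← ht]
  generalize t = u
  induction u using MvPolynomial.induction_on with
  | C a => simp [substVar]
  | add p q hp hq => simp only [map_add, hp, hq]
  | mul_X p j hp =>
    simp only [map_mul, hp]
    by_cases h : j = i
    · rw [h, substVar_X_self]; simp
    · rw [substVar_X_of_ne h, toPoly_X_of_ne h]

theorem eval_toPoly (i : Fin 3) (P : MvPolynomial (Fin 3) k) : (toPoly i P).eval (X i) = P := by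
  induction P using MvPolynomial.induction_on with
  | C a => simp
  | add p q hp hq => simp [hp, hq]
  | mul_X p j hp =>
    rw [map_mul, Polynomial.eval_mul, hp]
    by_cases h : j = i
    · rw [h, toPoly_X_self, Polynomial.eval_X]
    · rw [toPoly_X_of_ne h, Polynomial.eval_C]

theorem toPoly_substVar (i : Fin 3) {t : MvPolynomial (Fin 3) k} (ht : substVar i 0 t = t)
    (P : MvPolynomial (Fin 3) k) :
    toPoly i (substVar i (X i + t) P) = Polynomial.taylor t (toPoly i P) := by
  rw [Polynomial.taylor_apply]
  induction P using MvPolynomial.induction_on with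
  | C a => simp [substVar]
  | add p q hp hq => simp [hp, hq]
  | mul_X p j hp =>
    rw [map_mul, map_mul, hp, map_mul, Polynomial.mul_comp]
    by_cases h : j = i
    · rw [h, substVar_X_self, map_add, toPoly_X_self, toPoly_of_subst ht, Polynomial.X_comp]
    · rw [substVar_X_of_ne h, toPoly_X_of_ne h, Polynomial.C_comp]

/-- The coefficients of `toPoly i P` lie in the full polynomial ring by type, but they do not
involve the variable `i`. -/
theorem map_toPoly (i : Fin 3) (P : MvPolynomial (Fin 3) k) :
    (toPoly i P).map (substVar i 0).toRingHom = toPoly i P := by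
  induction P using MvPolynomial.induction_on with
  | C a => simp [substVar]
  | add p q hp hq => rw [map_add, Polynomial.map_add, hp, hq]
  | mul_X p j hp =>
    rw [map_mul, Polynomial.map_mul, hp]
    by_cases h : j = i
    · rw [h, toPoly_X_self, Polynomial.map_X]
    · rw [toPoly_X_of_ne h, Polynomial.map_C]
      congr 2
      exact substVar_X_of_ne h 0

theorem natDegree_toPoly_le (i : Fin 3) (P : MvPolynomial (Fin 3) k) :
    (toPoly i P).natDegree ≤ P.degreeOf i := by
  conv_lhs => rw [P.as_sum, map_sum]
  refine Polynomial.natDegree_sum_le_of_forall_le _ _ fun I hI => ?_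
  rw [monomial_eq, map_mul, toPoly_C, Finsupp.prod_fintype _ _ (by simp), map_prod]
  refine (Polynomial.natDegree_C_mul_le _ _).trans ?_
  refine (Polynomial.natDegree_prod_le _ _).trans ?_
  rw [Finset.sum_eq_single i]
  · rw [map_pow, toPoly_X_self, Polynomial.natDegree_X_pow]
    exact monomial_le_degreeOf i hI
  · intro j _ hj
    rw [map_pow, toPoly_X_of_ne hj, ← Polynomial.C_pow, Polynomial.natDegree_C]
  · simp

section

variable {A : Type*} [AddCommGroup A] {i : Fin 3} {t : MvPolynomial (Fin 3) k}

/-- The additive map `a ↦ φ(a) t`. -/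
noncomputable def smulHom (φ : A →+ k) (t : MvPolynomial (Fin 3) k) :
    A →+ MvPolynomial (Fin 3) k where
  toFun a := C (φ a) * t
  map_zero' := by simp
  map_add' a b := by simp [add_mul]

theorem smulHom_apply (φ : A →+ k) (a : A) : smulHom φ t a = C (φ a) * t := rfl

theorem smulHom_injective {φ : A →+ k} (hφ : Function.Injective φ) (ht0 : t ≠ 0) :
    Function.Injective (smulHom φ t) := by
  intro a b h
  rw [smulHom_apply, smulHom_apply] at h
  have h2 : (C (φ a) : MvPolynomial (Fin 3) k) = C (φ b) := mul_right_cancel₀ ht0 h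
  exact hφ ((C_inj k (φ a) (φ b)).1 h2)

theorem substVar_smulHom (ht : substVar i 0 t = t) (φ : A →+ k) (a : A) :
    substVar i 0 (smulHom φ t a) = smulHom φ t a := by
  have : substVar i 0 (C (φ a)) = (C (φ a) : MvPolynomial (Fin 3) k) := by simp [substVar]
  rw [smulHom_apply, map_mul, ht, this]

theorem mem_adjoin_of_translation [Fintype A] {φ : A →+ k} (hφ : Function.Injective φ)
    (ht : substVar i 0 t = t) (ht0 : t ≠ 0) {P : MvPolynomial (Fin 3) k}
    (hP : ∀ a, substVar i (X i + C (φ a) * t) P = P) :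
    P ∈ Algebra.adjoin k (insert (∏ a, (X i + C (φ a) * t)) (X '' {i}ᶜ)) := by
  obtain ⟨q, hq⟩ := exists_comp_eq_of_taylor_eq_self (smulHom φ t) (smulHom_injective hφ ht0)
    (toPoly i P) fun a => by
      rw [← toPoly_substVar i (substVar_smulHom ht φ a)]
      rw [smulHom_apply, hP a]
  -- Setting the variable `i` to zero in all coefficients fixes `toPoly i P` and the product of
  -- translates, and moves the coefficients of `q` into the algebra of the other variables.
  have hmap := congrArg (Polynomial.map (substVar i (0 : MvPolynomial (Fin 3) k)).toRingHom) hq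
  rw [map_toPoly, Polynomial.map_comp, Polynomial.map_prod] at hmap
  have hprod : ∏ a, Polynomial.map (substVar i (0 : MvPolynomial (Fin 3) k)).toRingHom
      (Polynomial.X + Polynomial.C (smulHom φ t a)) =
      ∏ a, (Polynomial.X + Polynomial.C (smulHom φ t a)) := by
    refine Finset.prod_congr rfl fun a _ => ?_
    rw [Polynomial.map_add, Polynomial.map_X, Polynomial.map_C]
    congr 2
    exact substVar_smulHom ht φ a
  rw [hprod] at hmap
  rw [← eval_toPoly i P, hmap, Polynomial.eval_comp, Polynomial.eval_prod,
    Polynomial.eval_eq_sum_range]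
  refine sum_mem fun n _ => mul_mem ?_ (pow_mem ?_ n)
  · rw [Polynomial.coeff_map]
    exact Algebra.adjoin_mono (Set.subset_insert _ _) (substVar_zero_mem i _)
  · refine Algebra.subset_adjoin (Or.inl ?_)
    refine Finset.prod_congr rfl fun a _ => ?_
    rw [Polynomial.eval_add, Polynomial.eval_X, Polynomial.eval_C]
    rfl

theorem substVar_zero_eq_of_translation [Fintype A] {φ : A →+ k} (hφ : Function.Injective φ)
    (ht : substVar i 0 t = t) (ht0 : t ≠ 0) {P : MvPolynomial (Fin 3) k}
    (hP : ∀ a, substVar i (X i + C (φ a) * t) P = P) (hdeg : P.degreeOf i < Fintype.card A) :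
    substVar i 0 P = P := by
  have h := taylor_eq_self_eq_C (smulHom φ t) (smulHom_injective hφ ht0) (r := toPoly i P)
    (fun a => by
      rw [← toPoly_substVar i (substVar_smulHom ht φ a)]
      rw [smulHom_apply, hP a]) (lt_of_le_of_lt (natDegree_toPoly_le i P) hdeg)
  have h1 := map_toPoly i P
  have h2 := eval_toPoly i P
  rw [h, Polynomial.eval_C] at h2
  rw [h, Polynomial.map_C, h2] at h1
  exact Polynomial.C_injective h1

end

end Translation

/-! ### Trading z for a polynomial linear in z, after inverting x. -/

section Localization

variable {k : Type*} [Field k]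

/-- Replacing `z` by a polynomial `B + c x^r z` with `B ∈ k[x, y]` gives an injective map. -/
theorem aeval_injective_of_linear {B : MvPolynomial (Fin 3) k} {c : k} {r : ℕ} (hc : c ≠ 0)
    (hB : substVar 0 0 B = B) :
    Function.Injective
      (aeval ![B + C c * X 2 ^ r * X 0, X 1, X 2] :
        MvPolynomial (Fin 3) k →ₐ[k] MvPolynomial (Fin 3) k) := by
  let K := FractionRing (MvPolynomial (Fin 3) k)
  let ι : MvPolynomial (Fin 3) k →ₐ[k] K := IsScalarTower.toAlgHom k _ K
  have hι : Function.Injective ι := IsFractionRing.injective _ K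
  -- Over the fraction field the substitution has the left inverse z ↦ (z - B) / (c x^r).
  let Φ : MvPolynomial (Fin 3) k →ₐ[k] K :=
    aeval ![(ι (X 0) - ι B) / (ι (C c) * ι (X 2) ^ r), ι (X 1), ι (X 2)]
  have hΦB : Φ B = ι B := by
    rw [← hB]
    have : Φ.comp (substVar 0 0) = ι.comp (substVar 0 0) := by
      apply MvPolynomial.algHom_ext
      intro i
      fin_cases i <;> simp [Φ, substVar]
    exact DFunLike.congr_fun this B
  have h2 : ι (X 2) ≠ 0 := by
    rw [Ne, map_eq_zero_iff ι hι]
    exact X_ne_zero _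
  have hcc : ι (C c) ≠ 0 := by
    rw [Ne, map_eq_zero_iff ι hι]
    simpa using hc
  have hΦC : Φ (C c) = ι (C c) := by
    rw [← algebraMap_eq, AlgHom.commutes, AlgHom.commutes]
  have hcomp : Φ.comp (aeval ![B + C c * X 2 ^ r * X 0, X 1, X 2]) = ι := by
    apply MvPolynomial.algHom_ext
    intro i
    fin_cases i
    · simp only [AlgHom.comp_apply, Fin.zero_eta, aeval_X, Matrix.cons_val_zero, map_add, map_mul,
        map_pow, hΦB, hΦC]
      simp only [Φ, aeval_X, Matrix.cons_val_zero, Matrix.cons_val]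
      rw [mul_div_cancel₀ _ (mul_ne_zero hcc (pow_ne_zero r h2)), add_sub_cancel]
    · simp [Φ]
    · simp [Φ]
  intro P Q h
  apply hι
  rw [← hcomp, AlgHom.comp_apply, AlgHom.comp_apply, h]

/-- The range contains x, y, B and hence x^r z, so every monomial lies in it after multiplication by
a power of x. -/
theorem exists_pow_mul_mem_range {B : MvPolynomial (Fin 3) k} {c : k} {r : ℕ} (hc : c ≠ 0)
    (hB : substVar 0 0 B = B) (F : MvPolynomial (Fin 3) k) :
    ∃ n : ℕ, X 2 ^ n * F ∈ (aeval ![B + C c * X 2 ^ r * X 0, X 1, X 2] :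
        MvPolynomial (Fin 3) k →ₐ[k] MvPolynomial (Fin 3) k).range := by
  set Ψ : MvPolynomial (Fin 3) k →ₐ[k] MvPolynomial (Fin 3) k :=
    aeval ![B + C c * X 2 ^ r * X 0, X 1, X 2] with hΨ
  have h1 : X 1 ∈ Ψ.range := ⟨X 1, by simp [hΨ]⟩
  have h2 : X 2 ∈ Ψ.range := ⟨X 2, by simp [hΨ]⟩
  have hBm : B ∈ Ψ.range := by
    refine (Algebra.adjoin_le (S := Ψ.range) ?_) (hB ▸ substVar_zero_mem 0 B)
    rintro _ ⟨j, hj, rfl⟩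
    fin_cases j
    · exact absurd rfl hj
    · exact h1
    · exact h2
  have h0 : X 2 ^ r * X 0 ∈ Ψ.range := by
    have hX : Ψ (X 0) = B + C c * X 2 ^ r * X 0 := by simp [hΨ]
    have : X 2 ^ r * X 0 = C c⁻¹ * (Ψ (X 0) - B) := by
      have hcc : (C c⁻¹ * C c : MvPolynomial (Fin 3) k) = 1 := by
        rw [← C_mul, inv_mul_cancel₀ hc, C_1]
      rw [hX]
      linear_combination -(X 2 ^ r * X 0) * hcc
    rw [this]
    exact mul_mem (Subalgebra.algebraMap_mem _ _) (sub_mem ⟨X 0, rfl⟩ hBm)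
  induction F using MvPolynomial.induction_on with
  | C a => exact ⟨0, by simpa using Subalgebra.algebraMap_mem Ψ.range a⟩
  | add p q hp hq =>
    obtain ⟨n, hn⟩ := hp
    obtain ⟨m, hm⟩ := hq
    refine ⟨n + m, ?_⟩
    have : (X 2 ^ (n + m) * (p + q) : MvPolynomial (Fin 3) k) =
      X 2 ^ m * (X 2 ^ n * p) + X 2 ^ n * (X 2 ^ m * q) := by ring
    rw [this]
    exact add_mem (mul_mem (pow_mem h2 _) hn) (mul_mem (pow_mem h2 _) hm)
  | mul_X p j hp =>
    obtain ⟨n, hn⟩ := hp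
    have hj : X 2 ^ r * X j ∈ Ψ.range := by
      fin_cases j
      · exact h0
      · exact mul_mem (pow_mem h2 _) h1
      · exact mul_mem (pow_mem h2 _) h2
    refine ⟨n + r, ?_⟩
    have : (X 2 ^ (n + r) * (p * X j) : MvPolynomial (Fin 3) k) =
      (X 2 ^ n * p) * (X 2 ^ r * X j) := by ring
    rw [this]
    exact mul_mem hn hj

end Localization

/-! ### Additive polynomials over a field of characteristic p. -/

section AdditivePolynomials

variable {p : ℕ} [Fact p.Prime] {k : Type*} [Field k] {n : ℕ}

theorem natDegree_sum_pow_lt (u : Fin n → k) :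
    (∑ i, Polynomial.C (u i) * Polynomial.X ^ p ^ (i : ℕ)).natDegree < p ^ n := by
  have hp := (Fact.out : p.Prime)
  refine lt_of_le_of_lt (Polynomial.natDegree_sum_le_of_forall_le (n := p ^ n - 1) _ _ fun i _ => ?_)
    (Nat.sub_lt (pow_pos hp.pos n) one_pos)
  refine (Polynomial.natDegree_C_mul_X_pow_le _ _).trans (Nat.le_sub_one_of_lt ?_)
  exact Nat.pow_lt_pow_right hp.one_lt i.2

theorem card_fin_zmod : Fintype.card (Fin n → ZMod p) = p ^ n := by
  rw [Fintype.card_fun, ZMod.card, Fintype.card_fin]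

/-- An additive polynomial of degree less than `p^n` that vanishes on a group of order `p^n`
is zero. -/
theorem eq_zero_of_sum_pow_eq_zero {φ : (Fin n → ZMod p) →+ k} (hφ : Function.Injective φ)
    {u : Fin n → k} (h : ∀ a, ∑ i, u i * φ a ^ p ^ (i : ℕ) = 0) : u = 0 := by
  have hp := (Fact.out : p.Prime)
  have h0 : (∑ i, Polynomial.C (u i) * Polynomial.X ^ p ^ (i : ℕ)) = 0 := by
    refine Polynomial.eq_zero_of_natDegree_lt_card_of_eval_eq_zero _ hφ (fun a => ?_) ?_
    · rw [Polynomial.eval_finsetSum, ← h a]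
      simp
    · rw [card_fin_zmod]
      exact natDegree_sum_pow_lt u
  ext i
  have := congrArg (fun q => Polynomial.coeff q (p ^ (i : ℕ))) h0
  simp only [Polynomial.finsetSum_coeff, Polynomial.coeff_C_mul, Polynomial.coeff_X_pow,
    Polynomial.coeff_zero] at this
  rw [Finset.sum_eq_single i] at this
  · simpa using this
  · intro j _ hj
    rw [if_neg, mul_zero]
    intro he
    exact hj (Fin.ext (Nat.pow_right_injective hp.two_le he)).symm
  · simp

variable [CharP k p]

theorem addMonoidHom_apply_eq_sum (φ : (Fin n → ZMod p) →+ k) (a : Fin n → ZMod p) :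
    φ a = ∑ j, ZMod.castHom (dvd_refl p) k (a j) * φ (Pi.single j 1) := by
  have h : a = ∑ j, (a j).val • Pi.single j (1 : ZMod p) := by
    ext i
    rw [Finset.sum_apply, Finset.sum_eq_single i]
    · rw [Pi.smul_apply, Pi.single_eq_same, nsmul_eq_mul, mul_one, ZMod.natCast_zmod_val]
    · intro j _ hj
      rw [Pi.smul_apply, Pi.single_eq_of_ne hj.symm, smul_zero]
    · simp
  conv_lhs => rw [h, map_sum]
  refine Finset.sum_congr rfl fun j _ => ?_
  rw [map_nsmul, nsmul_eq_mul, ← map_natCast (ZMod.castHom (dvd_refl p) k), ZMod.natCast_zmod_val]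

theorem addMonoidHom_eq_zero {φ : (Fin n → ZMod p) →+ k} (h : ∀ j, φ (Pi.single j 1) = 0)
    (a : Fin n → ZMod p) : φ a = 0 := by
  rw [addMonoidHom_apply_eq_sum]
  simp [h]

/-- The additive map `a ↦ φ(a)^(p^i)`. -/
noncomputable def powHom {A : Type*} [AddCommGroup A] (φ : A →+ k) (i : ℕ) : A →+ k where
  toFun a := φ a ^ p ^ i
  map_zero' := by simp [(Fact.out : p.Prime).ne_zero]
  map_add' a b := by rw [map_add, add_pow_char_pow]

theorem powHom_apply {A : Type*} [AddCommGroup A] (φ : A →+ k) (i : ℕ) (a : A) :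
    powHom (p := p) φ i a = φ a ^ p ^ i := rfl

/-- The product of the translates of `Y` by a finite group is an additive polynomial. -/
theorem exists_prod_add_eq {φ : (Fin n → ZMod p) →+ k} (hφ : Function.Injective φ) :
    ∃ u : Fin n → k, ∀ Y t : MvPolynomial (Fin 3) k, t ≠ 0 →
      ∏ a, (Y + C (φ a) * t) =
        Y ^ p ^ n + ∑ i : Fin n, C (u i) * t ^ (p ^ n - p ^ (i : ℕ)) * Y ^ p ^ (i : ℕ) := by
  classical
  have hp := (Fact.out : p.Prime)
  -- `L` evaluates the additive polynomial with coefficients `u` on a basis of the group. It is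
  -- injective by `eq_zero_of_sum_pow_eq_zero`, hence surjective, and so T^(p^n) can be completed to
  -- an additive polynomial vanishing on the image of `φ`.
  let L : (Fin n → k) →ₗ[k] (Fin n → k) :=
    { toFun := fun u j => ∑ i : Fin n, u i * φ (Pi.single j 1) ^ p ^ (i : ℕ)
      map_add' := fun u v => by ext j; simp [add_mul, Finset.sum_add_distrib]
      map_smul' := fun c u => by ext j; simp [Finset.mul_sum, mul_assoc] }
  have hL : Function.Surjective L := by
    apply LinearMap.injective_iff_surjective.1
    rw [← LinearMap.ker_eq_bot, LinearMap.ker_eq_bot']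
    intro u hu
    refine eq_zero_of_sum_pow_eq_zero hφ fun a => ?_
    have := addMonoidHom_eq_zero (p := p)
      (φ := ∑ i : Fin n, (AddMonoidHom.mulLeft (u i)).comp (powHom (p := p) φ i))
      (fun j => by simpa [powHom_apply, L] using congrFun hu j) a
    simpa [powHom_apply] using this
  obtain ⟨u, hu⟩ := hL fun j => -φ (Pi.single j 1) ^ p ^ n
  have hvan : ∀ a, φ a ^ p ^ n + ∑ i : Fin n, u i * φ a ^ p ^ (i : ℕ) = 0 := by
    intro a
    have := addMonoidHom_eq_zero (p := p)
      (φ := powHom (p := p) φ n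
        + ∑ i : Fin n, (AddMonoidHom.mulLeft (u i)).comp (powHom (p := p) φ i))
      (fun j => by
        have := congrFun hu j
        simp only [L, LinearMap.coe_mk, AddHom.coe_mk] at this
        simp [powHom_apply, this]) a
    simpa [powHom_apply] using this
  refine ⟨u, fun Y t ht => ?_⟩
  set P₁ : Polynomial (MvPolynomial (Fin 3) k) :=
    ∏ a, (Polynomial.X + Polynomial.C (C (φ a) * t)) with hP₁
  set P₂ : Polynomial (MvPolynomial (Fin 3) k) :=
    ∑ i : Fin n, Polynomial.C (C (u i) * t ^ (p ^ n - p ^ (i : ℕ))) * Polynomial.X ^ p ^ (i : ℕ) with hP₂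
  have hm₁ : P₁.Monic := Polynomial.monic_prod_of_monic _ _ fun a _ => Polynomial.monic_X_add_C _
  have hd₁ : P₁.degree = ((p ^ n : ℕ) : WithBot ℕ) := by
    rw [Polynomial.degree_eq_natDegree hm₁.ne_zero, hP₁,
      Polynomial.natDegree_prod_of_monic _ _ fun a _ => Polynomial.monic_X_add_C _]
    simp only [Polynomial.natDegree_X_add_C, Finset.sum_const, Finset.card_univ, card_fin_zmod,
      smul_eq_mul, mul_one]
  have hd₂ : P₂.degree < ((p ^ n : ℕ) : WithBot ℕ) := by
    rw [hP₂]
    refine (Polynomial.degree_sum_le _ _).trans_lt ?_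
    rw [Finset.sup_lt_iff (WithBot.bot_lt_coe _)]
    intro i _
    refine (Polynomial.degree_C_mul_X_pow_le _ _).trans_lt ?_
    exact_mod_cast Nat.pow_lt_pow_right hp.one_lt i.2
  have hd₃ : (P₁ - Polynomial.X ^ p ^ n).degree < ((p ^ n : ℕ) : WithBot ℕ) := by
    rw [← hd₁]
    refine Polynomial.degree_sub_lt_left ?_ hm₁.ne_zero ?_
    · rw [hd₁, Polynomial.degree_X_pow]
    · rw [hm₁.leadingCoeff, Polynomial.leadingCoeff_X_pow]
  -- The product and the additive polynomial are both monic of degree p^n with the p^n distinct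
  -- roots φ(a) t, so their difference vanishes.
  have hzero : P₁ - Polynomial.X ^ p ^ n - P₂ = 0 := by
    refine Polynomial.eq_zero_of_natDegree_lt_card_of_eval_eq_zero _
      (f := smulHom φ t) (smulHom_injective hφ ht) (fun a => ?_) ?_
    · rw [smulHom_apply]
      have e1 : P₁.eval (C (φ a) * t) = 0 := by
        rw [hP₁, Polynomial.eval_prod]
        refine Finset.prod_eq_zero (Finset.mem_univ (-a)) ?_
        simp
      have e2 : P₂.eval (C (φ a) * t) =
          t ^ p ^ n * C (∑ i : Fin n, u i * φ a ^ p ^ (i : ℕ)) := by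
        rw [hP₂, Polynomial.eval_finsetSum, map_sum, Finset.mul_sum]
        refine Finset.sum_congr rfl fun i _ => ?_
        have hle : p ^ (i : ℕ) ≤ p ^ n := Nat.pow_le_pow_right hp.pos i.2.le
        rw [Polynomial.eval_mul, Polynomial.eval_C, Polynomial.eval_pow, Polynomial.eval_X,
          mul_pow, map_mul, map_pow]
        conv_rhs => rw [← Nat.sub_add_cancel hle, pow_add]
        ring
      rw [Polynomial.eval_sub, Polynomial.eval_sub, e1, e2, Polynomial.eval_pow,
        Polynomial.eval_X, eq_neg_of_add_eq_zero_right (hvan a), mul_pow, ← C_pow, map_neg]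
      ring
    · rw [card_fin_zmod]
      by_cases h0 : P₁ - Polynomial.X ^ p ^ n - P₂ = 0
      · rw [h0, Polynomial.natDegree_zero]
        exact pow_pos hp.pos n
      · rw [Polynomial.natDegree_lt_iff_degree_lt h0]
        exact (Polynomial.degree_sub_le _ _).trans_lt (max_lt hd₃ hd₂)
  have := congrArg (Polynomial.eval Y) hzero
  rw [Polynomial.eval_sub, Polynomial.eval_sub, hP₁, hP₂, Polynomial.eval_prod,
    Polynomial.eval_finsetSum, Polynomial.eval_zero] at this
  simp only [Polynomial.eval_add, Polynomial.eval_X, Polynomial.eval_C, Polynomial.eval_pow,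
    Polynomial.eval_mul] at this
  linear_combination this

end AdditivePolynomials

/-! ### The action of G, orbit products, and the minors of Γ. -/

section Action

variable {k : Type*} [Field k]

theorem polyAct_sigma_X_zero (c : k × k) :
    polyAct (sigma c) (X 0) = X 0 + C (2 * c.1) * X 1 + C (c.1 ^ 2 + c.2) * X 2 := by
  simp [polyAct, sigma, Fin.sum_univ_three]

theorem polyAct_sigma_X_one (c : k × k) : polyAct (sigma c) (X 1) = X 1 + C c.1 * X 2 := by
  simp [polyAct, sigma, Fin.sum_univ_three]

theorem polyAct_sigma_X_two (c : k × k) : polyAct (sigma c) (X 2) = X 2 := by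
  simp [polyAct, sigma, Fin.sum_univ_three]

theorem polyAct_C (A : Matrix (Fin 3) (Fin 3) k) (c : k) : polyAct A (C c) = C c := by
  rw [← algebraMap_eq, AlgHom.commutes]

theorem polyAct_sigma_add (c d : k × k) (F : MvPolynomial (Fin 3) k) :
    polyAct (sigma (c + d)) F = polyAct (sigma c) (polyAct (sigma d) F) := by
  suffices polyAct (sigma (c + d)) = (polyAct (sigma c)).comp (polyAct (sigma d)) by
    rw [this, AlgHom.comp_apply]
  apply MvPolynomial.algHom_ext
  intro i
  fin_cases i
  · simp only [AlgHom.comp_apply, Fin.zero_eta, polyAct_sigma_X_zero, polyAct_sigma_X_one,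
      polyAct_sigma_X_two, map_add, map_mul, polyAct_C, map_pow, map_ofNat, Prod.fst_add, Prod.snd_add]
    ring
  · simp only [AlgHom.comp_apply, Fin.mk_one, polyAct_sigma_X_one,
      polyAct_sigma_X_two, map_add, map_mul, polyAct_C, Prod.fst_add]
    ring
  · simp [AlgHom.comp_apply, polyAct_sigma_X_two]

theorem polyAct_sigma_zero (F : MvPolynomial (Fin 3) k) : polyAct (sigma (0 : k × k)) F = F := by
  have : polyAct (sigma (0 : k × k)) = AlgHom.id k _ := by
    apply MvPolynomial.algHom_ext
    intro i
    fin_cases i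
    · simp [polyAct_sigma_X_zero]
    · simp [polyAct_sigma_X_one]
    · simp [polyAct_sigma_X_two]
  rw [this, AlgHom.id_apply]

/-- The discriminant-like form δ sees only c₂, as y sees only c₁. This makes x, y, δ good
coordinates once x is inverted. -/
theorem polyAct_sigma_delta (c : k × k) :
    polyAct (sigma c) delta = delta - C c.2 * X 2 ^ 2 := by
  simp only [delta, map_sub, map_mul, map_pow, polyAct_sigma_X_zero, polyAct_sigma_X_one,
    polyAct_sigma_X_two, map_add, map_ofNat]
  ring

variable {p : ℕ} [CharP k p] {M : Matrix (Fin 2) (Fin 3) k}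

theorem repMat_apply (g : Multiplicative (Fin 3 → ZMod p)) :
    repMat p M g = sigma (colComb p M g.toAdd) := rfl

theorem mem_invariantRing {F : MvPolynomial (Fin 3) k} :
    F ∈ invariantRing p M ↔
      ∀ a : Fin 3 → ZMod p, polyAct (sigma (colComb p M a)) F = F :=
  ⟨fun h a => h (Multiplicative.ofAdd a), fun h g => h g.toAdd⟩

theorem X_two_mem_invariantRing : X 2 ∈ invariantRing p M :=
  mem_invariantRing.2 fun _ => polyAct_sigma_X_two _

theorem mem_invariantRing_of_X_pow_mul {F : MvPolynomial (Fin 3) k} {n : ℕ}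
    (h : X 2 ^ n * F ∈ invariantRing p M) : F ∈ invariantRing p M := by
  rw [mem_invariantRing] at h ⊢
  intro a
  have := h a
  rw [map_mul, map_pow, polyAct_sigma_X_two] at this
  exact mul_left_cancel₀ (pow_ne_zero n (X_ne_zero _)) this

theorem mem_invariantRing_of_C_mul {F : MvPolynomial (Fin 3) k} {c : k} (hc : c ≠ 0)
    (h : C c * F ∈ invariantRing p M) : F ∈ invariantRing p M := by
  rw [mem_invariantRing] at h ⊢
  intro a
  have := h a
  rw [map_mul, polyAct_C] at this
  exact mul_left_cancel₀ (by simpa using hc) this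

theorem C_mem_invariantRing (c : k) : C c ∈ invariantRing p M :=
  mem_invariantRing.2 fun _ => polyAct_C _ _

theorem orbitProd_mem [NeZero p] (F : MvPolynomial (Fin 3) k) :
    orbitProd p M F ∈ invariantRing p M := by
  classical
  rw [mem_invariantRing]
  intro a
  have hinj : Function.Injective (polyAct (sigma (colComb p M a))) := by
    refine Function.LeftInverse.injective (g := polyAct (sigma (colComb p M (-a)))) fun F => ?_
    rw [← polyAct_sigma_add, ← map_add, neg_add_cancel, map_zero, polyAct_sigma_zero]
  rw [orbitProd, map_prod, ← Finset.prod_image (f := fun x => x) (fun x _ y _ h => hinj h)]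
  congr 1
  ext q
  simp only [Finset.mem_image, Finset.mem_univ, true_and, exists_exists_eq_and]
  constructor
  · rintro ⟨g, rfl⟩
    refine ⟨Multiplicative.ofAdd a * g, ?_⟩
    rw [repMat_apply, repMat_apply, toAdd_mul, map_add, polyAct_sigma_add]
    rfl
  · rintro ⟨g, rfl⟩
    refine ⟨Multiplicative.ofAdd (-a) * g, ?_⟩
    rw [repMat_apply, repMat_apply, ← polyAct_sigma_add, ← map_add, toAdd_mul, toAdd_ofAdd,
      add_neg_cancel_left]

/-- An orbit product runs over distinct images, so it becomes a product over any index set that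
parametrizes the orbit without repetition. -/
theorem orbitProd_eq_prod [NeZero p] {A : Type*} [Fintype A] {F : MvPolynomial (Fin 3) k}
    {ψ : A → MvPolynomial (Fin 3) k} (hψ : Function.Injective ψ)
    (h1 : ∀ a : Fin 3 → ZMod p, ∃ b, ψ b = polyAct (sigma (colComb p M a)) F)
    (h2 : ∀ b, ∃ a : Fin 3 → ZMod p, polyAct (sigma (colComb p M a)) F = ψ b) :
    orbitProd p M F = ∏ b, ψ b := by
  classical
  rw [orbitProd, ← Finset.prod_image (f := fun x => x) (s := Finset.univ) (g := ψ)
    (fun x _ y _ h => hψ h)]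
  congr 1
  ext q
  simp only [Finset.mem_image, Finset.mem_univ, true_and]
  constructor
  · rintro ⟨g, rfl⟩
    exact h1 g.toAdd
  · rintro ⟨b, rfl⟩
    obtain ⟨a, ha⟩ := h2 b
    exact ⟨Multiplicative.ofAdd a, ha⟩

theorem faithful_iff : Faithful p M ↔ Function.Injective (colComb p M) := by
  have hs : Function.Injective (sigma : k × k → _) := by
    intro c d h
    have h1 := congrFun (congrFun h 1) 2
    have h2 := congrFun (congrFun h 0) 2
    simp [sigma] at h1 h2
    rw [h1] at h2
    exact Prod.ext h1 (by simpa using h2)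
  have hr : ∀ g, repV p M g = Matrix.toLinAlgEquiv' (sigma (colComb p M g.toAdd)) := fun g => rfl
  constructor
  · intro h a b hab
    exact Multiplicative.ofAdd.injective (h (by rw [hr, hr, toAdd_ofAdd, toAdd_ofAdd, hab]))
  · intro h a b hab
    rw [hr, hr] at hab
    exact Multiplicative.toAdd.injective
      (h (hs (Matrix.toLinAlgEquiv'.injective hab)))

/-- The additive map `G → k` given by the first row of `M`. -/
noncomputable def rowOne (p : ℕ) [CharP k p] (M : Matrix (Fin 2) (Fin 3) k) :
    (Fin 3 → ZMod p) →+ k := (AddMonoidHom.fst k k).comp (colComb p M)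

/-- The additive map `G → k` given by the second row of `M`. -/
noncomputable def rowTwo (p : ℕ) [CharP k p] (M : Matrix (Fin 2) (Fin 3) k) :
    (Fin 3 → ZMod p) →+ k := (AddMonoidHom.snd k k).comp (colComb p M)

theorem colComb_eq (a : Fin 3 → ZMod p) : colComb p M a = (rowOne p M a, rowTwo p M a) := rfl

theorem rowOne_single (j : Fin 3) : rowOne p M (Pi.single j 1) = M 0 j := by
  change ∑ i, ZMod.castHom (dvd_refl p) k (Pi.single (M := fun _ => ZMod p) j 1 i) * M 0 i = M 0 j
  rw [Finset.sum_eq_single j]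
  · rw [Pi.single_eq_same, map_one, one_mul]
  · intro i _ hi
    rw [Pi.single_eq_of_ne hi, map_zero, zero_mul]
  · simp

theorem rowTwo_single (j : Fin 3) : rowTwo p M (Pi.single j 1) = M 1 j := by
  change ∑ i, ZMod.castHom (dvd_refl p) k (Pi.single (M := fun _ => ZMod p) j 1 i) * M 1 i = M 1 j
  rw [Finset.sum_eq_single j]
  · rw [Pi.single_eq_same, map_one, one_mul]
  · intro i _ hi
    rw [Pi.single_eq_of_ne hi, map_zero, zero_mul]
  · simp

variable [Fact p.Prime]

/-- The additive map `G → k` given by the row `n` of `Γ`. -/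
noncomputable def gammaHom (p : ℕ) [Fact p.Prime] [CharP k p] (M : Matrix (Fin 2) (Fin 3) k)
    (n : ℕ) : (Fin 3 → ZMod p) →+ k :=
  powHom (p := p) (if n % 2 = 1 then rowOne p M else rowTwo p M) ((n - 1) / 2)

theorem gammaHom_single (n : ℕ) (j : Fin 3) :
    gammaHom p M n (Pi.single j 1) = gammaRow p M n j := by
  rw [gammaHom, powHom_apply, gammaRow]
  split_ifs
  · rw [rowOne_single]
  · rw [rowTwo_single]

/-- A vanishing minor of `Γ` gives a linear relation between the rows, as functions on `G`. -/
theorem exists_relation_of_gammaMinor_eq_zero {a b c : ℕ} (h : gammaMinor p M a b c = 0) :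
    ∃ v : Fin 3 → k, v ≠ 0 ∧ ∀ s : Fin 3 → ZMod p,
      v 0 * gammaHom p M a s + v 1 * gammaHom p M b s + v 2 * gammaHom p M c s = 0 := by
  obtain ⟨v, hv, hM⟩ := Matrix.exists_vecMul_eq_zero_iff.2 h
  refine ⟨v, hv, fun s => ?_⟩
  have := addMonoidHom_eq_zero (p := p)
    (φ := (AddMonoidHom.mulLeft (v 0)).comp (gammaHom p M a)
      + (AddMonoidHom.mulLeft (v 1)).comp (gammaHom p M b)
      + (AddMonoidHom.mulLeft (v 2)).comp (gammaHom p M c))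
    (fun j => by
      have := congrFun hM j
      simpa [Matrix.vecMul, dotProduct, Fin.sum_univ_three, gammaHom_single] using this) s
  simpa using this

/-- The group element `s`, read as a vector over the prime field, is a nonzero kernel vector of the
three rows. -/
theorem gammaMinor_eq_zero_of_gammaHom_eq_zero {a b c : ℕ} {s : Fin 3 → ZMod p} (hs : s ≠ 0)
    (ha : gammaHom p M a s = 0) (hb : gammaHom p M b s = 0) (hc : gammaHom p M c s = 0) :
    gammaMinor p M a b c = 0 := by
  rw [gammaMinor, ← Matrix.exists_mulVec_eq_zero_iff]
  refine ⟨fun j => ZMod.castHom (dvd_refl p) k (s j), ?_, ?_⟩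
  · intro h
    apply hs
    ext j
    exact (ZMod.castHom (dvd_refl p) k).injective (by
      rw [Pi.zero_apply, map_zero]
      exact congrFun h j)
  · ext i
    rw [addMonoidHom_apply_eq_sum] at ha hb hc
    simp only [gammaHom_single] at ha hb hc
    fin_cases i
    · simpa [Matrix.mulVec, dotProduct, mul_comm] using ha
    · simpa [Matrix.mulVec, dotProduct, mul_comm] using hb
    · simpa [Matrix.mulVec, dotProduct, mul_comm] using hc

theorem gammaHom_one (s : Fin 3 → ZMod p) : gammaHom p M 1 s = rowOne p M s := by
  simp [gammaHom, powHom_apply]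

theorem gammaHom_two (s : Fin 3 → ZMod p) : gammaHom p M 2 s = rowTwo p M s := by
  simp [gammaHom, powHom_apply]

theorem gammaHom_three (s : Fin 3 → ZMod p) : gammaHom p M 3 s = rowOne p M s ^ p := by
  simp [gammaHom, powHom_apply]

theorem gammaHom_four (s : Fin 3 → ZMod p) : gammaHom p M 4 s = rowTwo p M s ^ p := by
  simp [gammaHom, powHom_apply]

theorem gammaHom_five (s : Fin 3 → ZMod p) : gammaHom p M 5 s = rowOne p M s ^ p ^ 2 := by
  simp [gammaHom, powHom_apply]

/-- Rows 1, 3, 5 are c₁, c₁^p, c₁^(p²), which all vanish where c₁ does. -/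
theorem rowOne_injective (h : gammaMinor p M 1 3 5 ≠ 0) : Function.Injective (rowOne p M) := by
  rw [injective_iff_map_eq_zero]
  intro s hs
  by_contra h0
  have hp := (Fact.out : p.Prime).ne_zero
  refine h (gammaMinor_eq_zero_of_gammaHom_eq_zero h0 ?_ ?_ ?_)
  · rw [gammaHom_one, hs]
  · rw [gammaHom_three, hs, zero_pow hp]
  · rw [gammaHom_five, hs, zero_pow (pow_ne_zero _ hp)]

/-- A relation between rows 1, 3, 5 is an additive polynomial of degree at most p² in c₁; it cannot
vanish at p³ distinct values. -/
theorem exists_rowOne_eq_zero (h : gammaMinor p M 1 3 5 = 0) : ∃ s ≠ 0, rowOne p M s = 0 := by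
  obtain ⟨v, hv, hrel⟩ := exists_relation_of_gammaMinor_eq_zero h
  by_contra! hne
  have hinj : Function.Injective (rowOne p M) := by
    rw [injective_iff_map_eq_zero]
    intro s hs
    by_contra h0
    exact hne s h0 hs
  refine hv (eq_zero_of_sum_pow_eq_zero hinj fun a => ?_)
  have := hrel a
  rw [gammaHom_one, gammaHom_three, gammaHom_five] at this
  simpa [Fin.sum_univ_three] using this

/-- If `γ₁₂₃ = 0` and `γ₁₃₅ ≠ 0`, the second row is a combination of the rows 1 and 3. -/
theorem exists_rowTwo_eq (h123 : gammaMinor p M 1 2 3 = 0) (h135 : gammaMinor p M 1 3 5 ≠ 0) :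
    ∃ a b : k, ∀ s, rowTwo p M s = a * rowOne p M s + b * rowOne p M s ^ p := by
  obtain ⟨v, hv, hrel⟩ := exists_relation_of_gammaMinor_eq_zero h123
  simp only [gammaHom_one, gammaHom_two, gammaHom_three] at hrel
  -- Without the term in c₂ the relation would be a nonzero additive polynomial of degree at most p
  -- vanishing at p³ values of c₁.
  have h1 : v 1 ≠ 0 := by
    intro h1
    have := eq_zero_of_sum_pow_eq_zero (rowOne_injective h135) (u := ![v 0, v 2, 0]) fun s => by
      have := hrel s
      rw [h1] at this
      simpa [Fin.sum_univ_three] using this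
    have e0 := congrFun this 0
    have e1 := congrFun this 1
    simp at e0 e1
    exact hv (by ext i; fin_cases i <;> assumption)
  refine ⟨-v 0 / v 1, -v 2 / v 1, fun s => ?_⟩
  have := hrel s
  field_simp
  linear_combination this

end Action

/-! ### The case of an injective first row: construction of an invariant with lead monomial z^(p³).
-/

section RankThree

variable {p : ℕ} [Fact p.Prime] {k : Type*} [Field k] [CharP k p]
  {M : Matrix (Fin 2) (Fin 3) k}

theorem X_one_add_injective {A : Type*} [AddCommGroup A] {φ : A →+ k}
    (hφ : Function.Injective φ) :
    Function.Injective fun a => (X 1 + C (φ a) * X 2 : MvPolynomial (Fin 3) k) := fun _ _ h =>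
  smulHom_injective hφ (X_ne_zero (2 : Fin 3)) (add_left_cancel h)

theorem orbitProd_X_one (h : Function.Injective (rowOne p M)) :
    orbitProd p M (X 1) = ∏ a, (X 1 + C (rowOne p M a) * X 2) := by
  refine orbitProd_eq_prod (X_one_add_injective h) (fun a => ⟨a, ?_⟩) (fun a => ⟨a, ?_⟩) <;>
  rw [polyAct_sigma_X_one, colComb_eq]

/-- In the coordinates f, y, x, available after inverting x, the group fixes f and x and translates
y by c₁ x. So the invariants are generated by f, x and the orbit product of y. -/
theorem exists_pow_mul_mem_adjoin (h : Function.Injective (rowOne p M))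
    {B f : MvPolynomial (Fin 3) k} {c : k} {r : ℕ} (hc : c ≠ 0) (hB : substVar 0 0 B = B)
    (hf : f = B + C c * X 2 ^ r * X 0) (hfR : f ∈ invariantRing p M)
    {F : MvPolynomial (Fin 3) k} (hF : F ∈ invariantRing p M) :
    ∃ n : ℕ, X 2 ^ n * F ∈ Algebra.adjoin k {orbitProd p M (X 1), f, X 2} := by
  obtain ⟨n, P, hP⟩ := exists_pow_mul_mem_range (r := r) hc hB F
  refine ⟨n, ?_⟩
  have hinj := aeval_injective_of_linear (r := r) hc hB
  rw [← hf] at hinj hP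
  set Ψ : MvPolynomial (Fin 3) k →ₐ[k] MvPolynomial (Fin 3) k := aeval ![f, X 1, X 2] with hΨ
  have hP' : Ψ P = X 2 ^ n * F := hP
  have hinv : ∀ a, substVar 1 (X 1 + C (rowOne p M a) * X 2) P = P := by
    intro a
    apply hinj
    have hcomp : Ψ.comp (substVar 1 (X 1 + C (rowOne p M a) * X 2)) =
        (polyAct (sigma (colComb p M a))).comp Ψ := by
      apply MvPolynomial.algHom_ext
      intro i
      fin_cases i
      · have := mem_invariantRing.1 hfR a
        simp [hΨ, substVar, this]
      · simp [hΨ, substVar, polyAct_sigma_X_one, colComb_eq]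
      · simp [hΨ, substVar, polyAct_sigma_X_two]
    have h1 := DFunLike.congr_fun hcomp P
    rw [AlgHom.comp_apply, AlgHom.comp_apply, hP', map_mul, map_pow, polyAct_sigma_X_two,
      mem_invariantRing.1 hF a, ← hP'] at h1
    exact h1
  have hmem := mem_adjoin_of_translation h (i := 1) (t := X 2) (substVar_X_of_ne (by decide) _)
    (X_ne_zero _) hinv
  have h2 : Ψ P ∈ (Algebra.adjoin k (insert (∏ a, (X 1 + C (rowOne p M a) * X 2))
      (X '' {1}ᶜ : Set (MvPolynomial (Fin 3) k)))).map Ψ := ⟨P, hmem, rfl⟩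
  rw [AlgHom.map_adjoin, hP'] at h2
  refine Algebra.adjoin_mono ?_ h2
  rintro _ ⟨_, rfl | ⟨j, hj, rfl⟩, rfl⟩
  · left
    rw [orbitProd_X_one h, map_prod]
    refine Finset.prod_congr rfl fun a _ => ?_
    simp [hΨ]
  · fin_cases j
    · right; left
      simp [hΨ]
    · exact absurd rfl hj
    · right; right
      simp [hΨ]

/-- Every number from `(a-1)(b-1)` on is a combination of the coprime numbers `a` and `b`. -/
theorem exists_eq_mul_add_mul {a b n : ℕ} (ha : 0 < a) (hab : a.Coprime b)
    (hn : (a - 1) * (b - 1) ≤ n) : ∃ i l, l < a ∧ a * i + b * l = n := by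
  obtain ⟨l, hl, hlm⟩ := Nat.exists_mul_mod_eq_of_coprime n hab.symm ha.ne'
  have hle : b * l ≤ n := by
    -- Here l solves b l ≡ n modulo a. If b l > n, then n ≤ b(a - 1) - a, which is one less than (a
    -- - 1)(b - 1).
    by_contra! hlt
    have h1 : n + a ≤ b * l := by
      have hdvd : a ∣ b * l - n := (Nat.modEq_iff_dvd' hlt.le).1 hlm.symm
      have := Nat.le_of_dvd (by omega) hdvd
      omega
    have h2 : b * l ≤ b * (a - 1) := Nat.mul_le_mul_left b (by omega)
    obtain ⟨a', rfl⟩ : ∃ a', a = a' + 1 := ⟨a - 1, by omega⟩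
    cases b with
    | zero => simp at h1
    | succ b' =>
      simp only [Nat.add_sub_cancel] at hn h2
      nlinarith
  have hdvd : a ∣ n - b * l := (Nat.modEq_iff_dvd' hle).1 hlm
  obtain ⟨i, hi⟩ := hdvd
  exact ⟨i, l, hl, by omega⟩

theorem eq_C_mul_X_one_pow {q : MvPolynomial (Fin 3) k} {n : ℕ} (hq : q.IsHomogeneous n)
    (h0 : substVar 0 0 q = q) (h2 : substVar 2 0 q = q) :
    q = C (coeff (Finsupp.single 1 n) q) * X 1 ^ n := by
  ext I
  rw [coeff_C_mul, coeff_X_pow]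
  by_cases h : Finsupp.single 1 n = I
  · rw [if_pos h, h, mul_one]
  · rw [if_neg h, mul_zero]
    by_contra hI
    have hI0 : I 0 = 0 := by
      rw [← h0, coeff_substVar_zero] at hI
      exact (ite_ne_right_iff.1 hI).1
    have hI2 : I 2 = 0 := by
      rw [← h2, coeff_substVar_zero] at hI
      exact (ite_ne_right_iff.1 hI).1
    have := IsHomogeneous.sum_eq hq hI
    refine h (Finsupp.ext fun i => ?_)
    fin_cases i <;> simp <;> omega

/-- A homogeneous invariant of `z`-degree less than `p³` is a power of `y` at `x = 0`. -/
theorem exists_substVar_two_eq (hp : p ≠ 2) (h : Function.Injective (rowOne p M))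
    {q : MvPolynomial (Fin 3) k} {n : ℕ} (hq : q.IsHomogeneous n) (hR : q ∈ invariantRing p M)
    (hz : (substVar 2 0 q).degreeOf 0 < p ^ 3) :
    ∃ c : k, substVar 2 0 q = C c * X 1 ^ n := by
  have h2 : (2 : k) ≠ 0 := Ring.two_ne_zero (by rwa [ringChar.eq k p])
  have hinj : Function.Injective ((AddMonoidHom.mulLeft (2 : k)).comp (rowOne p M)) := by
    intro a b hab
    exact h (mul_left_cancel₀ h2 hab)
  -- At x = 0 the action becomes z ↦ z + 2 c₁ y, a translation by a group of order p³ since p is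
  -- odd. A z-degree below p³ then excludes z altogether.
  have hinv : ∀ a, substVar 0
      (X 0 + C ((AddMonoidHom.mulLeft (2 : k)).comp (rowOne p M) a) * X 1) (substVar 2 0 q) =
        substVar 2 0 q := by
    intro a
    have hcomp : (substVar 0 (X 0 +
        C ((AddMonoidHom.mulLeft (2 : k)).comp (rowOne p M) a) * X 1)).comp (substVar 2 0) =
        (substVar 2 0).comp (polyAct (sigma (colComb p M a))) := by
      apply MvPolynomial.algHom_ext
      intro i
      fin_cases i
      · simp [substVar, polyAct_sigma_X_zero, colComb_eq]
      · simp [substVar, polyAct_sigma_X_one]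
      · simp [substVar, polyAct_sigma_X_two]
    have := DFunLike.congr_fun hcomp q
    rwa [AlgHom.comp_apply, AlgHom.comp_apply, mem_invariantRing.1 hR a] at this
  have h0 := substVar_zero_eq_of_translation hinj (i := 0) (t := X 1)
    (substVar_X_of_ne (by decide) _) (X_ne_zero _) hinv (by rw [card_fin_zmod]; exact hz)
  have hq' : (substVar 2 0 q).IsHomogeneous n := by
    intro I hI
    rw [coeff_substVar_zero] at hI
    exact hq (ite_ne_right_iff.1 hI).2
  refine ⟨_, eq_C_mul_X_one_pow hq' h0 ?_⟩
  ext I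
  rw [coeff_substVar_zero, coeff_substVar_zero]
  split_ifs <;> rfl

/-- Subducting `f^b - h^a` leads to an invariant with lead monomial `z^(p³)`. -/
theorem exists_invariant_degree_eq (hp : p ≠ 2) (hinj : Function.Injective (rowOne p M))
    {a b : ℕ} (ha : 0 < a) (hab : a.Coprime b) (hcond : (a - 1) * (b - 1) ≤ p ^ 3)
    (hlt : p ^ 3 < a * b) {f h : MvPolynomial (Fin 3) k}
    (hfR : f ∈ invariantRing p M) (hhR : h ∈ invariantRing p M)
    (hf : f.IsHomogeneous a) (hh : h.IsHomogeneous b)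
    (hf2 : substVar 2 0 f = X 1 ^ a) (hh2 : substVar 2 0 h = X 1 ^ b)
    {c : k} (hc : c ≠ 0)
    (hz : (f ^ b - h ^ a - C c * X 2 ^ (a * b - p ^ 3) * X 0 ^ p ^ 3).degreeOf 0 < p ^ 3)
    (hprod : ∀ i l, l < a → a * i + b * l < a * b → (f ^ i * h ^ l).degreeOf 0 < p ^ 3) :
    ∃ E ∈ invariantRing p M, E.IsHomogeneous (p ^ 3) ∧ coeff (Finsupp.single 0 (p ^ 3)) E ≠ 0 ∧
      ∃ Q : MvPolynomial (Fin 4) k, Q.degreeOf 2 < a ∧ aeval ![X 2, f, h, E] Q = h ^ a := by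
  have hpos : 0 < p ^ 3 := pow_pos (Fact.out : p.Prime).pos 3
  -- `E` is the remainder after s + 1 divisions by x. Its only part of z-degree at least p³ is the
  -- tracked term c x^(…) z^(p³), which loses one factor x each time and becomes c z^(p³) at the
  -- end.
  suffices key : ∀ s, s + 1 ≤ a * b - p ^ 3 → ∃ E ∈ invariantRing p M,
      E.IsHomogeneous (a * b - (s + 1)) ∧
      (E - C c * X 2 ^ (a * b - p ^ 3 - (s + 1)) * X 0 ^ p ^ 3).degreeOf 0 < p ^ 3 ∧
      ∃ Q : MvPolynomial (Fin 4) k, Q.degreeOf 2 < a ∧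
        ∀ N, aeval ![X 2, f, h, N] Q = f ^ b - h ^ a - X 2 ^ (s + 1) * E by
    obtain ⟨E, hER, hEh, hEz, Q, hQ, hQe⟩ := key (a * b - p ^ 3 - 1) (by omega)
    have e1 : a * b - p ^ 3 - 1 + 1 = a * b - p ^ 3 := by omega
    have e2 : a * b - (a * b - p ^ 3) = p ^ 3 := by omega
    rw [e1] at hEh hEz hQe
    rw [e2] at hEh
    rw [Nat.sub_self, pow_zero, mul_one] at hEz
    refine ⟨E, hER, hEh, ?_, X 1 ^ b - X 0 ^ (a * b - p ^ 3) * X 3 - Q, ?_, ?_⟩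
    · intro h0
      have hmem : Finsupp.single 0 (p ^ 3) ∈ (E - C c * X 0 ^ p ^ 3).support := by
        rw [mem_support_iff, coeff_sub, h0, coeff_C_mul, coeff_X_pow, if_pos rfl]
        simpa using hc
      have := (degreeOf_lt_iff hpos).1 hEz _ hmem
      simp at this
    · have d1 : (X 1 ^ b : MvPolynomial (Fin 4) k).degreeOf 2 = 0 := by
        refine Nat.eq_zero_of_le_zero ((degreeOf_pow_le _ _ _).trans ?_)
        rw [degreeOf_X]
        simp
      have d2 : (X 0 ^ (a * b - p ^ 3) * X 3 : MvPolynomial (Fin 4) k).degreeOf 2 = 0 := by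
        refine Nat.eq_zero_of_le_zero ((degreeOf_mul_le _ _ _).trans ?_)
        refine (add_le_add (degreeOf_pow_le _ _ _) le_rfl).trans ?_
        rw [degreeOf_X, degreeOf_X]
        simp
      refine lt_of_le_of_lt (degreeOf_sub_le _ _ _) (max_lt ?_ hQ)
      refine lt_of_le_of_lt (degreeOf_sub_le _ _ _) ?_
      rw [d1, d2]
      simpa using ha
    · rw [map_sub, hQe]
      simp
  have hdivide : ∀ (s : ℕ) (G : MvPolynomial (Fin 3) k), s + 1 ≤ a * b - p ^ 3 →
      G ∈ invariantRing p M → G.IsHomogeneous (a * b - s) →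
      (G - C c * X 2 ^ (a * b - p ^ 3 - s) * X 0 ^ p ^ 3).degreeOf 0 < p ^ 3 →
      substVar 2 0 G = 0 → ∃ E ∈ invariantRing p M, E.IsHomogeneous (a * b - (s + 1)) ∧
      (E - C c * X 2 ^ (a * b - p ^ 3 - (s + 1)) * X 0 ^ p ^ 3).degreeOf 0 < p ^ 3 ∧
      G = X 2 * E := by
    intro s G hs hGR hG hGz hG2
    obtain ⟨E, rfl⟩ := exists_eq_X_mul hG2
    refine ⟨E, mem_invariantRing_of_X_pow_mul (n := 1) (by rwa [pow_one]),
      isHomogeneous_of_X_mul (i := 2) ?_, ?_, rfl⟩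
    · have : a * b - (s + 1) + 1 = a * b - s := by omega
      rwa [this]
    · refine lt_of_le_of_lt (degreeOf_le_of_X_mul (i := 2) (by decide)) ?_
      have : a * b - p ^ 3 - s = a * b - p ^ 3 - (s + 1) + 1 := by omega
      rw [this] at hGz
      have e : X 2 * (E - C c * X 2 ^ (a * b - p ^ 3 - (s + 1)) * X 0 ^ p ^ 3) =
        X 2 * E - C c * X 2 ^ (a * b - p ^ 3 - (s + 1) + 1) * X 0 ^ p ^ 3 := by ring
      rwa [e]
  intro s
  induction s with
  | zero =>
    intro hs
    have h1 := hf.pow b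
    have h2 := hh.pow a
    rw [mul_comm b a] at h2
    have h3 : substVar 2 0 (f ^ b - h ^ a) = 0 := by
      rw [map_sub, map_pow, map_pow, hf2, hh2, ← pow_mul, ← pow_mul, mul_comm, sub_self]
    obtain ⟨E, hER, hEh, hEz, hGE⟩ := hdivide 0 (f ^ b - h ^ a) hs
      (sub_mem (pow_mem hfR _) (pow_mem hhR _)) (h1.sub h2) hz h3
    refine ⟨E, hER, hEh, hEz, 0, by simpa using ha, fun N => ?_⟩
    rw [map_zero, hGE]
    ring
  | succ s ih =>
    intro hs
    obtain ⟨E, hER, hEh, hEz, Q, hQ, hQe⟩ := ih (by omega)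
    -- The tracked term still contains x here, so it disappears at x = 0.
    have hEz2 : (substVar 2 0 E).degreeOf 0 < p ^ 3 := by
      refine lt_of_le_of_lt ?_ (lt_of_le_of_lt (degreeOf_substVar_zero_le 2 0 _) hEz)
      rw [map_sub, map_mul, map_mul, map_pow, map_pow, substVar_X_self,
        zero_pow (by omega), mul_zero, zero_mul, sub_zero]
    obtain ⟨α, hα⟩ := exists_substVar_two_eq hp hinj hEh hER hEz2
    -- The degree ab - (s + 1) is still above p³, hence at least (a - 1)(b - 1), so f^i h^l with l <
    -- a reproduces the power of y left at x = 0.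
    obtain ⟨i, l, hl, hil⟩ := exists_eq_mul_add_mul (n := a * b - (s + 1)) ha hab (by omega)
    have h1 := ((hf.pow i).mul (hh.pow l)).C_mul α
    rw [hil] at h1
    have h2 : (E - C α * (f ^ i * h ^ l)
        - C c * X 2 ^ (a * b - p ^ 3 - (s + 1)) * X 0 ^ p ^ 3).degreeOf 0 < p ^ 3 := by
      rw [sub_right_comm]
      refine lt_of_le_of_lt (degreeOf_sub_le _ _ _) (max_lt hEz ?_)
      refine lt_of_le_of_lt (degreeOf_C_mul_le _ _ _) (hprod i l hl ?_)
      omega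
    have h3 : substVar 2 0 (E - C α * (f ^ i * h ^ l)) = 0 := by
      rw [map_sub, map_mul, map_mul, map_pow, map_pow, hf2, hh2, hα, substVar_C, ← hil, pow_add,
        pow_mul, pow_mul, sub_self]
    obtain ⟨E', hER', hEh', hEz', hGE⟩ := hdivide (s + 1) (E - C α * (f ^ i * h ^ l)) hs
      (sub_mem hER (mul_mem (C_mem_invariantRing α) (mul_mem (pow_mem hfR _) (pow_mem hhR _))))
      (hEh.sub h1) h2 h3
    refine ⟨E', hER', hEh', hEz', Q + C α * X 0 ^ (s + 1) * X 1 ^ i * X 2 ^ l, ?_, fun N => ?_⟩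
    · refine lt_of_le_of_lt (degreeOf_add_le _ _ _) (max_lt hQ ?_)
      refine lt_of_le_of_lt (degreeOf_mul_le _ _ _) ?_
      have d1 : (C α * X 0 ^ (s + 1) * X 1 ^ i : MvPolynomial (Fin 4) k).degreeOf 2 = 0 := by
        refine Nat.eq_zero_of_le_zero ((degreeOf_mul_le _ _ _).trans ?_)
        refine (add_le_add ((degreeOf_C_mul_le _ _ _).trans (degreeOf_pow_le _ _ _))
          (degreeOf_pow_le _ _ _)).trans ?_
        rw [degreeOf_X, degreeOf_X]
        simp
      rw [d1, zero_add]
      refine lt_of_le_of_lt (degreeOf_pow_le _ _ _) ?_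
      rw [degreeOf_X]
      simpa using hl
    · rw [map_add, hQe]
      have e : aeval ![X 2, f, h, N] (C α * X 0 ^ (s + 1) * X 1 ^ i * X 2 ^ l :
          MvPolynomial (Fin 4) k) = C α * X 2 ^ (s + 1) * f ^ i * h ^ l := by
        simp
      rw [e]
      linear_combination -(X 2 ^ (s + 1)) * hGE

end RankThree

/-! ### Orbit products of y and z, and the criterion for an injective first row. -/

section OrbitProducts

variable {p : ℕ} {k : Type*} [Field k] [CharP k p] {M : Matrix (Fin 2) (Fin 3) k}

theorem two_ne_zero_of_charP (hp : p ≠ 2) : (2 : k) ≠ 0 :=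
  Ring.two_ne_zero (by rwa [ringChar.eq k p])

theorem rowOne_injective_colComb (h : Function.Injective (rowOne p M)) :
    Function.Injective (colComb p M) := fun _ _ hab => h (congrArg Prod.fst hab)

theorem polyAct_newZ (α γ : k) (c : k × k) :
    polyAct (sigma c) (newZ α γ) = newZ α γ + C (2 * (α * c.1)) * newY α
      + C ((α * c.1) ^ 2 + (α * γ * c.1 + α ^ 2 * c.2)) * X 2 :=
  (polyAct_newBasis α γ c).2.2

/-- The coefficient of y in the image determines c₁, since 2α² ≠ 0, and then the coefficient of x
determines c₂. -/
theorem polyAct_newZ_injective (hp : p ≠ 2) (hF : Function.Injective (colComb p M)) {α : k}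
    (hα : α ≠ 0) (γ : k) :
    Function.Injective fun a => polyAct (sigma (colComb p M a)) (newZ α γ) := by
  intro a b hab
  simp only [polyAct_newZ] at hab
  have h1 := congrArg (aeval ![(0 : k), 1, 0]) hab
  have h2 := congrArg (aeval ![(0 : k), 0, 1]) hab
  simp [newZ, newY, hα, two_ne_zero_of_charP (k := k) hp] at h1 h2
  rw [h1] at h2
  simp [hα] at h2
  exact hF (Prod.ext h1 h2)

variable [Fact p.Prime]

theorem orbitProd_newZ (hp : p ≠ 2) (hF : Function.Injective (colComb p M)) {α : k}
    (hα : α ≠ 0) (γ : k) :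
    orbitProd p M (newZ α γ) = ∏ a, polyAct (sigma (colComb p M a)) (newZ α γ) :=
  orbitProd_eq_prod (polyAct_newZ_injective hp hF hα γ) (fun a => ⟨a, rfl⟩) fun a => ⟨a, rfl⟩

theorem orbitProd_newZ_isHomogeneous (hp : p ≠ 2) (hF : Function.Injective (colComb p M)) {α : k}
    (hα : α ≠ 0) (γ : k) : (orbitProd p M (newZ α γ)).IsHomogeneous (p ^ 3) := by
  rw [orbitProd_newZ hp hF hα]
  have := IsHomogeneous.prod (Finset.univ : Finset (Fin 3 → ZMod p))
    (fun a => polyAct (sigma (colComb p M a)) (newZ α γ)) (fun _ => 1) fun a _ => by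
      rw [polyAct_newZ, newZ, newY]
      refine ((((isHomogeneous_X _ _).C_mul _).add ((isHomogeneous_X _ _).C_mul _)).add
        (((isHomogeneous_X _ _).C_mul _).C_mul _)).add ((isHomogeneous_X _ _).C_mul _)
  simpa [ZMod.card] using this

theorem orbitProd_newZ_degree (hp : p ≠ 2) (hF : Function.Injective (colComb p M)) {α : k}
    (hα : α ≠ 0) (γ : k) :
    orbitProd p M (newZ α γ) ≠ 0 ∧
    grevlex.degree (orbitProd p M (newZ α γ)) = Finsupp.single 0 (p ^ 3) := by
  have hc : coeff (Finsupp.single 0 (p ^ 3)) (orbitProd p M (newZ α γ)) ≠ 0 := by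
    rw [coeff_single_zero (orbitProd_newZ_isHomogeneous hp hF hα γ), orbitProd_newZ hp hF hα,
      map_prod]
    refine Finset.prod_ne_zero_iff.2 fun a _ => ?_
    rw [polyAct_newZ, newZ, newY]
    simp [hα]
  exact ⟨fun h => hc (by rw [h, coeff_zero]),
    degree_eq_single_zero (orbitProd_newZ_isHomogeneous hp hF hα γ) hc⟩

theorem orbitProd_X_one_isHomogeneous (h : Function.Injective (rowOne p M)) :
    (orbitProd p M (X 1)).IsHomogeneous (p ^ 3) := by
  rw [orbitProd_X_one h]
  have := IsHomogeneous.prod (Finset.univ : Finset (Fin 3 → ZMod p))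
    (fun a => (X 1 + C (rowOne p M a) * X 2 : MvPolynomial (Fin 3) k)) (fun _ => 1) fun a _ =>
      (isHomogeneous_X _ _).add ((isHomogeneous_X _ _).C_mul _)
  simpa [ZMod.card] using this

theorem substVar_two_orbitProd_X_one (h : Function.Injective (rowOne p M)) :
    substVar 2 0 (orbitProd p M (X 1)) = X 1 ^ p ^ 3 := by
  rw [orbitProd_X_one h, map_prod]
  simp [substVar, ZMod.card]

theorem substVar_zero_orbitProd_X_one (h : Function.Injective (rowOne p M)) :
    substVar 0 0 (orbitProd p M (X 1)) = orbitProd p M (X 1) := by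
  rw [orbitProd_X_one h, map_prod]
  simp [substVar]

theorem degreeOf_eq_zero_of_substVar {i : Fin 3} {q : MvPolynomial (Fin 3) k}
    (h : substVar i 0 q = q) : q.degreeOf i = 0 := by
  refine Nat.eq_zero_of_le_zero ((degreeOf_le_iff).2 fun I hI => ?_)
  rw [mem_support_iff, ← h, coeff_substVar_zero] at hI
  exact (ite_ne_right_iff.1 hI).1.le

/-- The structure of the invariants when the first row is injective on `G`. -/
theorem leadShape_of_rowOne_injective (hp : p ≠ 2) (hinj : Function.Injective (rowOne p M))
    {a b : ℕ} (ha : 0 < a) (hab : a.Coprime b) (hcond : (a - 1) * (b - 1) ≤ p ^ 3)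
    (hlt : p ^ 3 < a * b) {f h : MvPolynomial (Fin 3) k}
    (hfR : f ∈ invariantRing p M) (hhR : h ∈ invariantRing p M)
    (hf : f.IsHomogeneous a) (hh : h.IsHomogeneous b)
    (hf2 : substVar 2 0 f = X 1 ^ a) (hh2 : substVar 2 0 h = X 1 ^ b)
    {c : k} (hc : c ≠ 0)
    (hz : (f ^ b - h ^ a - C c * X 2 ^ (a * b - p ^ 3) * X 0 ^ p ^ 3).degreeOf 0 < p ^ 3)
    (hprod : ∀ i l, l < a → a * i + b * l < a * b → (f ^ i * h ^ l).degreeOf 0 < p ^ 3)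
    {B : MvPolynomial (Fin 3) k} {c' : k} {r : ℕ} (hc' : c' ≠ 0) (hB : substVar 0 0 B = B)
    (hfB : f = B + C c' * X 2 ^ r * X 0)
    (hN : orbitProd p M (X 1) ∈ Algebra.adjoin k {f, h, X 2})
    {N : MvPolynomial (Fin 3) k} (hN0 : N ≠ 0)
    (hNdeg : grevlex.degree N = Finsupp.single 0 (p ^ 3)) :
    LeadShape ![X 2, f, h, N] a b (p ^ 3) ∧
    grevlex.leadingCoeff f = 1 ∧ grevlex.leadingCoeff h = 1 ∧
    ∀ F ∈ invariantRing p M, F ≠ 0 → ∃ I : Fin 4 →₀ ℕ, grevlex.degree F =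
      grevlex.degree (aeval ![X 2, f, h, N] (monomial I (1 : k))) := by
  have hdf := degree_eq_single_one (c := (1 : k)) hf one_ne_zero (by rw [hf2, C_1, one_mul])
  have hdh := degree_eq_single_one (c := (1 : k)) hh one_ne_zero (by rw [hh2, C_1, one_mul])
  have hne : ∀ q : MvPolynomial (Fin 3) k, grevlex.leadingCoeff q = 1 → q ≠ 0 := by
    rintro q hq rfl
    simp at hq
  have hshape : ∀ N : MvPolynomial (Fin 3) k, N ≠ 0 →
      grevlex.degree N = Finsupp.single 0 (p ^ 3) → LeadShape ![X 2, f, h, N] a b (p ^ 3) := by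
    intro N hN0 hN
    refine ⟨rfl, fun i => ?_, hdf.1, hdh.1, hN, hab, ha, pow_pos (Fact.out : p.Prime).pos 3⟩
    fin_cases i
    · exact X_ne_zero _
    · exact hne _ hdf.2
    · exact hne _ hdh.2
    · exact hN0
  -- The relation is known with E as the fourth generator. The lead monomials it yields are the same
  -- for N, because only the degree of the fourth generator enters.
  obtain ⟨E, hER, hEh, hEc, Q, hQ, hQe⟩ := exists_invariant_degree_eq hp hinj ha hab hcond hlt
    hfR hhR hf hh hf2 hh2 hc hz hprod
  have hE0 : E ≠ 0 := fun h => hEc (by rw [h, coeff_zero])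
  have hEs := hshape E hE0 (degree_eq_single_zero hEh hEc)
  refine ⟨hshape N hN0 hNdeg, hdf.2, hdh.2, fun F hF hF0 => ?_⟩
  obtain ⟨I, hI⟩ := hEs.exists_degree_eq (R := invariantRing p M) hQ hQe (fun F hF => by
    obtain ⟨n, hn⟩ := exists_pow_mul_mem_adjoin hinj hc' hB hfB hfR hF
    refine ⟨n, (Algebra.adjoin_le ?_) hn⟩
    have hf' : f ∈ Algebra.adjoin k (Set.range ![X 2, f, h, E]) :=
      Algebra.subset_adjoin ⟨1, rfl⟩
    have hx' : X 2 ∈ Algebra.adjoin k (Set.range ![X 2, f, h, E]) :=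
      Algebra.subset_adjoin ⟨0, rfl⟩
    rintro _ (rfl | rfl | rfl)
    · refine (Algebra.adjoin_mono ?_) hN
      rintro _ (rfl | rfl | rfl)
      · exact ⟨1, rfl⟩
      · exact ⟨2, rfl⟩
      · exact ⟨0, rfl⟩
    · exact hf'
    · exact hx') F hF hF0
  exact ⟨I, by rw [hI, hEs.degree_eq I one_ne_zero,
    (hshape N hN0 hNdeg).degree_eq I one_ne_zero]⟩

end OrbitProducts

/-! ### The case c₂ = s c₁. -/

section SymmetricSquare

variable {p : ℕ} [Fact p.Prime] {k : Type*} [Field k] [CharP k p]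
  {M : Matrix (Fin 2) (Fin 3) k}

/-- The change -c₂ x² of δ is compensated by s x y, so f = δ + s x y is invariant. With h the orbit
product of y this is the pair (2, p³), coprime as p is odd, and f^(p³) - h² contains z^(p³) only in
the term (-1)^(p³) x^(p³) z^(p³). -/
theorem isHypersurface_of_rowTwo_eq (hp : p ≠ 2) (hinj : Function.Injective (rowOne p M)) {s : k}
    (hs : ∀ a, rowTwo p M a = s * rowOne p M a) : IsHypersurface (invariantRing p M) := by
  have hpp := (Fact.out : p.Prime)
  have hp3 : 3 ≤ p ^ 3 := by
    have : 2 ≤ p := hpp.two_le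
    calc 3 ≤ 2 ^ 3 := by norm_num
      _ ≤ p ^ 3 := Nat.pow_le_pow_left this 3
  have hFa := rowOne_injective_colComb hinj
  set B : MvPolynomial (Fin 3) k := X 1 ^ 2 + C s * X 1 * X 2 with hBdef
  set f : MvPolynomial (Fin 3) k := B + C (-1) * X 2 ^ 1 * X 0 with hfdef
  set h := orbitProd p M (X 1) with hhdef
  have hB : substVar 0 0 B = B := by simp [hBdef, substVar]
  have hfd : f = delta + C s * X 1 * X 2 := by
    rw [hfdef, hBdef, delta, C_neg, C_1]
    ring
  have hfR : f ∈ invariantRing p M := by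
    rw [mem_invariantRing]
    intro a
    rw [hfd, map_add, polyAct_sigma_delta, map_mul, map_mul, polyAct_C, polyAct_sigma_X_one,
      polyAct_sigma_X_two, colComb_eq, hs, C_mul]
    ring
  have hf : f.IsHomogeneous 2 := by
    rw [hfdef, hBdef]
    refine ((isHomogeneous_X_pow _ _).add ?_).add ?_
    · exact ((isHomogeneous_X _ _).C_mul _).mul (isHomogeneous_X _ _)
    · exact ((isHomogeneous_X_pow _ _).C_mul _).mul (isHomogeneous_X _ _)
  have hh := orbitProd_X_one_isHomogeneous hinj
  have hdh : h.degreeOf 0 = 0 := degreeOf_eq_zero_of_substVar (substVar_zero_orbitProd_X_one hinj)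
  have hdB : B.degreeOf 0 = 0 := degreeOf_eq_zero_of_substVar hB
  have hdf : f.degreeOf 0 ≤ 1 := by
    refine (degreeOf_add_le _ _ _).trans (max_le (by rw [hdB]; norm_num) ?_)
    rw [mul_assoc]
    refine (degreeOf_C_mul_le _ _ _).trans ((degreeOf_mul_le _ _ _).trans ?_)
    rw [pow_one, degreeOf_X, degreeOf_X]
    simp
  have hdeg := orbitProd_newZ_degree hp hFa (one_ne_zero (α := k)) 0
  have hhom := orbitProd_newZ_isHomogeneous hp hFa (one_ne_zero (α := k)) 0
  obtain ⟨hshape, hlf, hlh, hlead⟩ := leadShape_of_rowOne_injective hp hinj (a := 2) (b := p ^ 3)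
    (f := f) (h := h) (c := (-1) ^ p ^ 3) (c' := -1) (r := 1) (B := B) two_pos
    (Nat.Coprime.pow_right 3 ((Nat.coprime_primes Nat.prime_two hpp).2 hp.symm)) (by omega)
    (by omega) hfR (orbitProd_mem _) hf hh (by simp [hfdef, hBdef, substVar])
    (substVar_two_orbitProd_X_one hinj) (pow_ne_zero _ (neg_ne_zero.2 one_ne_zero))
    (by
      have e : 2 * p ^ 3 - p ^ 3 = p ^ 3 := by omega
      have e2 : f ^ p ^ 3 - h ^ 2 - C ((-1) ^ p ^ 3) * X 2 ^ (2 * p ^ 3 - p ^ 3) * X 0 ^ p ^ 3 =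
          B ^ p ^ 3 - h ^ 2 := by
        rw [e, hfdef, add_pow_char_pow, mul_pow, mul_pow, pow_one, ← C_pow]
        ring
      rw [e2]
      refine lt_of_le_of_lt (degreeOf_sub_le _ _ _) (max_lt ?_ ?_)
      · refine lt_of_le_of_lt (degreeOf_pow_le _ _ _) ?_
        rw [hdB]
        omega
      · refine lt_of_le_of_lt (degreeOf_pow_le _ _ _) ?_
        rw [hdh]
        omega)
    (by
      intro i l _ hil
      refine lt_of_le_of_lt (degreeOf_mul_le _ _ _) ?_
      have h1 : (f ^ i).degreeOf 0 ≤ i * 1 :=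
        (degreeOf_pow_le _ _ _).trans (Nat.mul_le_mul_left i hdf)
      have h2 : (h ^ l).degreeOf 0 ≤ l * 0 :=
        (degreeOf_pow_le _ _ _).trans (Nat.mul_le_mul_left l hdh.le)
      have h3 : 0 ≤ p ^ 3 * l := Nat.zero_le _
      omega)
    (neg_ne_zero.2 one_ne_zero) hB rfl (Algebra.subset_adjoin (Or.inr (Or.inl rfl)))
    hdeg.1 hdeg.2
  refine hshape.isHypersurface (R := invariantRing p M) (hshape.singleRelation (fun i => ?_) hlead
    (by simp [hlf, hlh])) (w := ![1, 2, p ^ 3, p ^ 3]) (fun i => ?_) (fun i => ?_) rfl rfl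
    (fun i => ?_) le_rfl (by omega)
  · fin_cases i
    · exact X_two_mem_invariantRing
    · exact hfR
    · exact orbitProd_mem _
    · exact orbitProd_mem _
  · fin_cases i
    · exact isHomogeneous_X _ _
    · exact hf
    · exact hh
    · exact hhom
  · fin_cases i
    · exact one_pos
    · exact two_pos
    · exact pow_pos hpp.pos 3
    · exact pow_pos hpp.pos 3
  · fin_cases i
    · show 1 ≠ 2 * p ^ 3
      omega
    · show 2 ≠ 2 * p ^ 3
      omega
    · show p ^ 3 ≠ 2 * p ^ 3
      omega
    · show p ^ 3 ≠ 2 * p ^ 3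
      omega

end SymmetricSquare

/-! ### Bounds for the degree in one variable. -/

section DegreeBounds

variable {k : Type*} [Field k] {q r : MvPolynomial (Fin 3) k} {a b n : ℕ} {i : Fin 3}

theorem degreeOf_add_le_of_le (hq : q.degreeOf i ≤ n) (hr : r.degreeOf i ≤ n) :
    (q + r).degreeOf i ≤ n := (degreeOf_add_le _ _ _).trans (max_le hq hr)

theorem degreeOf_sub_le_of_le (hq : q.degreeOf i ≤ n) (hr : r.degreeOf i ≤ n) :
    (q - r).degreeOf i ≤ n := (degreeOf_sub_le _ _ _).trans (max_le hq hr)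

theorem degreeOf_mul_le_of_le (hq : q.degreeOf i ≤ a) (hr : r.degreeOf i ≤ b) (h : a + b ≤ n) :
    (q * r).degreeOf i ≤ n := (degreeOf_mul_le _ _ _).trans ((add_le_add hq hr).trans h)

theorem degreeOf_mul_le_of_eq_zero (hq : q.degreeOf i = 0) (hr : r.degreeOf i ≤ n) :
    (q * r).degreeOf i ≤ n := degreeOf_mul_le_of_le hq.le hr (by omega)

theorem degreeOf_pow_le_of_le (hq : q.degreeOf i ≤ a) (h : b * a ≤ n) :
    (q ^ b).degreeOf i ≤ n := (degreeOf_pow_le _ _ _).trans ((Nat.mul_le_mul_left b hq).trans h)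

end DegreeBounds

/-! ### The explicit polynomials f and h̃ for b ≠ 0. -/

section ExplicitInvariants

variable {p : ℕ} {k : Type*} [Field k]

/-- `y^p + c δ x^{p-2} + e y x^{p-1}`. -/
noncomputable def polyF (p : ℕ) (c e : k) : MvPolynomial (Fin 3) k :=
  X 1 ^ p + C c * delta * X 2 ^ (p - 2) + C e * X 1 * X 2 ^ (p - 1)

/-- The linear form `e y - c z`. -/
noncomputable def polyV (c e : k) : MvPolynomial (Fin 3) k := C e * X 1 - C c * X 0

/-- The quadratic form `c δ + e x y`. -/
noncomputable def polyU (c e : k) : MvPolynomial (Fin 3) k := C c * X 1 ^ 2 + X 2 * polyV c e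

/-- The part of `polyK` of small `z`-degree. -/
noncomputable def polyR (p : ℕ) (c e : k) (L : MvPolynomial (Fin 3) k) : MvPolynomial (Fin 3) k :=
  X 2 ^ (p - 2) * X 2 ^ 4 * (L - C (e ^ p ^ 2) * X 1 ^ p ^ 2)
    + C (2 * c ^ p ^ 2) * X 2 ^ 2 * (X 1 ^ p) ^ p * polyV c e ^ p
    + C (c ^ p ^ 2) * X 2 ^ ((p - 2) * (p - 1)) * (polyU c e ^ p) ^ 2
    - C (2 * c ^ p ^ 2 * c ^ p) * (C 2 * (X 1 ^ p) ^ p * X 1 ^ p * polyU c e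
      + X 2 ^ (p - 2) * (X 1 ^ p) ^ p * polyU c e ^ 2
      + X 2 ^ ((p - 2) * (p - 1)) * polyU c e ^ p * (X 1 ^ p + X 2 ^ (p - 2) * polyU c e) ^ 2)

/-- The quotient of `h̃` by `x^{p³-p²-p-2}`, where `N_G(y) = y^{p³} + x^{p³-p²} L`. -/
noncomputable def polyK (p : ℕ) (c e : k) (L : MvPolynomial (Fin 3) k) : MvPolynomial (Fin 3) k :=
  C (c ^ p ^ 2) * X 2 ^ (p - 2) * X 2 ^ 4 * X 0 ^ p ^ 2 + polyR p c e L

theorem polyF_eq (hp : 2 ≤ p) (c e : k) :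
    polyF p c e = X 1 ^ p + X 2 ^ (p - 2) * polyU c e := by
  have : p - 1 = p - 2 + 1 := by omega
  rw [polyF, polyU, polyV, delta, this, pow_succ]
  ring

/-- The cancellations in h̃ with all powers replaced by letters: with m = p - 2 and u, v the forms
`polyU`, `polyV`, put a = x^m, b = a^p, d = a^(p²), b' = x^(m(m+1)), Y = y^p, Yp = y^(p²), YY =
y^(p³), U = u^p, V = v^p, V2 = v^(p²), c1 = c^p, c2 = c^(p²). The common factor d b a is
x^(p³-p²-p-2). -/
theorem subduction_identity {S : Type*} [CommRing S]
    {d a b b' x Y Yp YY L V V2 U u c1 c2 : S} (hU : U = c1 * Y ^ 2 + a * x ^ 2 * V)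
    (hb : b = a * b') :
    YY + d * (b * (a ^ 2 * x ^ 4)) * L - (YY + d * (c2 * Yp ^ 2 + b * (a ^ 2 * x ^ 4) * V2))
      + c2 * (Yp + b * U) ^ 2 * d
      - 2 * c2 * c1 * ((Yp + b * U) * (Y + a * u) ^ 2) * (d * b) =
    d * b * a * (a * x ^ 4 * (L - V2) + 2 * c2 * x ^ 2 * Yp * V + c2 * b' * U ^ 2
      - 2 * c2 * c1 * (2 * Yp * Y * u + a * Yp * u ^ 2 + b' * U * (Y + a * u) ^ 2)) := by
  linear_combination (2 * c2 * Yp * b * d) * hU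
    + (d * b * c2 * U ^ 2 - 2 * c1 * c2 * d * b * U * (Y + a * u) ^ 2) * hb

theorem exponent_identities {p m : ℕ} (hm : p = m + 2) :
    p ^ 3 - p ^ 2 = m * p ^ 2 + (m * p + 2 * p) ∧ p ^ 3 - 2 * p ^ 2 = m * p ^ 2 ∧
    p ^ 3 - p ^ 2 - 2 * p = m * p ^ 2 + m * p ∧
    p ^ 3 - p ^ 2 - p - 2 = m * p ^ 2 + m * p + m ∧ m * p = m + m * (m + 1) := by
  subst hm
  refine ⟨?_, ?_, ?_, ?_, by ring⟩
  · exact Nat.sub_eq_of_eq_add (by ring)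
  · exact Nat.sub_eq_of_eq_add (by ring)
  · rw [Nat.sub_sub]
    exact Nat.sub_eq_of_eq_add (by ring)
  · rw [Nat.sub_sub, Nat.sub_sub]
    exact Nat.sub_eq_of_eq_add (by ring)

/-- Only the summand with (y^p)^p y^p u carries no factor x, and u is c y² at x = 0. This is the
origin of the constant -4 c^(p²+p+1). -/
theorem substVar_two_polyK (hp : 3 ≤ p) (c e : k) (L : MvPolynomial (Fin 3) k) :
    substVar 2 0 (polyK p c e L) = C (-4 * c ^ (p ^ 2 + p + 1)) * X 1 ^ (p ^ 2 + p + 2) := by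
  have hu : substVar 2 0 (polyU c e) = C c * X 1 ^ 2 := by
    simp [polyU, substVar]
  have h1 : substVar 2 0 (X 1 : MvPolynomial (Fin 3) k) = X 1 := substVar_X_of_ne (by decide) _
  have e1 : p - 2 ≠ 0 := by omega
  have e2 : (p - 2) * (p - 1) ≠ 0 := mul_ne_zero (by omega) (by omega)
  rw [polyK, polyR]
  simp only [map_add, map_sub, map_mul, map_pow, substVar_X_self, hu, h1, substVar_C, zero_pow e1,
    zero_pow e2, map_neg, map_ofNat]
  ring

theorem degreeOf_polyV (c e : k) : (polyV c e).degreeOf 0 ≤ 1 := by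
  refine degreeOf_sub_le_of_le ?_ ?_ <;>
  refine degreeOf_mul_le_of_eq_zero (degreeOf_C _ _) ?_ <;> rw [degreeOf_X] <;> simp

theorem degreeOf_X_pow_eq_zero {i j : Fin 3} (h : i ≠ j) (n : ℕ) :
    ((X j : MvPolynomial (Fin 3) k) ^ n).degreeOf i = 0 := by
  refine Nat.eq_zero_of_le_zero (degreeOf_pow_le_of_le (a := 0) ?_ (by simp))
  rw [degreeOf_X, if_neg h]

theorem degreeOf_mul_eq_zero {i : Fin 3} {q r : MvPolynomial (Fin 3) k} (hq : q.degreeOf i = 0)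
    (hr : r.degreeOf i = 0) : (q * r).degreeOf i = 0 :=
  Nat.eq_zero_of_le_zero (degreeOf_mul_le_of_eq_zero hq hr.le)

theorem degreeOf_polyU (c e : k) : (polyU c e).degreeOf 0 ≤ 1 := by
  refine degreeOf_add_le_of_le ?_ ?_
  · exact degreeOf_mul_le_of_eq_zero (degreeOf_C _ _)
      (by rw [degreeOf_X_pow_eq_zero (by decide)]; norm_num)
  · refine degreeOf_mul_le_of_eq_zero ?_ (degreeOf_polyV c e)
    simpa using degreeOf_X_pow_eq_zero (k := k) (i := 0) (j := 2) (by decide) 1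

theorem degreeOf_polyF (hp : 2 ≤ p) (c e : k) : (polyF p c e).degreeOf 0 ≤ 1 := by
  rw [polyF_eq hp]
  refine degreeOf_add_le_of_le (by rw [degreeOf_X_pow_eq_zero (by decide)]; norm_num) ?_
  exact degreeOf_mul_le_of_eq_zero (degreeOf_X_pow_eq_zero (by decide) _) (degreeOf_polyU c e)

/-- As 2p < p², the term c^(p²) x^(p+2) z^(p²) is the only part of `polyK` of larger z-degree; its
p-th power will provide z^(p³). -/
theorem degreeOf_polyR (hp : 3 ≤ p) (c e : k) {L : MvPolynomial (Fin 3) k}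
    (hL : L.degreeOf 0 = 0) : (polyR p c e L).degreeOf 0 ≤ 2 * p := by
  have hx : ∀ n, ((X 2 : MvPolynomial (Fin 3) k) ^ n).degreeOf 0 = 0 :=
    degreeOf_X_pow_eq_zero (by decide)
  have hy : ∀ n, ((X 1 : MvPolynomial (Fin 3) k) ^ n).degreeOf 0 = 0 :=
    degreeOf_X_pow_eq_zero (by decide)
  have hyy : ((X 1 ^ p : MvPolynomial (Fin 3) k) ^ p).degreeOf 0 = 0 := by
    rw [← pow_mul]
    exact hy _
  have hC : ∀ c : k, (C c : MvPolynomial (Fin 3) k).degreeOf 0 = 0 := fun c => degreeOf_C _ _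
  have hu := degreeOf_polyU c e
  have hup : (polyU c e ^ p).degreeOf 0 ≤ p := degreeOf_pow_le_of_le hu (by omega)
  refine degreeOf_sub_le_of_le (degreeOf_add_le_of_le (degreeOf_add_le_of_le ?_ ?_) ?_) ?_
  · refine degreeOf_mul_le_of_eq_zero (degreeOf_mul_eq_zero (hx _) (hx _))
      (degreeOf_sub_le_of_le (by omega) ?_)
    exact degreeOf_mul_le_of_eq_zero (hC _) (by rw [hy]; omega)
  · refine degreeOf_mul_le_of_eq_zero (degreeOf_mul_eq_zero (degreeOf_mul_eq_zero (hC _) (hx _)) hyy)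
      (degreeOf_pow_le_of_le (degreeOf_polyV c e) (by omega))
  · refine degreeOf_mul_le_of_eq_zero (degreeOf_mul_eq_zero (hC _) (hx _)) ?_
    exact degreeOf_pow_le_of_le hup le_rfl
  · refine degreeOf_mul_le_of_eq_zero (hC _)
      (degreeOf_add_le_of_le (degreeOf_add_le_of_le ?_ ?_) ?_)
    · exact degreeOf_mul_le_of_eq_zero
        (degreeOf_mul_eq_zero (degreeOf_mul_eq_zero (hC _) hyy) (hy _)) (hu.trans (by omega))
    · exact degreeOf_mul_le_of_eq_zero (degreeOf_mul_eq_zero (hx _) hyy)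
        (degreeOf_pow_le_of_le hu (by omega))
    · refine degreeOf_mul_le_of_le (degreeOf_mul_le_of_eq_zero (hx _) hup)
        (degreeOf_pow_le_of_le (a := 1) (n := 2) ?_ le_rfl) (by omega)
      refine degreeOf_add_le_of_le (by rw [hy]; omega) ?_
      exact degreeOf_mul_le_of_eq_zero (hx _) hu

variable [Fact p.Prime] [CharP k p]

theorem X_pow_mul_polyK (c e : k) {L N : MvPolynomial (Fin 3) k}
    (hN : N = X 1 ^ p ^ 3 + X 2 ^ (p ^ 3 - p ^ 2) * L) :
    N - polyF p c e ^ p ^ 2 + C (c ^ p ^ 2) * polyF p c e ^ (2 * p) * X 2 ^ (p ^ 3 - 2 * p ^ 2)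
      - C (2 * c ^ (p ^ 2 + p)) * polyF p c e ^ (p + 2) * X 2 ^ (p ^ 3 - p ^ 2 - 2 * p) =
    X 2 ^ (p ^ 3 - p ^ 2 - p - 2) * polyK p c e L := by
  have hpp := (Fact.out : p.Prime)
  obtain ⟨m, hm⟩ : ∃ m, p = m + 2 := ⟨p - 2, by have := hpp.two_le; omega⟩
  obtain ⟨e1, e2, e3, e4, e5⟩ := exponent_identities hm
  have hm2 : p - 2 = m := by omega
  have hm1 : p - 1 = m + 1 := by omega
  have hx : (X 2 : MvPolynomial (Fin 3) k) ^ p = X 2 ^ m * X 2 ^ 2 := by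
    rw [← pow_add, ← hm]
  have hf : polyF p c e = X 1 ^ p + X 2 ^ m * polyU c e := by
    rw [polyF_eq hpp.two_le, hm2]
  have hfp : polyF p c e ^ p = (X 1 ^ p) ^ p + (X 2 ^ m) ^ p * polyU c e ^ p := by
    rw [hf, add_pow_char, mul_pow]
  have hU : polyU c e ^ p = C (c ^ p) * (X 1 ^ p) ^ 2 + X 2 ^ m * X 2 ^ 2 * polyV c e ^ p := by
    rw [polyU, add_pow_char, mul_pow, mul_pow, hx, C_pow, pow_right_comm]
  have hxx : ((X 2 : MvPolynomial (Fin 3) k) ^ p) ^ p =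
      (X 2 ^ m) ^ p * ((X 2 ^ m) ^ 2 * X 2 ^ 4) := by
    rw [hx, mul_pow, ← pow_mul (X 2) 2 p, mul_comm 2 p, pow_mul, hx]
    ring
  have hV2 : polyV c e ^ p ^ 2 = C (e ^ p ^ 2) * X 1 ^ p ^ 2 - C (c ^ p ^ 2) * X 0 ^ p ^ 2 := by
    rw [polyV, sub_pow_char_pow, mul_pow, mul_pow, C_pow, C_pow]
  have hUU : polyU c e ^ p ^ 2 = C (c ^ p ^ 2) * ((X 1 ^ p) ^ p) ^ 2
      + (X 2 ^ m) ^ p * ((X 2 ^ m) ^ 2 * X 2 ^ 4) * polyV c e ^ p ^ 2 := by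
    rw [← hxx, polyU, add_pow_char_pow, mul_pow, mul_pow, C_pow, ← pow_mul (X 2) p p, ← sq,
      ← pow_mul (X 1) p p, ← sq, pow_right_comm]
  have hff : polyF p c e ^ p ^ 2 = X 1 ^ p ^ 3 + (X 2 ^ m) ^ p ^ 2 * polyU c e ^ p ^ 2 := by
    rw [hf, add_pow_char_pow, mul_pow, ← pow_mul, ← pow_succ']
  have hb : ((X 2 : MvPolynomial (Fin 3) k) ^ m) ^ p = X 2 ^ m * X 2 ^ (m * (m + 1)) := by
    rw [← pow_mul, e5, pow_add]
  have hx1 : (X 2 : MvPolynomial (Fin 3) k) ^ (p ^ 3 - p ^ 2) =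
      (X 2 ^ m) ^ p ^ 2 * ((X 2 ^ m) ^ p * ((X 2 ^ m) ^ 2 * X 2 ^ 4)) := by
    rw [← hxx, e1, pow_add, pow_mul, ← pow_mul (X 2) p p]
    congr 2
    nlinarith
  have hx2 : (X 2 : MvPolynomial (Fin 3) k) ^ (p ^ 3 - 2 * p ^ 2) = (X 2 ^ m) ^ p ^ 2 := by
    rw [e2, pow_mul]
  have hx3 : (X 2 : MvPolynomial (Fin 3) k) ^ (p ^ 3 - p ^ 2 - 2 * p) =
      (X 2 ^ m) ^ p ^ 2 * (X 2 ^ m) ^ p := by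
    rw [e3, pow_add, pow_mul, pow_mul]
  have hx4 : (X 2 : MvPolynomial (Fin 3) k) ^ (p ^ 3 - p ^ 2 - p - 2) =
      (X 2 ^ m) ^ p ^ 2 * (X 2 ^ m) ^ p * X 2 ^ m := by
    rw [e4, pow_add, pow_add, pow_mul, pow_mul]
  have hx5 : (X 2 : MvPolynomial (Fin 3) k) ^ ((p - 2) * (p - 1)) = X 2 ^ (m * (m + 1)) := by
    rw [hm2, hm1]
  rw [polyK, polyR, hN, hx1, hx2, hx3, hx4, hx5, hm2, hff, hUU, mul_comm 2 p,
    pow_mul (polyF p c e) p 2, pow_add (polyF p c e) p 2, hfp, hf, pow_add c]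
  have key := subduction_identity (d := ((X 2 : MvPolynomial (Fin 3) k) ^ m) ^ p ^ 2)
    (YY := X 1 ^ p ^ 3) (Yp := (X 1 ^ p) ^ p) (L := L) (V2 := polyV c e ^ p ^ 2) (u := polyU c e)
    (c2 := C (c ^ p ^ 2)) hU hb
  rw [hV2] at key ⊢
  simp only [C_mul, map_ofNat]
  -- The powers become independent letters, and what is left is the identity `key`.
  generalize ((X 2 : MvPolynomial (Fin 3) k) ^ m) ^ p ^ 2 = d at *
  generalize ((X 2 : MvPolynomial (Fin 3) k) ^ m) ^ p = b at *
  generalize (X 2 : MvPolynomial (Fin 3) k) ^ (m * (m + 1)) = b' at *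
  generalize (X 2 : MvPolynomial (Fin 3) k) ^ m = a at *
  generalize (X 1 : MvPolynomial (Fin 3) k) ^ p ^ 3 = YY at *
  generalize ((X 1 : MvPolynomial (Fin 3) k) ^ p) ^ p = Yp at *
  generalize (X 1 : MvPolynomial (Fin 3) k) ^ p = Y at *
  generalize (X 1 : MvPolynomial (Fin 3) k) ^ p ^ 2 = Y2 at *
  generalize (X 0 : MvPolynomial (Fin 3) k) ^ p ^ 2 = Z2 at *
  generalize polyU c e ^ p = U at *
  generalize polyV c e ^ p = V at *
  generalize (C (c ^ p ^ 2) : MvPolynomial (Fin 3) k) = c2 at *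
  generalize (C (c ^ p) : MvPolynomial (Fin 3) k) = c1 at *
  generalize (C (e ^ p ^ 2) : MvPolynomial (Fin 3) k) = ee at *
  linear_combination key

end ExplicitInvariants

/-! ### Minors of Γ when c₂ = a c₁ + b c₁^p. -/

section GammaMinors

variable {p : ℕ} [Fact p.Prime] {k : Type*} [Field k] [CharP k p]
  {M : Matrix (Fin 2) (Fin 3) k}

/-- Row 2 combines rows 1 and 3, and by Frobenius row 4 combines rows 3 and 5, so multilinearity
reduces all minors to γ₁₃₅. The coefficients of `invF` are therefore 1/b and a/b. -/
theorem gammaMinor_of_rowTwo_eq {a b : k}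
    (h : ∀ s, rowTwo p M s = a * rowOne p M s + b * rowOne p M s ^ p) :
    gammaMinor p M 1 2 4 = b ^ (p + 1) * gammaMinor p M 1 3 5 ∧
    gammaMinor p M 1 3 4 = b ^ p * gammaMinor p M 1 3 5 ∧
    gammaMinor p M 2 3 4 = a * b ^ p * gammaMinor p M 1 3 5 := by
  have h1 : ∀ j, gammaRow p M 1 j = M 0 j := fun j => by simp [gammaRow]
  have h3 : ∀ j, gammaRow p M 3 j = M 0 j ^ p := fun j => by simp [gammaRow]
  have h5 : ∀ j, gammaRow p M 5 j = M 0 j ^ p ^ 2 := fun j => by simp [gammaRow]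
  have h2 : ∀ j, gammaRow p M 2 j = a * M 0 j + b * M 0 j ^ p := fun j => by
    have := h (Pi.single j 1)
    rw [rowOne_single, rowTwo_single] at this
    simpa [gammaRow] using this
  have h4 : ∀ j, gammaRow p M 4 j = a ^ p * M 0 j ^ p + b ^ p * M 0 j ^ p ^ 2 := fun j => by
    have h4' : gammaRow p M 4 j = gammaRow p M 2 j ^ p := by simp [gammaRow]
    rw [h4', h2, add_pow_char, mul_pow, mul_pow, ← pow_mul (M 0 j) p p, ← sq]
  refine ⟨?_, ?_, ?_⟩ <;>
  simp only [gammaMinor, Matrix.det_fin_three, Matrix.of_apply, Matrix.cons_val_zero,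
    Matrix.cons_val_one, Matrix.cons_val, h1, h2, h3, h4, h5] <;> ring

end GammaMinors

/-! ### The case γ₁₂₄ ≠ 0, γ₁₃₅ ≠ 0. -/

section GenericCase

variable {p : ℕ} {k : Type*} [Field k]

theorem polyF_eq_add_mul (hp : 2 ≤ p) (c e : k) : polyF p c e =
    X 1 ^ p + C c * X 1 ^ 2 * X 2 ^ (p - 2) + C e * X 1 * X 2 ^ (p - 1)
      + C (-c) * X 2 ^ (p - 1) * X 0 := by
  have : p - 1 = p - 2 + 1 := by omega
  rw [polyF, delta, this, pow_succ, C_neg]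
  ring

theorem polyF_isHomogeneous (hp : 2 ≤ p) (c e : k) : (polyF p c e).IsHomogeneous p := by
  obtain ⟨m, rfl⟩ : ∃ m, p = m + 2 := ⟨p - 2, by omega⟩
  rw [polyF, delta]
  refine ((isHomogeneous_X_pow _ _).add ?_).add ?_
  · have h1 : (X 1 ^ 2 - X 2 * X 0 : MvPolynomial (Fin 3) k).IsHomogeneous 2 :=
      (isHomogeneous_X_pow _ _).sub ((isHomogeneous_X _ _).mul (isHomogeneous_X _ _))
    have := (h1.C_mul c).mul (isHomogeneous_X_pow (R := k) (2 : Fin 3) (m + 2 - 2))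
    rwa [show 2 + (m + 2 - 2) = m + 2 by omega] at this
  · have := ((isHomogeneous_X k (1 : Fin 3)).C_mul e).mul
      (isHomogeneous_X_pow (R := k) (2 : Fin 3) (m + 2 - 1))
    rwa [show 1 + (m + 2 - 1) = m + 2 by omega] at this

theorem substVar_two_polyF (hp : 3 ≤ p) (c e : k) : substVar 2 0 (polyF p c e) = X 1 ^ p := by
  have h1 : substVar 2 0 (X 1 : MvPolynomial (Fin 3) k) = X 1 := substVar_X_of_ne (by decide) _
  rw [polyF]
  simp only [map_add, map_mul, map_pow, substVar_X_self, h1, zero_pow (show p - 2 ≠ 0 by omega),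
    zero_pow (show p - 1 ≠ 0 by omega), mul_zero, add_zero]

/-- This bounds the z-degree of f^i h^l, where f contributes 1 and h contributes p². From p i < b (p
- l) and b ≤ p³ one gets p (i + p² l) < p³ (p - l) + p³ l = p⁴. -/
theorem add_mul_lt_pow_three {b i l : ℕ} (hp : 0 < p) (hb : b ≤ p ^ 3) (hl : l < p)
    (h : p * i + b * l < p * b) : i + p ^ 2 * l < p ^ 3 := by
  obtain ⟨m, rfl⟩ := Nat.exists_eq_add_of_lt hl
  set p := l + m + 1 with hpd
  have h1 : p * i < b * (m + 1) := by
    have : p * b = b * l + b * (m + 1) := by rw [hpd]; ring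
    omega
  have h2 : b * (m + 1) ≤ p ^ 3 * (m + 1) := Nat.mul_le_mul_right _ hb
  have h3 : p * (i + p ^ 2 * l) < p * p ^ 3 := by
    have e1 : p * (i + p ^ 2 * l) = p * i + p ^ 3 * l := by ring
    have e2 : p * p ^ 3 = p ^ 3 * l + p ^ 3 * (m + 1) := by
      calc p * p ^ 3 = (l + m + 1) * p ^ 3 := by rw [← hpd]
        _ = _ := by ring
    omega
  exact lt_of_mul_lt_mul_left h3 (Nat.zero_le p)

variable [Fact p.Prime] [CharP k p] {M : Matrix (Fin 2) (Fin 3) k}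

/-- The three terms change by c₁^p x^p, -b⁻¹ c₂ x^p and (a/b) c₁ x^p, and these add up to zero. -/
theorem polyF_mem {a b : k} (hb : b ≠ 0)
    (hs : ∀ s, rowTwo p M s = a * rowOne p M s + b * rowOne p M s ^ p) :
    polyF p b⁻¹ (a / b) ∈ invariantRing p M := by
  have hpp := (Fact.out : p.Prime)
  obtain ⟨m, hm⟩ : ∃ m, p = m + 2 := ⟨p - 2, by have := hpp.two_le; omega⟩
  have hx : (X 2 : MvPolynomial (Fin 3) k) ^ p = X 2 ^ (p - 2) * X 2 ^ 2 := by
    rw [← pow_add]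
    congr 1
    omega
  have hx' : (X 2 : MvPolynomial (Fin 3) k) ^ (p - 1) = X 2 ^ (p - 2) * X 2 := by
    rw [← pow_succ]
    congr 1
    omega
  rw [mem_invariantRing]
  intro s
  have hc : (C (rowOne p M s) : MvPolynomial (Fin 3) k) ^ p - C b⁻¹ * C (rowTwo p M s)
      + C (a / b) * C (rowOne p M s) = 0 := by
    rw [← C_pow, ← C_mul, ← C_mul, ← C_sub, ← C_add, hs,
      show rowOne p M s ^ p - b⁻¹ * (a * rowOne p M s + b * rowOne p M s ^ p)
        + a / b * rowOne p M s = 0 by field_simp; ring, C_0]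
  rw [polyF]
  simp only [map_add, map_mul, map_pow, polyAct_C, polyAct_sigma_delta, polyAct_sigma_X_one,
    polyAct_sigma_X_two, colComb_eq]
  rw [add_pow_char, mul_pow, hx, hx']
  linear_combination X 2 ^ (p - 2) * X 2 ^ 2 * hc

/-- The orbit product of y is an additive polynomial in y; its lower terms y^(p^i) x^(p³-p^i) have i
≤ 2. -/
theorem exists_orbitProd_X_one_eq (hinj : Function.Injective (rowOne p M)) :
    ∃ L : MvPolynomial (Fin 3) k, L.degreeOf 0 = 0 ∧
      orbitProd p M (X 1) = X 1 ^ p ^ 3 + X 2 ^ (p ^ 3 - p ^ 2) * L := by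
  have hpp := (Fact.out : p.Prime)
  obtain ⟨u, hu⟩ := exists_prod_add_eq (k := k) (n := 3) hinj
  refine ⟨∑ i, C (u i) * X 2 ^ (p ^ 2 - p ^ (i : ℕ)) * X 1 ^ p ^ (i : ℕ), ?_, ?_⟩
  · apply degreeOf_eq_zero_of_substVar
    simp [substVar]
  · rw [orbitProd_X_one hinj, hu _ _ (X_ne_zero _), Finset.mul_sum]
    congr 1
    refine Finset.sum_congr rfl fun i _ => ?_
    have h1 : p ^ (i : ℕ) ≤ p ^ 2 := Nat.pow_le_pow_right hpp.pos (by omega)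
    have h2 : p ^ 2 ≤ p ^ 3 := Nat.pow_le_pow_right hpp.pos (by omega)
    rw [show p ^ 3 - p ^ (i : ℕ) = (p ^ 3 - p ^ 2) + (p ^ 2 - p ^ (i : ℕ)) by omega, pow_add]
    ring

set_option maxHeartbeats 1000000 in
/-- The generators in the case `c₂ = a c₁ + b c₁^p` with `b ≠ 0` and `c₁` injective. -/
theorem exists_leadShape_of_rowTwo_eq (hp : p ≠ 2) (hinj : Function.Injective (rowOne p M))
    {a b c e : k} (hb : b ≠ 0) (hc : c = b⁻¹) (he : e = a / b)
    (hs : ∀ s, rowTwo p M s = a * rowOne p M s + b * rowOne p M s ^ p)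
    {N : MvPolynomial (Fin 3) k} (hN0 : N ≠ 0)
    (hNdeg : grevlex.degree N = Finsupp.single 0 (p ^ 3)) :
    ∃ h, C (-4 * c ^ (p ^ 2 + p + 1)) * X 2 ^ (p ^ 3 - p ^ 2 - p - 2) * h =
      orbitProd p M (X 1) - polyF p c e ^ p ^ 2
        + C (c ^ p ^ 2) * polyF p c e ^ (2 * p) * X 2 ^ (p ^ 3 - 2 * p ^ 2)
        - C (2 * c ^ (p ^ 2 + p)) * polyF p c e ^ (p + 2) * X 2 ^ (p ^ 3 - p ^ 2 - 2 * p) ∧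
    polyF p c e ∈ invariantRing p M ∧ h ∈ invariantRing p M ∧
    h.IsHomogeneous (p ^ 2 + p + 2) ∧
    LeadShape ![X 2, polyF p c e, h, N] p (p ^ 2 + p + 2) (p ^ 3) ∧
    grevlex.leadingCoeff (polyF p c e) = 1 ∧ grevlex.leadingCoeff h = 1 ∧
    ∀ F ∈ invariantRing p M, F ≠ 0 → ∃ I : Fin 4 →₀ ℕ, grevlex.degree F =
      grevlex.degree (aeval ![X 2, polyF p c e, h, N] (monomial I (1 : k))) := by
  have hpp := (Fact.out : p.Prime)
  have hp3 : 3 ≤ p := by have := hpp.two_le; omega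
  obtain ⟨m, hm⟩ : ∃ m, p = m + 2 := ⟨p - 2, by omega⟩
  obtain ⟨e1, e2, e3, e4, e5⟩ := exponent_identities hm
  have hc0 : c ≠ 0 := hc ▸ inv_ne_zero hb
  obtain ⟨L, hL, hN⟩ := exists_orbitProd_X_one_eq hinj
  set κ : k := -4 * c ^ (p ^ 2 + p + 1) with hκ
  have hκ0 : κ ≠ 0 := by
    have h2 := two_ne_zero_of_charP (k := k) hp
    have h4 : (-4 : k) ≠ 0 := by
      rw [show (-4 : k) = -(2 * 2) by norm_num]
      exact neg_ne_zero.2 (mul_ne_zero h2 h2)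
    exact mul_ne_zero h4 (pow_ne_zero _ hc0)
  have hfR : polyF p c e ∈ invariantRing p M := by
    rw [hc, he]
    exact polyF_mem hb hs
  have hf := polyF_isHomogeneous (by omega : 2 ≤ p) c e
  have hfd := degreeOf_polyF (by omega : 2 ≤ p) c e
  have hKe := X_pow_mul_polyK c e hN
  have hK2 := substVar_two_polyK hp3 c e L
  have hRd := degreeOf_polyR hp3 c e hL
  have hfB := polyF_eq_add_mul (by omega : 2 ≤ p) c e
  have hf2 := substVar_two_polyF hp3 c e
  have hK : polyK p c e L = C (c ^ p ^ 2) * X 2 ^ (p - 2) * X 2 ^ 4 * X 0 ^ p ^ 2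
    + polyR p c e L := rfl
  generalize polyK p c e L = K at *
  generalize polyR p c e L = R at *
  generalize polyF p c e = f at *
  have hKR : K ∈ invariantRing p M := by
    refine mem_invariantRing_of_X_pow_mul (n := p ^ 3 - p ^ 2 - p - 2) ?_
    rw [← hKe]
    have hx : ∀ n, X 2 ^ n ∈ invariantRing p M := fun n => pow_mem X_two_mem_invariantRing n
    exact sub_mem (add_mem (sub_mem (orbitProd_mem _) (pow_mem hfR _))
      (mul_mem (mul_mem (C_mem_invariantRing _) (pow_mem hfR _)) (hx _)))
      (mul_mem (mul_mem (C_mem_invariantRing _) (pow_mem hfR _)) (hx _))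
  have hKh : K.IsHomogeneous (p ^ 2 + p + 2) := by
    refine isHomogeneous_of_X_pow_mul (i := 2) (m := p ^ 3 - p ^ 2 - p - 2) ?_
    have d0 : p ^ 2 + p + 2 + (p ^ 3 - p ^ 2 - p - 2) = p ^ 3 := by
      rw [e4, hm]
      ring
    have d1 : p * p ^ 2 = p ^ 3 := by ring
    have d2 : p * (2 * p) + (p ^ 3 - 2 * p ^ 2) = p ^ 3 := by
      rw [e2, hm]
      ring
    have d3 : p * (p + 2) + (p ^ 3 - p ^ 2 - 2 * p) = p ^ 3 := by
      rw [e3, hm]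
      ring
    have t1 := hf.pow (p ^ 2)
    have t2 := ((hf.pow (2 * p)).C_mul (c ^ p ^ 2)).mul
      (isHomogeneous_X_pow (R := k) (2 : Fin 3) (p ^ 3 - 2 * p ^ 2))
    have t3 := ((hf.pow (p + 2)).C_mul (2 * c ^ (p ^ 2 + p))).mul
      (isHomogeneous_X_pow (R := k) (2 : Fin 3) (p ^ 3 - p ^ 2 - 2 * p))
    rw [d1] at t1
    rw [d2] at t2
    rw [d3] at t3
    rw [← hKe, d0]
    exact (((orbitProd_X_one_isHomogeneous hinj).sub t1).add t2).sub t3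
  set h := C κ⁻¹ * K with hh
  have hKh' : K = C κ * h := by
    rw [hh, ← mul_assoc, ← C_mul, mul_inv_cancel₀ hκ0, C_1, one_mul]
  set lam := κ⁻¹ * c ^ p ^ 2 with hlam
  set R' := C κ⁻¹ * R with hR'
  have hR'd : R'.degreeOf 0 ≤ 2 * p := (degreeOf_C_mul_le _ _ _).trans hRd
  have hhe : h = C lam * X 2 ^ (p + 2) * X 0 ^ p ^ 2 + R' := by
    rw [hh, hK, hR', hlam, C_mul, show p + 2 = p - 2 + 4 by omega, pow_add]
    ring
  have hp2 : 3 * p ≤ p ^ 2 := by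
    rw [sq]
    exact Nat.mul_le_mul_right p hp3
  have hp3' : 3 * p ^ 2 ≤ p ^ 3 := by
    rw [pow_succ' p 2]
    exact Nat.mul_le_mul_right _ hp3
  have hhd : h.degreeOf 0 ≤ p ^ 2 := by
    rw [hhe]
    refine degreeOf_add_le_of_le ?_ (hR'd.trans (by omega))
    refine degreeOf_mul_le_of_eq_zero (degreeOf_mul_eq_zero (degreeOf_C _ _)
      (degreeOf_X_pow_eq_zero (by decide) _)) ?_
    refine degreeOf_pow_le_of_le (a := 1) ?_ (by omega)
    rw [degreeOf_X, if_pos rfl]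
  have hbp : p * (p ^ 2 + p + 2) - p ^ 3 = (p + 2) * p :=
    Nat.sub_eq_of_eq_add (by ring)
  have hbp' : p * (p ^ 2 + p + 2) = p ^ 3 + (p + 2) * p := by ring
  obtain ⟨hshape, hlf, hlh, hlead⟩ := leadShape_of_rowOne_injective hp hinj (a := p)
    (b := p ^ 2 + p + 2) (f := f) (h := h) (c := -lam ^ p) (c' := -c) (r := p - 1)
    (B := X 1 ^ p + C c * X 1 ^ 2 * X 2 ^ (p - 2) + C e * X 1 * X 2 ^ (p - 1)) (N := N) hpp.pos
    (by
      rw [show p ^ 2 + p + 2 = 2 + p * (p + 1) by ring, Nat.coprime_add_mul_left_right]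
      exact (Nat.coprime_primes hpp Nat.prime_two).2 hp)
    -- Here (a - 1)(b - 1) = (p - 1)(p² + p + 1) = p³ - 1.
    (by
      have h1 : (p - 1) * (p ^ 2 + p + 2 - 1) ≤ p ^ 3 := by
        obtain ⟨q, hq⟩ : ∃ q, p = q + 1 := ⟨p - 1, by omega⟩
        rw [show p ^ 2 + p + 2 - 1 = p ^ 2 + p + 1 by omega, hq, Nat.add_sub_cancel]
        have : (q + 1) ^ 3 = q * ((q + 1) ^ 2 + (q + 1) + 1) + 1 := by ring
        omega
      exact h1)
    (by
      rw [hbp']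
      have : 0 < (p + 2) * p := by positivity
      omega)
    hfR (mul_mem (C_mem_invariantRing _) hKR) hf (hKh.C_mul _) hf2
    (by
      rw [hh, map_mul, substVar_C, hK2, ← mul_assoc, ← C_mul, inv_mul_cancel₀ hκ0, C_1, one_mul])
    (neg_ne_zero.2 (pow_ne_zero _ (mul_ne_zero (inv_ne_zero hκ0) (pow_ne_zero _ hc0))))
    (by
      -- The p-th power is additive, so h^p = lam^p x^(p(p+2)) z^(p³) + R'^p. This gives the
      -- constant -lam^p; the other parts have z-degree at most p² + p + 2 and 2p².
      have : f ^ (p ^ 2 + p + 2) - h ^ p - C (-lam ^ p) *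
          X 2 ^ (p * (p ^ 2 + p + 2) - p ^ 3) * X 0 ^ p ^ 3 = f ^ (p ^ 2 + p + 2) - R' ^ p := by
        rw [hbp, hhe, add_pow_char, mul_pow, mul_pow, ← pow_mul, ← pow_mul, ← pow_succ, C_neg,
          C_pow]
        ring
      rw [this]
      refine lt_of_le_of_lt (degreeOf_sub_le _ _ _) (max_lt ?_ ?_)
      · exact lt_of_le_of_lt (degreeOf_pow_le_of_le hfd le_rfl) (by omega)
      · refine lt_of_le_of_lt (degreeOf_pow_le_of_le hR'd le_rfl) ?_
        have : p * (2 * p) = 2 * p ^ 2 := by ring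
        have : 0 < p ^ 2 := pow_pos hpp.pos 2
        omega)
    (by
      intro i l hl hil
      have h1 : (f ^ i).degreeOf 0 ≤ i := degreeOf_pow_le_of_le hfd (by omega)
      have h2 : (h ^ l).degreeOf 0 ≤ p ^ 2 * l := degreeOf_pow_le_of_le hhd (by rw [mul_comm])
      exact lt_of_le_of_lt (degreeOf_mul_le_of_le h1 h2 le_rfl)
        (add_mul_lt_pow_three hpp.pos (by omega) hl hil))
    (neg_ne_zero.2 hc0)
    (by simp [substVar]) hfB
    (by
      have hfm : f ∈ Algebra.adjoin k {f, h, X 2} := Algebra.subset_adjoin (Or.inl rfl)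
      have hhm : h ∈ Algebra.adjoin k {f, h, X 2} := Algebra.subset_adjoin (Or.inr (Or.inl rfl))
      have hxm : ∀ n, (X 2 : MvPolynomial (Fin 3) k) ^ n ∈ Algebra.adjoin k {f, h, X 2} := by
        have : (X 2 : MvPolynomial (Fin 3) k) ∈ Algebra.adjoin k {f, h, X 2} :=
          Algebra.subset_adjoin (Or.inr (Or.inr rfl))
        exact fun n => pow_mem this n
      have hCm : ∀ t : k, C t ∈ Algebra.adjoin k {f, h, X 2} := fun t =>
        Subalgebra.algebraMap_mem _ t
      -- The definition of h̃, solved for the orbit product of y.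
      have hNe : orbitProd p M (X 1) = X 2 ^ (p ^ 3 - p ^ 2 - p - 2) * (C κ * h) + f ^ p ^ 2
          - C (c ^ p ^ 2) * f ^ (2 * p) * X 2 ^ (p ^ 3 - 2 * p ^ 2)
          + C (2 * c ^ (p ^ 2 + p)) * f ^ (p + 2) * X 2 ^ (p ^ 3 - p ^ 2 - 2 * p) := by
        rw [← hKh']
        linear_combination hKe
      rw [hNe]
      exact add_mem (sub_mem (add_mem (mul_mem (hxm _) (mul_mem (hCm _) hhm)) (pow_mem hfm _))
        (mul_mem (mul_mem (hCm _) (pow_mem hfm _)) (hxm _)))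
        (mul_mem (mul_mem (hCm _) (pow_mem hfm _)) (hxm _)))
    hN0 hNdeg
  refine ⟨h, ?_, hfR, mul_mem (C_mem_invariantRing _) hKR, hKh.C_mul _, hshape, hlf, hlh, hlead⟩
  rw [hKe, hKh']
  ring

theorem newZ_one_zero : newZ (1 : k) 0 = X 0 := by simp [newZ]

/-- The case `γ₁₂₄ ≠ 0`, `γ₁₃₅ ≠ 0`. -/
theorem sagbi_of_gammaMinor_ne_zero (hp : p ≠ 2) (h123 : gammaMinor p M 1 2 3 = 0)
    (h124 : gammaMinor p M 1 2 4 ≠ 0) (h135 : gammaMinor p M 1 3 5 ≠ 0) :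
    ∃ h, IsInvH p M h ∧
      IsSagbiBasis (Set.range ![X 2, invF p M, h, orbitProd p M (X 0)]) (invariantRing p M) ∧
      SingleRelationBySubducting ![X 2, invF p M, h, orbitProd p M (X 0)] (invariantRing p M)
        (Finsupp.single (1 : Fin 4) (p ^ 2 + p + 2)) (Finsupp.single (2 : Fin 4) p) ∧
      IsHypersurface (invariantRing p M) := by
  have hpp := (Fact.out : p.Prime)
  have hinj := rowOne_injective h135
  have hF := rowOne_injective_colComb hinj
  obtain ⟨a, b, hs⟩ := exists_rowTwo_eq h123 h135
  obtain ⟨g1, g2, g3⟩ := gammaMinor_of_rowTwo_eq hs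
  have hb : b ≠ 0 := by
    rintro rfl
    exact h124 (by rw [g1, zero_pow (by omega), zero_mul])
  have hc : gammaMinor p M 1 3 4 / gammaMinor p M 1 2 4 = b⁻¹ := by
    rw [g1, g2, pow_succ]
    field_simp
  have he : gammaMinor p M 2 3 4 / gammaMinor p M 1 2 4 = a / b := by
    rw [g1, g3, pow_succ]
    field_simp
  have hdeg := orbitProd_newZ_degree hp hF (one_ne_zero (α := k)) 0
  have hhom := orbitProd_newZ_isHomogeneous hp hF (one_ne_zero (α := k)) 0
  rw [newZ_one_zero] at hdeg hhom
  obtain ⟨h, hhe, hfR, hhR, hhh, hshape, hlf, hlh, hlead⟩ :=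
    exists_leadShape_of_rowTwo_eq hp hinj hb hc he hs hdeg.1 hdeg.2
  have hg : ∀ i, ![X 2, invF p M, h, orbitProd p M (X 0)] i ∈ invariantRing p M := by
    intro i
    fin_cases i
    · exact X_two_mem_invariantRing
    · exact hfR
    · exact hhR
    · exact orbitProd_mem _
  have hrel := hshape.singleRelation hg hlead
    (show grevlex.leadingCoeff (polyF p _ _) ^ _ = grevlex.leadingCoeff h ^ _ by
      rw [hlf, hlh, one_pow, one_pow])
  have hp2 : 2 ≤ p := hpp.two_le
  have hpp3 : p * (p ^ 2 + p + 2) = p ^ 3 + p ^ 2 + 2 * p := by ring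
  refine ⟨h, hhe, isSagbiBasis_range hshape.ne_zero hg hlead, hrel,
    hshape.isHypersurface (R := invariantRing p M) hrel (w := ![1, p, p ^ 2 + p + 2, p ^ 3])
      (fun i => ?_) (fun i => ?_) rfl rfl (fun i => ?_) hp2 (by omega)⟩
  · fin_cases i
    · exact isHomogeneous_X _ _
    · exact polyF_isHomogeneous hp2 _ _
    · exact hhh
    · exact hhom
  · fin_cases i
    · exact one_pos
    · exact hpp.pos
    · exact Nat.succ_pos _
    · exact pow_pos hpp.pos 3
  · have h3 : 2 * p ^ 2 ≤ p ^ 3 := by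
      rw [pow_succ' p 2]
      exact Nat.mul_le_mul_right _ hp2
    have h4 : 2 * p ≤ p ^ 2 := by
      rw [sq]
      exact Nat.mul_le_mul_right _ hp2
    rw [hpp3]
    fin_cases i
    · show 1 ≠ _
      omega
    · show p ≠ _
      omega
    · show p ^ 2 + p + 2 ≠ _
      omega
    · show p ^ 3 ≠ _
      omega

end GenericCase

/-! ### The prime field inside k. -/

section PrimeField

variable {p : ℕ} {k : Type*} [Field k] [CharP k p]

/-- The embedding of the prime field, as an additive map on `(ℤ/p)¹`. -/
noncomputable def primeHom (p : ℕ) (k : Type*) [Field k] [CharP k p] : (Fin 1 → ZMod p) →+ k where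
  toFun a := ZMod.castHom (dvd_refl p) k (a 0)
  map_zero' := map_zero _
  map_add' _ _ := map_add _ _ _

theorem primeHom_apply (a : Fin 1 → ZMod p) :
    primeHom p k a = ZMod.castHom (dvd_refl p) k (a 0) := rfl

variable [Fact p.Prime]

theorem primeHom_injective : Function.Injective (primeHom p k) := by
  intro a b h
  ext i
  rw [Subsingleton.elim i 0]
  exact (ZMod.castHom (dvd_refl p) k).injective h

/-- The product has the form Y^p + u t^(p-1) Y, and the root Y = -t gives u = -1. -/
theorem prod_primeHom (Y : MvPolynomial (Fin 3) k) {t : MvPolynomial (Fin 3) k} (ht : t ≠ 0) :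
    ∏ a, (Y + C (primeHom p k a) * t) = Y ^ p - t ^ (p - 1) * Y := by
  have hpp := (Fact.out : p.Prime)
  obtain ⟨u, hu⟩ := exists_prod_add_eq (k := k) (n := 1) (primeHom_injective (p := p))
  have h0 : ∏ a, (0 + C (primeHom p k a) * t) = 0 :=
    Finset.prod_eq_zero (Finset.mem_univ 0) (by simp)
  have h1 : ∏ a, (-t + C (primeHom p k a) * t) = 0 :=
    Finset.prod_eq_zero (Finset.mem_univ 1) (by simp [primeHom_apply])
  have hu1 := hu (-t) t ht
  have hneg : (-t) ^ p = -t ^ p := by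
    rw [← zero_sub, sub_pow_char, zero_pow hpp.ne_zero, zero_sub]
  rw [h1] at hu1
  simp only [Finset.univ_unique, Fin.default_eq_zero, Finset.sum_singleton, Fin.val_eq_zero,
    pow_zero, pow_one] at hu hu1
  rw [hneg] at hu1
  have ht1 : t ^ (p - 1) * t = t ^ p := by
    rw [← pow_succ, Nat.sub_add_cancel hpp.one_le]
  have h2 : t ^ p * (1 + C (u 0)) = 0 := by
    linear_combination hu1 - C (u 0) * ht1
  have h3 : C (u 0) = (-1 : MvPolynomial (Fin 3) k) := by
    have := (mul_eq_zero.1 h2).resolve_left (pow_ne_zero _ ht)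
    linear_combination this
  rw [hu Y t ht, h3]
  ring

/-- The elements of 𝔽_p already account for all p roots of T^p - T; a further root is added as
`none` of an `Option` type to reach a contradiction. -/
theorem exists_castHom_eq {c : k} (h : c ^ p = c) :
    ∃ n : ZMod p, c = ZMod.castHom (dvd_refl p) k n := by
  by_contra! hne
  have hpp := (Fact.out : p.Prime)
  have hroot : (Polynomial.X ^ p - Polynomial.X : Polynomial k) = 0 := by
    refine Polynomial.eq_zero_of_natDegree_lt_card_of_eval_eq_zero _
      (f := fun o : Option (ZMod p) => o.elim c (ZMod.castHom (dvd_refl p) k)) ?_ ?_ ?_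
    · rintro (_ | a) (_ | b) hab
      · rfl
      · exact absurd hab (hne b)
      · exact absurd hab.symm (hne a)
      · exact congrArg some ((ZMod.castHom (dvd_refl p) k).injective hab)
    · rintro (_ | a)
      · simp [h]
      · simp only [Option.elim_some, Polynomial.eval_sub, Polynomial.eval_pow, Polynomial.eval_X,
          ← map_pow, ZMod.pow_card, sub_self]
    · rw [Fintype.card_option, ZMod.card, FiniteField.X_pow_card_sub_X_natDegree_eq k hpp.one_lt]
      exact Nat.lt_succ_self p
  exact FiniteField.X_pow_card_sub_X_ne_zero k hpp.one_lt hroot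

end PrimeField

/-! ### Algebraic independence from lead monomials. -/

section AlgebraicIndependence

variable {k : Type*} [Field k]

/-- When the lead monomials are powers of distinct variables, different products have different lead
monomials and cannot cancel. -/
theorem aeval_injective_of_degree {g : Fin 3 → MvPolynomial (Fin 3) k} {σ : Fin 3 → Fin 3}
    {d : Fin 3 → ℕ} (hσ : Function.Injective σ) (hd : ∀ i, 0 < d i) (hg : ∀ i, g i ≠ 0)
    (h : ∀ i, grevlex.degree (g i) = Finsupp.single (σ i) (d i)) :
    Function.Injective (aeval g : MvPolynomial (Fin 3) k →ₐ[k] MvPolynomial (Fin 3) k) := by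
  rw [injective_iff_map_eq_zero]
  intro P hP
  by_contra hP0
  obtain ⟨I, -, hI, -⟩ := exists_degree_aeval_eq hg hP0 (fun I _ J _ hIJ => by
    have hval : ∀ (I : Fin 3 →₀ ℕ) i,
        grevlex.degree (aeval g (monomial I (1 : k))) (σ i) = I i * d i := by
      intro I i
      rw [degree_aeval_monomial hg I one_ne_zero, Finsupp.sum_fintype _ _ (by simp),
        Finsupp.finsetSum_apply, Finset.sum_eq_single i]
      · rw [h, Finsupp.smul_apply, Finsupp.single_eq_same, smul_eq_mul]
      · intro j _ hj
        rw [h, Finsupp.smul_apply, Finsupp.single_eq_of_ne (hσ.ne hj.symm), smul_zero]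
      · simp
    ext i
    have := DFunLike.congr_fun hIJ (σ i)
    rw [hval, hval] at this
    exact Nat.eq_of_mul_eq_mul_right (hd i) this)
  exact hI hP

end AlgebraicIndependence

/-! ### Invariants after inverting x when M has the form [1 * 0; 0 * *]. -/

section NormalizedAction

variable {p : ℕ} {k : Type*} [Field k] [CharP k p]

/-- In the basis `x, y', z'` given by `(γ, α)` the group `G` is the product of a group of order `p`,
acting through `c₁ ∈ 𝔽_p` and `c₂ = 0`, and a group acting through `c₁ = 0` and `c₂ = -φ₂`. -/
structure NormalizedAction (M : Matrix (Fin 2) (Fin 3) k) (α γ : k)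
    (φ₂ : (Fin 2 → ZMod p) →+ k) : Prop where
  ne_zero : α ≠ 0
  injective : Function.Injective φ₂
  exists_castHom : ∀ a, ∃ n : ZMod p, α * rowOne p M a = ZMod.castHom (dvd_refl p) k n
  exists_eq_neg : ∀ a, ∃ b, α * γ * rowOne p M a + α ^ 2 * rowTwo p M a = -φ₂ b
  exists_ker : ∀ b, ∃ a, rowOne p M a = 0 ∧ α ^ 2 * rowTwo p M a = -φ₂ b
  exists_one : ∃ t, α * rowOne p M t = 1 ∧ α * γ * rowOne p M t + α ^ 2 * rowTwo p M t = 0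

/-- The quadratic form `δ' = y'² - x z'`. -/
noncomputable def newDelta (α γ : k) : MvPolynomial (Fin 3) k := newY α ^ 2 - X 2 * newZ α γ

theorem polyAct_newY (α : k) (c : k × k) :
    polyAct (sigma c) (newY α) = newY α + C (α * c.1) * X 2 := (polyAct_newBasis α 0 c).2.1

theorem polyAct_newDelta (α γ : k) (c : k × k) :
    polyAct (sigma c) (newDelta α γ) =
      newDelta α γ - C (α * γ * c.1 + α ^ 2 * c.2) * X 2 ^ 2 := by
  rw [newDelta, map_sub, map_pow, map_mul, polyAct_newY, polyAct_newZ, polyAct_sigma_X_two]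
  simp only [map_add, map_mul, map_pow, map_ofNat]
  ring

variable {M : Matrix (Fin 2) (Fin 3) k} {α γ : k} {φ₂ : (Fin 2 → ZMod p) →+ k}

theorem NormalizedAction.exists_rowOne_eq (h : NormalizedAction M α γ φ₂) [NeZero p] (n : ZMod p) :
    ∃ t, α * rowOne p M t = ZMod.castHom (dvd_refl p) k n ∧
      α * γ * rowOne p M t + α ^ 2 * rowTwo p M t = 0 := by
  obtain ⟨t, h1, h2⟩ := h.exists_one
  refine ⟨n.val • t, ?_, ?_⟩
  · rw [map_nsmul, nsmul_eq_mul, mul_left_comm, h1, mul_one,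
      ← map_natCast (ZMod.castHom (dvd_refl p) k), ZMod.natCast_zmod_val]
  · rw [map_nsmul, map_nsmul, nsmul_eq_mul, nsmul_eq_mul]
    linear_combination (n.val : k) * h2

variable [Fact p.Prime]

theorem NormalizedAction.orbitProd_newY_eq_prod (h : NormalizedAction M α γ φ₂) :
    orbitProd p M (newY α) = ∏ a, (newY α + C (primeHom p k a) * X 2) := by
  refine orbitProd_eq_prod (fun a b hab => ?_) (fun a => ?_) fun b => ?_
  · exact smulHom_injective primeHom_injective (X_ne_zero (2 : Fin 3)) (add_left_cancel hab)
  · obtain ⟨n, hn⟩ := h.exists_castHom a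
    exact ⟨fun _ => n, by rw [polyAct_newY, colComb_eq, hn, primeHom_apply]⟩
  · obtain ⟨t, ht, -⟩ := h.exists_rowOne_eq (b 0)
    exact ⟨t, by rw [polyAct_newY, colComb_eq, ht, primeHom_apply]⟩

theorem NormalizedAction.orbitProd_newY (h : NormalizedAction M α γ φ₂) :
    orbitProd p M (newY α) = newY α ^ p - X 2 ^ (p - 1) * newY α := by
  rw [h.orbitProd_newY_eq_prod, prod_primeHom _ (X_ne_zero _)]

theorem NormalizedAction.orbitProd_newDelta (h : NormalizedAction M α γ φ₂) :
    orbitProd p M (newDelta α γ) = ∏ b, (newDelta α γ + C (φ₂ b) * X 2 ^ 2) := by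
  refine orbitProd_eq_prod (fun a b hab => ?_) (fun a => ?_) fun b => ?_
  · exact smulHom_injective h.injective (pow_ne_zero 2 (X_ne_zero (2 : Fin 3)))
      (add_left_cancel hab)
  · obtain ⟨b, hb⟩ := h.exists_eq_neg a
    refine ⟨b, ?_⟩
    rw [polyAct_newDelta, colComb_eq, hb, C_neg]
    ring
  · obtain ⟨a, ha, hb⟩ := h.exists_ker b
    refine ⟨a, ?_⟩
    rw [polyAct_newDelta, colComb_eq, ha, mul_zero, zero_add, hb, C_neg]
    ring

/-- After inverting `x` the invariants are generated by `N_G(y')`, `N_G(δ')` and `x`. -/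
theorem NormalizedAction.exists_pow_mul_mem_adjoin (h : NormalizedAction M α γ φ₂)
    {F : MvPolynomial (Fin 3) k} (hF : F ∈ invariantRing p M) :
    ∃ n : ℕ, X 2 ^ n * F ∈ Algebra.adjoin k
      {orbitProd p M (newDelta α γ), orbitProd p M (newY α), X 2} := by
  have hα := h.ne_zero
  set B : MvPolynomial (Fin 3) k := C (α ^ 2) * X 1 ^ 2 - C (α * γ) * X 2 * X 1 with hBdef
  have hB : substVar 0 0 B = B := by simp [hBdef, substVar]
  have hc : -α ^ 2 ≠ 0 := neg_ne_zero.2 (pow_ne_zero 2 hα)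
  have hδ : B + C (-α ^ 2) * X 2 ^ 1 * X 0 = newDelta α γ := by
    rw [hBdef, newDelta, newY, newZ, C_neg]
    simp only [map_mul, map_pow]
    ring
  obtain ⟨n, P, hP⟩ := exists_pow_mul_mem_range (r := 1) hc hB F
  have hinj := aeval_injective_of_linear (r := 1) hc hB
  rw [hδ] at hinj hP
  set Ψ : MvPolynomial (Fin 3) k →ₐ[k] MvPolynomial (Fin 3) k :=
    aeval ![newDelta α γ, X 1, X 2] with hΨ
  have hP' : Ψ P = X 2 ^ n * F := hP
  have hΨ0 : Ψ (X 0) = newDelta α γ := by simp [hΨ]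
  have hΨ1 : Ψ (X 1) = X 1 := by simp [hΨ]
  have hΨ2 : Ψ (X 2) = X 2 := by simp [hΨ]
  refine ⟨n, ?_⟩
  -- `P` is F (times a power of x) written in the coordinates δ', y, x. Any substitution that
  -- describes the action of a group element in these coordinates fixes it.
  have hinv : ∀ (a) (τ : MvPolynomial (Fin 3) k →ₐ[k] MvPolynomial (Fin 3) k),
      Ψ.comp τ = (polyAct (sigma (colComb p M a))).comp Ψ → τ P = P := by
    intro a τ hτ
    apply hinj
    have h1 := DFunLike.congr_fun hτ P
    rwa [AlgHom.comp_apply, AlgHom.comp_apply, hP', map_mul, map_pow, polyAct_sigma_X_two,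
      mem_invariantRing.1 hF a, ← hP'] at h1
  -- The factor α⁻¹ appears because y = α⁻¹ y' and y' is translated by 𝔽_p x.
  set φ₁ : (Fin 1 → ZMod p) →+ k := (AddMonoidHom.mulLeft α⁻¹).comp (primeHom p k) with hφ₁
  have hφ₁i : Function.Injective φ₁ := fun a b hab =>
    primeHom_injective (mul_left_cancel₀ (inv_ne_zero hα) hab)
  have hinv1 : ∀ a, substVar 1 (X 1 + C (φ₁ a) * X 2) P = P := by
    intro a
    obtain ⟨t, ht, ht2⟩ := h.exists_rowOne_eq (a 0)
    have htr : rowOne p M t = φ₁ a := by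
      rw [hφ₁, AddMonoidHom.comp_apply, primeHom_apply, ← ht, AddMonoidHom.coe_mulLeft,
        inv_mul_cancel_left₀ hα]
    refine hinv t _ (MvPolynomial.algHom_ext fun i => ?_)
    fin_cases i
    · simp only [Fin.zero_eta, AlgHom.comp_apply]
      rw [substVar_X_of_ne (by decide), hΨ0, polyAct_newDelta, colComb_eq, ht2, C_0, zero_mul,
        sub_zero]
    · simp only [Fin.mk_one, AlgHom.comp_apply]
      rw [substVar_X_self, map_add, map_mul, hΨ1, hΨ2, polyAct_sigma_X_one, colComb_eq, htr,
        ← algebraMap_eq, AlgHom.commutes]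
    · simp only [Fin.reduceFinMk, AlgHom.comp_apply]
      rw [substVar_X_of_ne (by decide), hΨ2, polyAct_sigma_X_two]
  -- Elements in the kernel of c₁ fix y and translate δ' by φ₂(b) x².
  have hinv0 : ∀ b, substVar 0 (X 0 + C (φ₂ b) * X 2 ^ 2) P = P := by
    intro b
    obtain ⟨a, ha, hb⟩ := h.exists_ker b
    refine hinv a _ (MvPolynomial.algHom_ext fun i => ?_)
    fin_cases i
    · simp only [Fin.zero_eta, AlgHom.comp_apply]
      rw [substVar_X_self, map_add, map_mul, map_pow, hΨ0, hΨ2, polyAct_newDelta, colComb_eq, ha,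
        mul_zero, zero_add, hb, C_neg, ← algebraMap_eq, AlgHom.commutes]
      ring
    · simp only [Fin.mk_one, AlgHom.comp_apply]
      rw [substVar_X_of_ne (by decide), hΨ1, polyAct_sigma_X_one, colComb_eq, ha, C_0, zero_mul,
        add_zero]
    · simp only [Fin.reduceFinMk, AlgHom.comp_apply]
      rw [substVar_X_of_ne (by decide), hΨ2, polyAct_sigma_X_two]
  set N₁ : MvPolynomial (Fin 3) k := ∏ a, (X 1 + C (φ₁ a) * X 2) with hN₁
  have hN₁hom : N₁.IsHomogeneous p := by
    have := IsHomogeneous.prod (Finset.univ : Finset (Fin 1 → ZMod p))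
      (fun a => (X 1 + C (φ₁ a) * X 2 : MvPolynomial (Fin 3) k)) (fun _ => 1) fun a _ =>
        (isHomogeneous_X _ _).add ((isHomogeneous_X _ _).C_mul _)
    simpa [ZMod.card] using this
  have hN₁deg := degree_eq_single_one (c := (1 : k)) hN₁hom one_ne_zero (by
    rw [hN₁, map_prod]
    simp [substVar, ZMod.card])
  have hN₁0 : N₁ ≠ 0 := Finset.prod_ne_zero_iff.2 fun a _ h0 => by
    have := congrArg (aeval ![(0 : k), 1, 0]) h0
    simp at this
  -- Invariance under the translations of y puts P into the image of Θ. As Θ is injective and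
  -- commutes with the translations of the first variable, the preimage P₁ is invariant under these.
  set Θ : MvPolynomial (Fin 3) k →ₐ[k] MvPolynomial (Fin 3) k := aeval ![X 0, N₁, X 2] with hΘ
  have hΘ0 : Θ (X 0) = X 0 := by simp [hΘ]
  have hΘ1 : Θ (X 1) = N₁ := by simp [hΘ]
  have hΘ2 : Θ (X 2) = X 2 := by simp [hΘ]
  have hΘinj : Function.Injective Θ := by
    refine aeval_injective_of_degree (σ := id) (d := ![1, p, 1]) Function.injective_id ?_ ?_ ?_ <;>
    intro i <;> fin_cases i
    · exact one_pos
    · exact (Fact.out : p.Prime).pos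
    · exact one_pos
    · exact X_ne_zero _
    · exact hN₁0
    · exact X_ne_zero _
    · exact grevlex.degree_X
    · exact hN₁deg.1
    · exact grevlex.degree_X
  obtain ⟨P₁, hP₁⟩ : P ∈ Θ.range := by
    have hmem := mem_adjoin_of_translation hφ₁i (i := 1) (t := X 2)
      (substVar_X_of_ne (by decide) _) (X_ne_zero _) hinv1
    refine Algebra.adjoin_le ?_ hmem
    rintro _ (rfl | ⟨j, hj, rfl⟩)
    · exact ⟨X 1, hΘ1⟩
    · fin_cases j
      · exact ⟨X 0, hΘ0⟩
      · exact absurd rfl hj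
      · exact ⟨X 2, hΘ2⟩
  have hP₁' : Θ P₁ = P := hP₁
  have hinvP₁ : ∀ b, substVar 0 (X 0 + C (φ₂ b) * X 2 ^ 2) P₁ = P₁ := by
    intro b
    apply hΘinj
    have hcomp : Θ.comp (substVar 0 (X 0 + C (φ₂ b) * X 2 ^ 2)) =
        (substVar 0 (X 0 + C (φ₂ b) * X 2 ^ 2)).comp Θ := by
      refine MvPolynomial.algHom_ext fun i => ?_
      fin_cases i
      · simp only [Fin.zero_eta, AlgHom.comp_apply]
        rw [substVar_X_self, map_add, map_mul, map_pow, hΘ0, hΘ2, substVar_X_self,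
          ← algebraMap_eq, AlgHom.commutes]
      · simp only [Fin.mk_one, AlgHom.comp_apply]
        rw [substVar_X_of_ne (by decide), hΘ1, hN₁, map_prod]
        refine Finset.prod_congr rfl fun a _ => ?_
        rw [map_add, map_mul, substVar_X_of_ne (by decide), substVar_X_of_ne (by decide),
          substVar_C]
      · simp only [Fin.reduceFinMk, AlgHom.comp_apply]
        rw [substVar_X_of_ne (by decide), hΘ2, substVar_X_of_ne (by decide)]
    have h1 := DFunLike.congr_fun hcomp P₁
    rwa [AlgHom.comp_apply, AlgHom.comp_apply, hP₁', hinv0, ← hP₁'] at h1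
  have hmem := mem_adjoin_of_translation h.injective (i := 0) (t := X 2 ^ 2)
    (by rw [map_pow, substVar_X_of_ne (by decide)]) (pow_ne_zero 2 (X_ne_zero _)) hinvP₁
  have h2 : Ψ (Θ P₁) ∈ ((Algebra.adjoin k (insert (∏ b, (X 0 + C (φ₂ b) * X 2 ^ 2))
      (X '' {0}ᶜ : Set (MvPolynomial (Fin 3) k)))).map Θ).map Ψ := ⟨Θ P₁, ⟨P₁, hmem, rfl⟩, rfl⟩
  rw [AlgHom.map_adjoin, AlgHom.map_adjoin, hP₁', hP'] at h2
  refine Algebra.adjoin_le ?_ h2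
  have hy : orbitProd p M (newY α) ∈ Algebra.adjoin k
      {orbitProd p M (newDelta α γ), orbitProd p M (newY α), X 2} :=
    Algebra.subset_adjoin (Or.inr (Or.inl rfl))
  rintro _ ⟨_, ⟨_, rfl | ⟨j, hj, rfl⟩, rfl⟩, rfl⟩
  · refine Algebra.subset_adjoin (Or.inl ?_)
    rw [h.orbitProd_newDelta, map_prod, map_prod]
    refine Finset.prod_congr rfl fun b _ => ?_
    rw [map_add, map_mul, map_pow, hΘ0, hΘ2, map_add, map_mul, map_pow, hΨ0, hΨ2,
      ← algebraMap_eq, AlgHom.commutes, AlgHom.commutes]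
  · fin_cases j
    · exact absurd rfl hj
    · have : Ψ (Θ (X 1)) = C (α⁻¹ ^ p) * orbitProd p M (newY α) := by
        rw [hΘ1, h.orbitProd_newY_eq_prod, hN₁, map_prod]
        have hcard : Fintype.card (Fin 1 → ZMod p) = p := by rw [card_fin_zmod, pow_one]
        have hprod : (C (α⁻¹ ^ p) : MvPolynomial (Fin 3) k) =
            ∏ _a : Fin 1 → ZMod p, C α⁻¹ := by
          rw [Finset.prod_const, Finset.card_univ, hcard, C_pow]
        rw [hprod, ← Finset.prod_mul_distrib]
        refine Finset.prod_congr rfl fun a _ => ?_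
        rw [map_add, map_mul, hΨ1, hΨ2, ← algebraMap_eq, AlgHom.commutes, algebraMap_eq, newY,
          hφ₁, AddMonoidHom.comp_apply, AddMonoidHom.coe_mulLeft, mul_add, ← mul_assoc,
          ← mul_assoc, ← C_mul, ← C_mul, inv_mul_cancel₀ hα, C_1, one_mul]
      change Ψ (Θ (X 1)) ∈ _
      rw [this]
      exact mul_mem (Subalgebra.algebraMap_mem _ _) hy
    · change Ψ (Θ (X 2)) ∈ _
      rw [hΘ2, hΨ2]
      exact Algebra.subset_adjoin (Or.inr (Or.inr rfl))

end NormalizedAction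

/-! ### The explicit invariants g and E. -/

section NormalizedCase

/-- The letters stand for i = 1/2, c1 = x^(p-1), e = x^(p²-2p-1), A = x^(p²-p), Y = y'^p, YY =
y'^(p²), ZZ = z'^(p²), D' = δ'^p. On the left is 2 x^(p²-1) times g; on the right are the expansions
of the orbit products. -/
theorem invG_identity {S : Type*} [CommRing S] {i x c1 e A y Y YY ZZ D' δ u0 u1 : S}
    (hi : 2 * i = 1) (hA : A = c1 * x ^ 2 * e) :
    2 * (A * c1) * (YY * y - i * x * ZZ + x ^ 2 * (i * e * (u1 * D' + Y ^ 2)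
      + i * u0 * c1 ^ 2 * e * δ - c1 * e * Y * y)) =
    (YY ^ 2 - x * A * c1 * ZZ + u0 * (A * c1) ^ 2 * δ + u1 * A ^ 2 * D')
      - (YY - Y * A) ^ 2 - 2 * ((YY - Y * A) * (Y - c1 * y)) * A := by
  linear_combination (- A * c1 * x * ZZ + c1 * x ^ 2 * A * e * (u1 * D' + Y ^ 2)
    + A * c1 * u0 * c1 ^ 2 * x ^ 2 * e * δ) * hi
    - (u1 * D' * A + Y ^ 2 * A + u0 * c1 ^ 2 * δ * A - 2 * A * c1 * Y * y) * hA

/-- Here X = x^p, A = x^(p²-p), A' = A^p, P = y'^(p³-p²), and the power p² - p of the orbit product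
of y' is P + A W. The left side is divisible by X, and the quotient contains z'^(p³) with
coefficient 1/2. -/
theorem subductG_identity {S : Type*} [CommRing S]
    {i x c1 e' e'' A A' W X y Y YY YYY ZZ ZZZ P w w' g : S}
    (hX : X = x * c1) (hA : A = X * e') (hA' : A' = X * e'') (hP : P * YY = YYY)
    (hg : g = YY * y - i * x * ZZ + x ^ 2 * w) :
    (YYY - YY * A') * (Y - c1 * y) - (YYY * Y - i * X * ZZZ + X ^ 2 * w') + (P + A * W) * g * c1 =
    X * (i * ZZZ - X * w' - YY * e'' * (Y - c1 * y) + P * (-i * ZZ + x * w) + e' * W * g * c1) := by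
  linear_combination (-(YY * (Y - c1 * y))) * hA' + (W * g * c1) * hA + c1 * y * hP + P * c1 * hg
    + (i * P * ZZ - P * x * w) * hX

variable {p : ℕ} {k : Type*} [Field k] [CharP k p] {M : Matrix (Fin 2) (Fin 3) k} {α γ : k}
  {φ₂ : (Fin 2 → ZMod p) →+ k}

theorem newY_isHomogeneous (α : k) : (newY α).IsHomogeneous 1 := (isHomogeneous_X _ _).C_mul _

theorem newZ_isHomogeneous (α γ : k) : (newZ α γ).IsHomogeneous 1 :=
  ((isHomogeneous_X _ _).C_mul _).add ((isHomogeneous_X _ _).C_mul _)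

theorem newDelta_isHomogeneous (α γ : k) : (newDelta α γ).IsHomogeneous 2 :=
  ((newY_isHomogeneous α).pow 2).sub ((isHomogeneous_X _ _).mul (newZ_isHomogeneous α γ))

variable [Fact p.Prime]

theorem NormalizedAction.orbitProd_newDelta_isHomogeneous (h : NormalizedAction M α γ φ₂) :
    (orbitProd p M (newDelta α γ)).IsHomogeneous (2 * p ^ 2) := by
  rw [h.orbitProd_newDelta]
  have := IsHomogeneous.prod (Finset.univ : Finset (Fin 2 → ZMod p))
    (fun b => (newDelta α γ + C (φ₂ b) * X 2 ^ 2 : MvPolynomial (Fin 3) k)) (fun _ => 2)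
    fun b _ => (newDelta_isHomogeneous α γ).add ((isHomogeneous_X_pow _ _).C_mul _)
  rw [Finset.sum_const, Finset.card_univ, card_fin_zmod, smul_eq_mul, mul_comm] at this
  exact this

theorem NormalizedAction.orbitProd_newY_isHomogeneous (h : NormalizedAction M α γ φ₂) :
    (orbitProd p M (newY α)).IsHomogeneous p := by
  rw [h.orbitProd_newY_eq_prod]
  have := IsHomogeneous.prod (Finset.univ : Finset (Fin 1 → ZMod p))
    (fun a => (newY α + C (primeHom p k a) * X 2 : MvPolynomial (Fin 3) k)) (fun _ => 1)
    fun a _ => (newY_isHomogeneous α).add ((isHomogeneous_X _ _).C_mul _)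
  rw [Finset.sum_const, Finset.card_univ, card_fin_zmod, smul_eq_mul, mul_one, pow_one] at this
  exact this

/-- The invariants `g` and `E` with `2 x^(p²-1) g = N(δ') - N(y')^(2p) - 2 N(y')^(p+1) x^(p(p-1))`
and `x^p E = N(y')^(p²+1) - g^p + N(y')^(p²-p) g x^(p-1)`. -/
theorem NormalizedAction.exists_eq (hp : p ≠ 2) (h : NormalizedAction M α γ φ₂) :
    ∃ g E : MvPolynomial (Fin 3) k,
      C 2 * X 2 ^ (p ^ 2 - 1) * g = orbitProd p M (newDelta α γ)
        - orbitProd p M (newY α) ^ (2 * p)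
        - C 2 * orbitProd p M (newY α) ^ (p + 1) * X 2 ^ (p * (p - 1)) ∧
      X 2 ^ p * E = orbitProd p M (newY α) ^ (p ^ 2 + 1) - g ^ p
        + orbitProd p M (newY α) ^ (p ^ 2 - p) * g * X 2 ^ (p - 1) ∧
      substVar 2 0 g = C (α ^ (p ^ 2 + 1)) * X 1 ^ (p ^ 2 + 1) ∧
      aeval ![(1 : k), 0, 0] E ≠ 0 := by
  have hpp := (Fact.out : p.Prime)
  have hp3 : 3 ≤ p := by have := hpp.two_le; omega
  have h2 := two_ne_zero_of_charP (k := k) hp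
  obtain ⟨m, hm⟩ : ∃ m, p = m + 3 := ⟨p - 3, by omega⟩
  obtain ⟨u, hu⟩ := exists_prod_add_eq (k := k) (n := 2) h.injective
  have hD := hu (newDelta α γ) (X 2 ^ 2) (pow_ne_zero 2 (X_ne_zero _))
  rw [← h.orbitProd_newDelta, Fin.sum_univ_two] at hD
  simp only [Fin.val_zero, Fin.val_one, pow_zero, pow_one] at hD
  have hf := h.orbitProd_newY
  set x : MvPolynomial (Fin 3) k := X 2 with hx
  set y : MvPolynomial (Fin 3) k := newY α with hy
  set z : MvPolynomial (Fin 3) k := newZ α γ with hz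
  have hδ : newDelta α γ = y ^ 2 - x * z := rfl
  generalize orbitProd p M (newDelta α γ) = D at *
  generalize orbitProd p M y = f at *
  set c1 := x ^ (p - 1) with hc1
  set e := x ^ (p ^ 2 - 2 * p - 1) with he
  set e' := x ^ (p ^ 2 - 2 * p) with he'
  set A := x ^ (p ^ 2 - p) with hA
  have n0 : p ^ 2 = m * m + 6 * m + 9 := by rw [hm]; ring
  have hAe : A = c1 * x ^ 2 * e := by
    rw [hA, hc1, he, ← pow_add, ← pow_add]
    congr 1
    omega
  have hX : x ^ p = x * c1 := by
    rw [hc1, ← pow_succ']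
    congr 1
    omega
  have hAe' : A = x ^ p * e' := by
    rw [hA, he', ← pow_add]
    congr 1
    omega
  have hc1p : c1 ^ p = A := by
    rw [hc1, hA, ← pow_mul, Nat.sub_mul, sq, one_mul]
  have hAp : A ^ p = x ^ p * ((x ^ p) ^ (p - 1) * e' ^ p) := by
    rw [← mul_assoc, ← pow_succ', Nat.sub_add_cancel hpp.one_le, ← mul_pow, ← hAe']
  have hAc : x ^ (p ^ 2 - 1) = A * c1 := by
    rw [hA, hc1, ← pow_add]
    congr 1
    omega
  have hfp : f ^ p = y ^ p ^ 2 - y ^ p * A := by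
    rw [hf, sub_pow_char, mul_pow, hc1p, ← pow_mul, ← sq, mul_comm A]
  have hfpp : f ^ p ^ 2 = y ^ p ^ 3 - y ^ p ^ 2 * A ^ p := by
    rw [sq p, pow_mul, hfp, sub_pow_char, mul_pow, ← pow_mul, ← pow_mul, ← pow_succ, ← sq]
  -- The orbit product is an additive polynomial in δ', and δ'^(p²) = y'^(2p²) - x^(p²) z'^(p²).
  have hD' : D = (y ^ p ^ 2) ^ 2 - x * A * c1 * z ^ p ^ 2 + C (u 0) * (A * c1) ^ 2 * newDelta α γ
      + C (u 1) * A ^ 2 * newDelta α γ ^ p := by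
    have t1 : (x ^ 2) ^ (p ^ 2 - 1) = (A * c1) ^ 2 := by rw [pow_right_comm, hAc]
    have t2 : (x ^ 2) ^ (p ^ 2 - p) = A ^ 2 := by rw [pow_right_comm]
    have t3 : x ^ p ^ 2 = x * A * c1 := by
      rw [mul_assoc, ← hAc, ← pow_succ']
      congr 1
      omega
    rw [hD, t1, t2]
    conv_lhs => enter [1]; rw [hδ, sub_pow_char_pow, mul_pow, t3, pow_right_comm]
    ring
  set i : MvPolynomial (Fin 3) k := C 2⁻¹ with hi
  have hi2 : 2 * i = 1 := by
    rw [hi, ← map_ofNat C 2, ← C_mul, mul_inv_cancel₀ h2, C_1]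
  -- The constant 1/2 lies in the prime field and is fixed by Frobenius.
  have hip : i ^ p = i := by
    have h2p : (2 : k) ^ p = 2 := by
      have := map_natCast (frobenius k p) 2
      simpa [frobenius_def] using this
    rw [hi, ← C_pow, inv_pow, h2p]
  set w := i * e * (C (u 1) * newDelta α γ ^ p + (y ^ p) ^ 2)
      + i * C (u 0) * c1 ^ 2 * e * newDelta α γ - c1 * e * y ^ p * y with hw
  set g := y ^ p ^ 2 * y - i * x * z ^ p ^ 2 + x ^ 2 * w with hg
  have hgp : g ^ p = y ^ p ^ 3 * y ^ p - i * x ^ p * z ^ p ^ 3 + (x ^ p) ^ 2 * w ^ p := by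
    rw [hg, add_pow_char, sub_pow_char, mul_pow, mul_pow, mul_pow, mul_pow, hip, ← pow_mul,
      ← pow_succ, ← pow_mul z, ← pow_succ, pow_right_comm x]
  obtain ⟨W, hW⟩ : ∃ W, f ^ (p ^ 2 - p) = (y ^ p ^ 2) ^ (p - 1) + A * W := by
    have h1 : A ∣ (f ^ p) ^ (p - 1) - (y ^ p ^ 2) ^ (p - 1) := by
      refine dvd_trans ?_ (sub_dvd_pow_sub_pow _ _ _)
      rw [hfp]
      exact ⟨-y ^ p, by ring⟩
    obtain ⟨W, hW⟩ := h1
    refine ⟨W, ?_⟩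
    rw [← hW, show p ^ 2 - p = p * (p - 1) by rw [Nat.mul_sub, mul_one, sq], pow_mul]
    ring
  have hYY : (y ^ p ^ 2) ^ (p - 1) * y ^ p ^ 2 = y ^ p ^ 3 := by
    rw [← pow_succ, Nat.sub_add_cancel hpp.one_le, ← pow_mul, ← pow_succ]
  have key := invG_identity (y := y) (Y := y ^ p) (YY := y ^ p ^ 2) (ZZ := z ^ p ^ 2)
    (D' := newDelta α γ ^ p) (δ := newDelta α γ) (u0 := C (u 0)) (u1 := C (u 1)) hi2 hAe
  have key2 := subductG_identity (ZZZ := z ^ p ^ 3) (Y := y ^ p) (w' := w ^ p) (W := W) hX hAe' hAp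
    hYY hg
  refine ⟨g, _, ?_, key2.symm.trans ?_, ?_, ?_⟩
  · have t1 : f ^ (2 * p) = (y ^ p ^ 2 - y ^ p * A) ^ 2 := by rw [mul_comm, pow_mul, hfp]
    have t2 : f ^ (p + 1) = (y ^ p ^ 2 - y ^ p * A) * (y ^ p - c1 * y) := by
      rw [pow_succ, hfp, hf]
    have t3 : x ^ (p * (p - 1)) = A := by rw [hA, Nat.mul_sub, mul_one, sq]
    rw [hAc, t1, t2, t3, map_ofNat, hD', hg, hw]
    exact key
  · have t1 : f ^ (p ^ 2 + 1) = (y ^ p ^ 3 - y ^ p ^ 2 * A ^ p) * (y ^ p - c1 * y) := by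
      rw [pow_succ, hfpp, hf]
    rw [hgp, t1, hW]
  · have h1 : substVar 2 0 x = 0 := substVar_X_self _ _
    have h3 : substVar 2 0 y = C α * X 1 := by simp [hy, newY, substVar]
    rw [hg]
    simp only [map_add, map_sub, map_mul, map_pow, h1, h3]
    ring
  -- At y = x = 0 and z = 1 only the term z'^(p³)/2 survives, as α^(2p³)/2.
  · have h1 : aeval ![(1 : k), 0, 0] x = 0 := by simp [hx]
    have h3 : aeval ![(1 : k), 0, 0] y = 0 := by simp [hy, newY]
    have h4 : aeval ![(1 : k), 0, 0] z = α ^ 2 := by simp [hz, newZ]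
    have h5 : aeval ![(1 : k), 0, 0] i = 2⁻¹ := by simp [hi]
    have h6 : aeval ![(1 : k), 0, 0] c1 = 0 := by
      rw [hc1, map_pow, h1, zero_pow (by omega)]
    simp only [map_add, map_sub, map_mul, map_pow, h1, h3, h4, h5, h6, zero_pow hpp.ne_zero,
      zero_pow (pow_ne_zero 2 hpp.ne_zero), zero_pow (show p - 1 ≠ 0 by omega), zero_mul, mul_zero,
      sub_zero, add_zero]
    exact mul_ne_zero (inv_ne_zero h2) (pow_ne_zero _ (pow_ne_zero _ h.ne_zero))

end NormalizedCase

/-! ### The case γ₁₂₄ ≠ 0, γ₁₃₅ = 0. -/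

section NormalizedGenerators

variable {p : ℕ} [Fact p.Prime] {k : Type*} [Field k] [CharP k p] {M : Matrix (Fin 2) (Fin 3) k}
  {α γ : k} {φ₂ : (Fin 2 → ZMod p) →+ k}

/-- This is the pair (p, p² + 1). The equation for x^p E expresses g^p through products linear in g,
and after that E gives way to the orbit product of z', which has the same lead monomial. The lead
coefficients α^p and α^(p²+1) match after raising to the powers p² + 1 and p. -/
theorem NormalizedAction.sagbi (hp : p ≠ 2) (hF : Function.Injective (colComb p M))
    (h : NormalizedAction M α γ φ₂) :
    ∃ g, IsInvG p M α γ g ∧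
      IsSagbiBasis (Set.range ![X 2, orbitProd p M (newY α), g, orbitProd p M (newZ α γ)])
        (invariantRing p M) ∧
      SingleRelationBySubducting ![X 2, orbitProd p M (newY α), g, orbitProd p M (newZ α γ)]
        (invariantRing p M)
        (Finsupp.single (1 : Fin 4) (p ^ 2 + 1)) (Finsupp.single (2 : Fin 4) p) ∧
      IsHypersurface (invariantRing p M) := by
  have hpp := (Fact.out : p.Prime)
  have hα := h.ne_zero
  have h2 := two_ne_zero_of_charP (k := k) hp
  have hp3 : 3 ≤ p := by have := hpp.two_le; omega
  have hpp2 : 3 * p ≤ p ^ 2 := by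
    rw [sq]
    exact Nat.mul_le_mul_right _ hp3
  have hpp3 : 3 * p ^ 2 ≤ p ^ 3 := by
    rw [pow_succ' p 2]
    exact Nat.mul_le_mul_right _ hp3
  obtain ⟨g, E, hg, hE, hg2, hE1⟩ := h.exists_eq hp
  have hfR : orbitProd p M (newY α) ∈ invariantRing p M := orbitProd_mem _
  have hDR : orbitProd p M (newDelta α γ) ∈ invariantRing p M := orbitProd_mem _
  have hxR : ∀ n, X 2 ^ n ∈ invariantRing p M := fun n => pow_mem X_two_mem_invariantRing n
  have hfh := h.orbitProd_newY_isHomogeneous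
  have hDh := h.orbitProd_newDelta_isHomogeneous
  have hNh := orbitProd_newZ_isHomogeneous hp hF hα γ
  have hNd := orbitProd_newZ_degree hp hF hα γ
  have hloc := fun F hF => h.exists_pow_mul_mem_adjoin (F := F) hF
  have hNR : orbitProd p M (newZ α γ) ∈ invariantRing p M := orbitProd_mem _
  have hinv : IsInvG p M α γ g := hg
  have hf2 : substVar 2 0 (orbitProd p M (newY α)) = C (α ^ p) * X 1 ^ p := by
    rw [h.orbitProd_newY, map_sub, map_mul, map_pow, map_pow, substVar_X_self,
      zero_pow (by omega), zero_mul, sub_zero, newY, map_mul, substVar_C,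
      substVar_X_of_ne (by decide), mul_pow, C_pow]
  generalize orbitProd p M (newY α) = f at *
  generalize orbitProd p M (newDelta α γ) = D at *
  generalize orbitProd p M (newZ α γ) = N at *
  have hgR : g ∈ invariantRing p M := by
    refine mem_invariantRing_of_C_mul h2 (mem_invariantRing_of_X_pow_mul (n := p ^ 2 - 1) ?_)
    rw [← mul_assoc, mul_comm (X 2 ^ _), hg]
    exact sub_mem (sub_mem hDR (pow_mem hfR _))
      (mul_mem (mul_mem (C_mem_invariantRing _) (pow_mem hfR _)) (hxR _))
  have hER : E ∈ invariantRing p M := by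
    refine mem_invariantRing_of_X_pow_mul (n := p) ?_
    rw [hE]
    exact add_mem (sub_mem (pow_mem hfR _) (pow_mem hgR _))
      (mul_mem (mul_mem (pow_mem hfR _) hgR) (hxR _))
  have hgh : g.IsHomogeneous (p ^ 2 + 1) := by
    have key : (X 2 ^ (p ^ 2 - 1) * (C 2 * g)).IsHomogeneous (p ^ 2 + 1 + (p ^ 2 - 1)) := by
      rw [← mul_assoc, mul_comm (X 2 ^ _), hg,
        show p ^ 2 + 1 + (p ^ 2 - 1) = 2 * p ^ 2 by omega]
      have t1 := hfh.pow (2 * p)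
      have t2 := ((hfh.pow (p + 1)).C_mul 2).mul
        (isHomogeneous_X_pow (R := k) (2 : Fin 3) (p * (p - 1)))
      rw [show p * (2 * p) = 2 * p ^ 2 by ring] at t1
      rw [show p * (p + 1) + p * (p - 1) = 2 * p ^ 2 by
        rw [← mul_add, show p + 1 + (p - 1) = 2 * p by omega]
        ring] at t2
      exact (hDh.sub t1).sub t2
    have := (isHomogeneous_of_X_pow_mul key).C_mul (2⁻¹ : k)
    rwa [← mul_assoc, ← C_mul, inv_mul_cancel₀ h2, C_1, one_mul] at this
  have hEh : E.IsHomogeneous (p ^ 3) := by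
    refine isHomogeneous_of_X_pow_mul (i := 2) (m := p) ?_
    rw [hE]
    have t1 := hfh.pow (p ^ 2 + 1)
    have t2 := hgh.pow p
    have t3 := ((hfh.pow (p ^ 2 - p)).mul hgh).mul
      (isHomogeneous_X_pow (R := k) (2 : Fin 3) (p - 1))
    rw [show p * (p ^ 2 + 1) = p ^ 3 + p by ring] at t1
    rw [show (p ^ 2 + 1) * p = p ^ 3 + p by ring] at t2
    rw [show p * (p ^ 2 - p) + (p ^ 2 + 1) + (p - 1) = p ^ 3 + p by
      rw [Nat.mul_sub, show p * p ^ 2 = p ^ 3 by ring, ← sq]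
      omega] at t3
    exact (t1.sub t2).add t3
  have hαf := pow_ne_zero p hα
  have hαg := pow_ne_zero (p ^ 2 + 1) hα
  have hdf := degree_eq_single_one hfh hαf hf2
  have hdg := degree_eq_single_one hgh hαg hg2
  have hE0 : E ≠ 0 := fun h0 => hE1 (by rw [h0, map_zero])
  have hEd := degree_eq_single_zero hEh (by rwa [coeff_single_zero hEh])
  have hshape : ∀ N : MvPolynomial (Fin 3) k, N ≠ 0 →
      grevlex.degree N = Finsupp.single 0 (p ^ 3) →
      LeadShape ![X 2, f, g, N] p (p ^ 2 + 1) (p ^ 3) := by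
    intro N hN0 hN
    refine ⟨rfl, fun i => ?_, hdf.1, hdg.1, hN, ?_, hpp.pos, pow_pos hpp.pos 3⟩
    · fin_cases i
      · exact X_ne_zero _
      · exact fun h0 => hαf (by rw [← hdf.2, show f = 0 from h0, grevlex.leadingCoeff_zero])
      · exact fun h0 => hαg (by rw [← hdg.2, show g = 0 from h0, grevlex.leadingCoeff_zero])
      · exact hN0
    · rw [show p ^ 2 + 1 = 1 + p * p by ring, Nat.coprime_add_mul_left_right]
      exact Nat.coprime_one_right p
  have hlead : ∀ F ∈ invariantRing p M, F ≠ 0 → ∃ I : Fin 4 →₀ ℕ, grevlex.degree F =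
      grevlex.degree (aeval ![X 2, f, g, N] (monomial I (1 : k))) := by
    intro F hF hF0
    obtain ⟨I, hI⟩ := (hshape E hE0 hEd).exists_degree_eq (R := invariantRing p M)
      (Q := X 1 ^ (p ^ 2 + 1) + X 1 ^ (p ^ 2 - p) * X 2 * X 0 ^ (p - 1) - X 0 ^ p * X 3)
      (by
        have hX : ∀ (j : Fin 4) (n : ℕ), j ≠ 2 →
            ((X j : MvPolynomial (Fin 4) k) ^ n).degreeOf 2 = 0 := by
          intro j n hj
          refine Nat.eq_zero_of_le_zero ((degreeOf_pow_le _ _ _).trans ?_)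
          rw [degreeOf_X, if_neg hj.symm, mul_zero]
        have d1 := hX 1 (p ^ 2 + 1) (by decide)
        have d2 : (X 1 ^ (p ^ 2 - p) * X 2 * X 0 ^ (p - 1) :
            MvPolynomial (Fin 4) k).degreeOf 2 ≤ 1 := by
          refine (degreeOf_mul_le _ _ _).trans
            ((add_le_add (degreeOf_mul_le _ _ _) le_rfl).trans ?_)
          rw [hX 1 _ (by decide), hX 0 _ (by decide), degreeOf_X, if_pos rfl]
        have d3 : (X 0 ^ p * X 3 : MvPolynomial (Fin 4) k).degreeOf 2 ≤ 0 := by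
          refine (degreeOf_mul_le _ _ _).trans ?_
          rw [hX 0 _ (by decide), degreeOf_X, if_neg (by decide)]
        refine lt_of_le_of_lt (degreeOf_sub_le _ _ _) (max_lt (lt_of_le_of_lt
          (degreeOf_add_le _ _ _) (max_lt ?_ ?_)) ?_) <;> omega)
      (by
        simp only [map_add, map_sub, map_mul, map_pow, aeval_X]
        change f ^ (p ^ 2 + 1) + f ^ (p ^ 2 - p) * g * X 2 ^ (p - 1) - X 2 ^ p * E = g ^ p
        rw [hE]
        ring)
      (fun F hF => by
        obtain ⟨n, hn⟩ := hloc F hF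
        refine ⟨n, Algebra.adjoin_le ?_ hn⟩
        have hx' : X 2 ∈ Algebra.adjoin k (Set.range ![X 2, f, g, E]) :=
          Algebra.subset_adjoin ⟨0, rfl⟩
        have hf' : f ∈ Algebra.adjoin k (Set.range ![X 2, f, g, E]) :=
          Algebra.subset_adjoin ⟨1, rfl⟩
        have hg' : g ∈ Algebra.adjoin k (Set.range ![X 2, f, g, E]) :=
          Algebra.subset_adjoin ⟨2, rfl⟩
        have hC' : C 2 ∈ Algebra.adjoin k (Set.range ![X 2, f, g, E]) :=
          Subalgebra.algebraMap_mem _ _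
        rintro q (hq | hq | hq)
        · rw [hq, show D = C 2 * X 2 ^ (p ^ 2 - 1) * g + f ^ (2 * p)
            + C 2 * f ^ (p + 1) * X 2 ^ (p * (p - 1)) by rw [hg]; ring]
          exact add_mem (add_mem (mul_mem (mul_mem hC' (pow_mem hx' _)) hg') (pow_mem hf' _))
            (mul_mem (mul_mem hC' (pow_mem hf' _)) (pow_mem hx' _))
        · rwa [hq]
        · rwa [hq]) F hF hF0
    exact ⟨I, by rw [hI, (hshape E hE0 hEd).degree_eq I one_ne_zero,
      (hshape N hNd.1 hNd.2).degree_eq I one_ne_zero]⟩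
  have hgen : ∀ i, ![X 2, f, g, N] i ∈ invariantRing p M := by
    intro i
    fin_cases i
    · exact X_two_mem_invariantRing
    · exact hfR
    · exact hgR
    · exact hNR
  have hsh := hshape N hNd.1 hNd.2
  have hrel := hsh.singleRelation hgen hlead
    (show grevlex.leadingCoeff f ^ _ = grevlex.leadingCoeff g ^ _ by
      rw [hdf.2, hdg.2, ← pow_mul, ← pow_mul, mul_comm])
  have hprod : p * (p ^ 2 + 1) = p ^ 3 + p := by ring
  refine ⟨g, hinv, isSagbiBasis_range hsh.ne_zero hgen hlead, hrel,
    hsh.isHypersurface (R := invariantRing p M) hrel (w := ![1, p, p ^ 2 + 1, p ^ 3])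
      (fun i => ?_) (fun i => ?_) rfl rfl (fun i => ?_) hpp.two_le (by omega)⟩
  · fin_cases i
    · exact isHomogeneous_X _ _
    · exact hfh
    · exact hgh
    · exact hNh
  · fin_cases i
    · exact one_pos
    · exact hpp.pos
    · exact Nat.succ_pos _
    · exact pow_pos hpp.pos 3
  · rw [hprod]
    fin_cases i
    · show 1 ≠ _
      omega
    · show p ≠ _
      omega
    · show p ^ 2 + 1 ≠ _
      omega
    · show p ^ 3 ≠ _
      omega

end NormalizedGenerators

/-! ### Normalizing M by changes of generators and of basis. -/

section ChangeOfBasis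

variable {p : ℕ} {k : Type*} [Field k] [CharP k p] {M : Matrix (Fin 2) (Fin 3) k}

theorem changeOf_apply (α γ : k) (T : GL (Fin 3) (ZMod p)) (j : Fin 3) :
    changeOf p M α γ T 0 j = α * ∑ i, ZMod.castHom (dvd_refl p) k (T.val i j) * M 0 i ∧
    changeOf p M α γ T 1 j =
      α * γ * ∑ i, ZMod.castHom (dvd_refl p) k (T.val i j) * M 0 i
        + α ^ 2 * ∑ i, ZMod.castHom (dvd_refl p) k (T.val i j) * M 1 i := by
  constructor
  · simp [changeOf, Matrix.mul_apply, Matrix.vecMul, dotProduct, Fin.sum_univ_three]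
    ring
  · simp [changeOf, Matrix.mul_apply, Matrix.vecMul, dotProduct, Fin.sum_univ_three]
    ring

theorem rowOne_apply (a : Fin 3 → ZMod p) :
    rowOne p M a = ∑ i, ZMod.castHom (dvd_refl p) k (a i) * M 0 i := rfl

theorem rowTwo_apply (a : Fin 3 → ZMod p) :
    rowTwo p M a = ∑ i, ZMod.castHom (dvd_refl p) k (a i) * M 1 i := rfl

theorem changeOf_eq (α γ : k) (T : GL (Fin 3) (ZMod p)) (b : Fin 3 → ZMod p) :
    α * rowOne p M (T.val.mulVec b) =
      ∑ j, ZMod.castHom (dvd_refl p) k (b j) * changeOf p M α γ T 0 j ∧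
    α * γ * rowOne p M (T.val.mulVec b) + α ^ 2 * rowTwo p M (T.val.mulVec b) =
      ∑ j, ZMod.castHom (dvd_refl p) k (b j) * changeOf p M α γ T 1 j := by
  simp only [(changeOf_apply α γ T _).1, (changeOf_apply α γ T _).2, rowOne_apply, rowTwo_apply,
    Matrix.mulVec, dotProduct, map_add, map_mul, Fin.sum_univ_three]
  constructor <;> ring

theorem rowOne_smul (s : ZMod p) (t : Fin 3 → ZMod p) :
    rowOne p M (s • t) = ZMod.castHom (dvd_refl p) k s * rowOne p M t := by
  simp only [rowOne_apply, Pi.smul_apply, smul_eq_mul, map_mul, Finset.mul_sum, mul_assoc]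

theorem rowTwo_smul (s : ZMod p) (t : Fin 3 → ZMod p) :
    rowTwo p M (s • t) = ZMod.castHom (dvd_refl p) k s * rowTwo p M t := by
  simp only [rowTwo_apply, Pi.smul_apply, smul_eq_mul, map_mul, Finset.mul_sum, mul_assoc]

variable [Fact p.Prime]

/-- Take t₁ with c₁(t₁) ≠ 0 and t₃ ≠ 0 in the kernel of c₁ as first and third column of T. Then α
scales c₁(t₁) to 1, and γ removes the second entry of the first column. -/
theorem exists_isNormalizing (h124 : gammaMinor p M 1 2 4 ≠ 0)
    (h135 : gammaMinor p M 1 3 5 = 0) : ∃ α γ T, IsNormalizing p M α γ T := by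
  obtain ⟨t₃, ht₃, h3⟩ := exists_rowOne_eq_zero h135
  obtain ⟨t₁, ht₁⟩ : ∃ t, rowOne p M t ≠ 0 := by
    by_contra! h0
    refine h124 ?_
    have hM : ∀ j, M 0 j = 0 := fun j =>
      (rowOne_single (p := p) j).symm.trans (h0 _)
    rw [gammaMinor]
    refine Matrix.det_eq_zero_of_row_eq_zero 0 fun j => ?_
    simp [gammaRow, hM]
  have hli : LinearIndependent (ZMod p) ![t₁, t₃] := by
    rw [LinearIndependent.pair_iff]
    intro s r hsr
    have h1 := congrArg (rowOne p M) hsr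
    rw [map_add, rowOne_smul, rowOne_smul, h3, mul_zero, add_zero, map_zero] at h1
    have hs : s = 0 := (ZMod.castHom (dvd_refl p) k).injective (by
      rw [map_zero]
      exact (mul_eq_zero.1 h1).resolve_right ht₁)
    rw [hs, zero_smul, zero_add] at hsr
    exact ⟨hs, (smul_eq_zero.1 hsr).resolve_right ht₃⟩
  -- A nonzero coordinate j of the cross product is, up to sign, the determinant of t₁, e_j, t₃, so
  -- e_j completes the basis.
  obtain ⟨j, hj⟩ := Function.ne_iff.1 (crossProduct_ne_zero_iff_linearIndependent.2 hli)
  have hdet : (Matrix.of ![t₁, Pi.single j 1, t₃]).transpose.det ≠ 0 := by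
    rw [Matrix.det_transpose, Matrix.det_fin_three]
    intro h0
    apply hj
    rw [cross_apply]
    fin_cases j <;> simp at h0 ⊢ <;> linear_combination -h0
  refine ⟨(rowOne p M t₁)⁻¹, -(rowOne p M t₁)⁻¹ * rowTwo p M t₁ / rowOne p M t₁,
    Matrix.GeneralLinearGroup.mkOfDetNeZero _ hdet, inv_ne_zero ht₁, ?_, ?_, ?_⟩
  · rw [(changeOf_apply _ _ _ _).1]
    exact inv_mul_cancel₀ ht₁
  · rw [(changeOf_apply _ _ _ _).2]
    change _ * rowOne p M t₁ + _ * rowTwo p M t₁ = 0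
    field_simp
    ring
  · rw [(changeOf_apply _ _ _ _).1]
    change _ * rowOne p M t₃ = 0
    rw [h3, mul_zero]

/-- The relation from γ₁₂₃ = 0 has no c₂-term, as seen on the third column, where c₁ = 0 and c₂ ≠ 0
by faithfulness. So c₁^p is a multiple of c₁, and since α c₁ takes the value 1, all its values are
in 𝔽_p. -/
theorem IsNormalizing.normalizedAction (hF : Function.Injective (colComb p M))
    (h123 : gammaMinor p M 1 2 3 = 0) {α γ : k} {T : GL (Fin 3) (ZMod p)}
    (h : IsNormalizing p M α γ T) : ∃ φ₂, NormalizedAction M α γ φ₂ := by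
  have hpp := (Fact.out : p.Prime)
  obtain ⟨hα, h00, h10, h02⟩ := h
  have key := changeOf_eq (M := M) α γ T
  simp only [Fin.sum_univ_three, h00, h10, h02, mul_one, mul_zero, add_zero, zero_add] at key
  have hT : Function.Injective T.val.mulVec :=
    Matrix.mulVec_injective_of_isUnit T.isUnit
  have hTs : ∀ a, ∃ b, T.val.mulVec b = a := fun a =>
    Matrix.mulVec_surjective_iff_isUnit.2 T.isUnit a
  have hker : ∀ a, rowOne p M a = 0 → rowTwo p M a = 0 → a = 0 := by
    intro a h1 h2
    apply hF
    rw [colComb_eq, h1, h2, map_zero]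
    rfl
  obtain ⟨v, hv, hrel⟩ := exists_relation_of_gammaMinor_eq_zero h123
  simp only [gammaHom_one, gammaHom_two, gammaHom_three] at hrel
  have hv1 : v 1 = 0 := by
    have ht := (key (Pi.single 2 1)).1
    simp at ht
    have h1 := ht.resolve_left hα
    have h3 := hrel (T.val.mulVec (Pi.single 2 1))
    simp only [Matrix.mulVec_single_one] at h3
    rw [h1, zero_pow hpp.ne_zero, mul_zero, mul_zero, zero_add, add_zero] at h3
    refine (mul_eq_zero.1 h3).resolve_right fun h2 => ?_
    have h0 := hker _ h1 h2
    have := hT (a₁ := Pi.single 2 1) (a₂ := 0) (by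
      rw [Matrix.mulVec_zero, Matrix.mulVec_single_one, h0])
    exact one_ne_zero (α := ZMod p) (by simpa using congrFun this 2)
  obtain ⟨t, ht⟩ : ∃ t, α * rowOne p M t = 1 ∧
      α * γ * rowOne p M t + α ^ 2 * rowTwo p M t = 0 :=
    ⟨_, by rw [(key (Pi.single 0 1)).1]; simp, by rw [(key (Pi.single 0 1)).2]; simp⟩
  have hs0 : rowOne p M t ≠ 0 := right_ne_zero_of_mul (ht.1.trans_ne one_ne_zero)
  have hrt := hrel t
  rw [hv1, zero_mul, add_zero] at hrt
  have hv2 : v 2 ≠ 0 := by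
    intro hv2
    rw [hv2, zero_mul, add_zero] at hrt
    refine hv (funext fun i => ?_)
    fin_cases i
    · exact (mul_eq_zero.1 hrt).resolve_right hs0
    · exact hv1
    · exact hv2
  have hpow : ∀ a, (α * rowOne p M a) ^ p = α * rowOne p M a := by
    intro a
    have hra := hrel a
    rw [hv1, zero_mul, add_zero] at hra
    have htp : α ^ p * rowOne p M t ^ p = 1 := by rw [← mul_pow, ht.1, one_pow]
    refine mul_left_cancel₀ (mul_ne_zero hv2 (pow_ne_zero p hs0)) ?_
    rw [mul_pow]
    linear_combination (v 2 * rowOne p M a ^ p) * htp - α * rowOne p M a * hrt + hra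
      + v 0 * rowOne p M a * ht.1
  have hcast : ∀ a, ∃ n : ZMod p, α * rowOne p M a = ZMod.castHom (dvd_refl p) k n := fun a =>
    exists_castHom_eq (hpow a)
  obtain ⟨n, hn⟩ := hcast (T.val.mulVec (Pi.single 1 1))
  rw [(key _).1] at hn
  simp at hn
  set φ₂ : (Fin 2 → ZMod p) →+ k :=
    { toFun := fun b => -(ZMod.castHom (dvd_refl p) k (b 0) * changeOf p M α γ T 1 1
        + ZMod.castHom (dvd_refl p) k (b 1) * changeOf p M α γ T 1 2)
      map_zero' := by simp
      map_add' := fun b c => by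
        simp only [Pi.add_apply, map_add]
        ring } with hφ₂
  have hφa : ∀ b, φ₂ b = -(ZMod.castHom (dvd_refl p) k (b 0) * changeOf p M α γ T 1 1
        + ZMod.castHom (dvd_refl p) k (b 1) * changeOf p M α γ T 1 2) := fun b => rfl
  -- With n the entry of the first row in the second column, the kernel of c₁ consists of the
  -- vectors (-b₀ n, b₀, b₁). Their first coordinate does not affect the second row, whose first
  -- entry is zero.
  have hkerb : ∀ b : Fin 2 → ZMod p, rowOne p M (T.val.mulVec ![-b 0 * n, b 0, b 1]) = 0 ∧
      α ^ 2 * rowTwo p M (T.val.mulVec ![-b 0 * n, b 0, b 1]) = -φ₂ b := by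
    intro b
    have h1 := (key ![-b 0 * n, b 0, b 1]).1
    have h2 := (key ![-b 0 * n, b 0, b 1]).2
    have h3 : rowOne p M (T.val.mulVec ![-b 0 * n, b 0, b 1]) = 0 := by
      refine (mul_eq_zero.1 (h1.trans ?_)).resolve_left hα
      simp [hn]
    rw [h3, mul_zero, zero_add] at h2
    exact ⟨h3, by rw [h2, hφa]; simp⟩
  refine ⟨φ₂, hα, ?_, hcast, fun a => ?_, fun b => ⟨_, hkerb b⟩, ⟨t, ht⟩⟩
  · rw [injective_iff_map_eq_zero]
    intro b hb
    obtain ⟨h1, h2⟩ := hkerb b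
    rw [hb, neg_zero] at h2
    have h0 := hker _ h1 ((mul_eq_zero.1 h2).resolve_left (pow_ne_zero 2 hα))
    have := hT (a₂ := 0) (h0.trans (Matrix.mulVec_zero _).symm)
    ext i
    fin_cases i
    · exact congrFun this 1
    · exact congrFun this 2
  · obtain ⟨b, rfl⟩ := hTs a
    exact ⟨![b 1, b 2], by rw [(key b).2, hφa]; simp⟩

end ChangeOfBasis

/-! ### Symmetric squares, non-faithful representations, and a zero first row. -/

section DegenerateCases

variable {p : ℕ} {k : Type*} [Field k] [CharP k p] {M : Matrix (Fin 2) (Fin 3) k}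

/-- The unipotent change z ↦ z - a y absorbs c₂ = a c₁. -/
theorem isSymmetricSquare_of_rowTwo_eq {a : k} (hs : ∀ s, rowTwo p M s = a * rowOne p M s) :
    IsSymmetricSquare p M := by
  have hinv : ∀ b : k, (!![1, -b, 0; 0, 1, 0; 0, 0, 1] : Matrix (Fin 3) (Fin 3) k) *
      !![1, b, 0; 0, 1, 0; 0, 0, 1] = 1 := by
    intro b
    ext i j
    fin_cases i <;> fin_cases j <;> simp [Matrix.mul_apply, Fin.sum_univ_three]
  refine ⟨rowOne p M, ⟨!![1, -a, 0; 0, 1, 0; 0, 0, 1], !![1, a, 0; 0, 1, 0; 0, 0, 1], hinv a, ?_⟩,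
    fun g => ?_⟩
  · have := hinv (-a)
    rwa [neg_neg] at this
  · rw [Units.mul_inv_eq_iff_eq_mul, repMat_apply, colComb_eq, hs]
    ext i j
    fin_cases i <;> fin_cases j <;>
      simp [sigma, symSquare, Matrix.mul_apply, Fin.sum_univ_three]
    ring

/-- If c₁ = 0, then all vectors with last coordinate zero are fixed, so the fixed space has
dimension at least 2. -/
theorem exists_rowOne_ne_zero (h : IsTypeOneOneOne (repV p M)) : ∃ t, rowOne p M t ≠ 0 := by
  by_contra! h0
  have hmem : ∀ v : Fin 3 → k, v 2 = 0 → v ∈ (repV p M).invariants := by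
    intro v hv g
    change (sigma (colComb p M g.toAdd)).mulVec v = v
    rw [colComb_eq, h0]
    ext i
    fin_cases i <;> simp [sigma, Matrix.mulVec, dotProduct, Fin.sum_univ_three, hv]
  obtain ⟨v, -, hv⟩ := finrank_eq_one_iff'.1 h.1
  obtain ⟨c, hc⟩ := hv ⟨![1, 0, 0], hmem _ rfl⟩
  obtain ⟨d, hd⟩ := hv ⟨![0, 1, 0], hmem _ rfl⟩
  have h1 := congrFun (congrArg Subtype.val hc) 0
  have h2 := congrFun (congrArg Subtype.val hc) 1
  have h3 := congrFun (congrArg Subtype.val hd) 1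
  simp at h1 h2 h3
  rcases h2 with h2 | h2
  · simp [h2] at h1
  · simp [h2] at h3

variable [Fact p.Prime]

theorem exists_rowTwo_eq_mul (h123 : gammaMinor p M 1 2 3 = 0) (h124 : gammaMinor p M 1 2 4 = 0)
    (h135 : gammaMinor p M 1 3 5 ≠ 0) : ∃ a : k, ∀ s, rowTwo p M s = a * rowOne p M s := by
  obtain ⟨a, b, hs⟩ := exists_rowTwo_eq h123 h135
  have hb : b = 0 := by
    have h := (gammaMinor_of_rowTwo_eq hs).1
    rw [h124, eq_comm] at h
    exact eq_zero_of_pow_eq_zero ((mul_eq_zero.1 h).resolve_right h135)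
  exact ⟨a, fun s => by rw [hs, hb, zero_mul, add_zero]⟩

/-- The roots of `u₀ T + u₁ T^p` are the multiples of one of them by elements of `𝔽_p`. -/
theorem exists_eq_castHom_mul {u₀ u₁ s x : k} (hu : u₁ ≠ 0) (hs : s ≠ 0)
    (h1 : u₀ * s + u₁ * s ^ p = 0) (h2 : u₀ * x + u₁ * x ^ p = 0) :
    ∃ n : ZMod p, x = ZMod.castHom (dvd_refl p) k n * s := by
  have hx : (x / s) ^ p = x / s := by
    rw [div_pow, div_eq_div_iff (pow_ne_zero p hs) hs]
    refine mul_left_cancel₀ hu ?_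
    linear_combination s * h2 - x * h1
  obtain ⟨n, hn⟩ := exists_castHom_eq hx
  exact ⟨n, by rw [← hn, div_mul_cancel₀ _ hs]⟩

/-- If V_M were faithful, c₁ and the restriction of c₂ to the kernel of c₁ would each satisfy a
two-term equation u₀ T + u₁ T^p = 0 with u₁ ≠ 0. Their values would lie on one line over 𝔽_p each,
so G would have at most p² elements. -/
theorem not_faithful (h123 : gammaMinor p M 1 2 3 = 0) (h124 : gammaMinor p M 1 2 4 = 0)
    (h135 : gammaMinor p M 1 3 5 = 0) (h : IsTypeOneOneOne (repV p M)) : ¬ Faithful p M := by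
  rw [faithful_iff]
  intro hF
  have hpp := (Fact.out : p.Prime)
  have hker : ∀ a, rowOne p M a = 0 → rowTwo p M a = 0 → a = 0 := by
    intro a h1 h2
    apply hF
    rw [colComb_eq, h1, h2, map_zero]
    rfl
  obtain ⟨t₁, ht₁⟩ := exists_rowOne_ne_zero h
  obtain ⟨t, ht, ht0⟩ := exists_rowOne_eq_zero h135
  have htψ : rowTwo p M t ≠ 0 := fun h0 => ht (hker t ht0 h0)
  obtain ⟨v, hv, hrel⟩ := exists_relation_of_gammaMinor_eq_zero h123
  obtain ⟨w, hw, hrel'⟩ := exists_relation_of_gammaMinor_eq_zero h124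
  simp only [gammaHom_one, gammaHom_two, gammaHom_three] at hrel
  simp only [gammaHom_one, gammaHom_two, gammaHom_four] at hrel'
  have hv1 : v 1 = 0 := by
    have := hrel t
    rw [ht0, zero_pow hpp.ne_zero, mul_zero, mul_zero, zero_add, add_zero] at this
    exact (mul_eq_zero.1 this).resolve_right htψ
  simp only [hv1, zero_mul, add_zero] at hrel
  have hv2 : v 2 ≠ 0 := by
    intro hv2
    have := hrel t₁
    rw [hv2, zero_mul, add_zero] at this
    refine hv (funext fun i => ?_)
    fin_cases i
    · exact (mul_eq_zero.1 this).resolve_right ht₁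
    · exact hv1
    · exact hv2
  have hrelker : ∀ a, rowOne p M a = 0 → w 1 * rowTwo p M a + w 2 * rowTwo p M a ^ p = 0 := by
    intro a ha
    have := hrel' a
    rwa [ha, mul_zero, zero_add] at this
  have hw2 : w 2 ≠ 0 := by
    intro hw2
    have h1 := hrelker t ht0
    rw [hw2, zero_mul, add_zero] at h1
    have hw1 := (mul_eq_zero.1 h1).resolve_right htψ
    have h2 := hrel' t₁
    rw [hw1, hw2, zero_mul, zero_mul, add_zero, add_zero] at h2
    refine hw (funext fun i => ?_)
    fin_cases i
    · exact (mul_eq_zero.1 h2).resolve_right ht₁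
    · exact hw1
    · exact hw2
  have hsurj : Function.Surjective fun x : ZMod p × ZMod p => x.1 • t₁ + x.2 • t := by
    intro a
    obtain ⟨m, hm⟩ := exists_eq_castHom_mul hv2 ht₁ (hrel t₁) (hrel a)
    have ha : rowOne p M (a - m • t₁) = 0 := by rw [map_sub, rowOne_smul, hm, sub_self]
    obtain ⟨n, hn⟩ := exists_eq_castHom_mul hw2 htψ (hrelker t ht0) (hrelker _ ha)
    refine ⟨(m, n), ?_⟩
    have := hker (a - m • t₁ - n • t)
      (by rw [map_sub, ha, rowOne_smul, ht0, mul_zero, sub_zero])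
      (by rw [map_sub, rowTwo_smul, hn, sub_self])
    exact (sub_eq_zero.1 (by rwa [sub_sub] at this)).symm
  have hcard := Fintype.card_le_of_surjective _ hsurj
  rw [card_fin_zmod, Fintype.card_prod, ZMod.card, ← sq] at hcard
  exact absurd (Nat.pow_lt_pow_right hpp.one_lt (by norm_num : 2 < 3)) (not_lt.2 hcard)

/-- If the first row of `M` is zero, the invariants form a polynomial ring. -/
theorem invariantRing_of_row_zero (h : ∀ j, M 0 j = 0) :
    AlgebraicIndependent k ![X 2, X 1, orbitProd p M (X 0)] ∧
    Algebra.adjoin k (Set.range ![X 2, X 1, orbitProd p M (X 0)]) = invariantRing p M := by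
  classical
  have h1 : ∀ a, rowOne p M a = 0 :=
    addMonoidHom_eq_zero fun j => by rw [rowOne_single, h]
  have hX0 : ∀ a, polyAct (sigma (colComb p M a)) (X 0) = X 0 + C (rowTwo p M a) * X 2 := by
    intro a
    rw [polyAct_sigma_X_zero, colComb_eq, h1]
    simp
  have hX1 : ∀ a, polyAct (sigma (colComb p M a)) (X 1) = X 1 := by
    intro a
    rw [polyAct_sigma_X_one, colComb_eq, h1, C_0, zero_mul, add_zero]
  -- The orbit of z is parametrized by the image of c₂, which is smaller than G when V_M is not
  -- faithful.
  let A := (rowTwo p M).range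
  have hA : Finite A := Set.finite_range (rowTwo p M)
  have : Fintype A := Fintype.ofFinite A
  set N := orbitProd p M (X 0) with hNdef
  have hinj : Function.Injective A.subtype := A.subtype_injective
  have hN : N = ∏ w : A, (X 0 + C (A.subtype w) * X 2) := by
    refine orbitProd_eq_prod (fun a b hab => ?_) (fun a => ⟨⟨rowTwo p M a, a, rfl⟩, ?_⟩) ?_
    · exact smulHom_injective hinj (X_ne_zero (2 : Fin 3)) (add_left_cancel hab)
    · rw [hX0]
      rfl
    · rintro ⟨_, a, rfl⟩
      exact ⟨a, hX0 a⟩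
  have hNh : N.IsHomogeneous (Fintype.card A) := by
    have := IsHomogeneous.prod (Finset.univ : Finset A)
      (fun w => (X 0 + C (A.subtype w) * X 2 : MvPolynomial (Fin 3) k)) (fun _ => 1) fun w _ =>
        (isHomogeneous_X _ _).add ((isHomogeneous_X _ _).C_mul _)
    rw [Finset.sum_const, Finset.card_univ, smul_eq_mul, mul_one] at this
    rwa [hN]
  have hNc : coeff (Finsupp.single 0 (Fintype.card A)) N ≠ 0 := by
    rw [coeff_single_zero hNh, hN, map_prod]
    simp
  have hNd := degree_eq_single_zero hNh hNc
  refine ⟨?_, le_antisymm (Algebra.adjoin_le ?_) fun F hF => ?_⟩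
  · refine aeval_injective_of_degree (σ := ![2, 1, 0]) (d := ![1, 1, Fintype.card A]) (by decide)
      ?_ ?_ ?_ <;> intro i <;> fin_cases i
    · exact one_pos
    · exact one_pos
    · exact Fintype.card_pos
    · exact X_ne_zero _
    · exact X_ne_zero _
    · exact fun h0 => hNc (by rw [show N = 0 from h0, coeff_zero])
    · exact grevlex.degree_X
    · exact grevlex.degree_X
    · exact hNd
  · rintro _ ⟨i, rfl⟩
    fin_cases i
    · exact X_two_mem_invariantRing
    · exact mem_invariantRing.2 hX1
    · exact orbitProd_mem _
  · have hmem := mem_adjoin_of_translation hinj (i := 0) (t := X 2) (P := F)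
      (substVar_X_of_ne (by decide) _) (X_ne_zero _) (by
        rintro ⟨_, a, rfl⟩
        have hcomp : substVar 0 (X 0 + C (rowTwo p M a) * X 2) =
            polyAct (sigma (colComb p M a)) := by
          refine MvPolynomial.algHom_ext fun i => ?_
          fin_cases i
          · exact (substVar_X_self _ _).trans (hX0 a).symm
          · exact (substVar_X_of_ne (by decide) _).trans (hX1 a).symm
          · exact (substVar_X_of_ne (by decide) _).trans (polyAct_sigma_X_two _).symm
        exact (DFunLike.congr_fun hcomp F).trans (mem_invariantRing.1 hF a))
    rw [← hN] at hmem
    refine Algebra.adjoin_mono ?_ hmem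
    rintro _ (rfl | ⟨j, hj, rfl⟩)
    · exact ⟨2, rfl⟩
    · fin_cases j
      · exact absurd rfl hj
      · exact ⟨1, rfl⟩
      · exact ⟨0, rfl⟩

theorem isHypersurface_of_isTypeOneOneOne (hp : p ≠ 2) (h123 : gammaMinor p M 1 2 3 = 0)
    (hF : Faithful p M) (h : IsTypeOneOneOne (repV p M)) :
    IsHypersurface (invariantRing p M) := by
  by_cases h124 : gammaMinor p M 1 2 4 = 0
  · by_cases h135 : gammaMinor p M 1 3 5 = 0
    · exact absurd hF (not_faithful h123 h124 h135 h)
    · obtain ⟨a, hs⟩ := exists_rowTwo_eq_mul h123 h124 h135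
      exact isHypersurface_of_rowTwo_eq hp (rowOne_injective h135) hs
  · by_cases h135 : gammaMinor p M 1 3 5 = 0
    · obtain ⟨α, γ, T, hT⟩ := exists_isNormalizing h124 h135
      rw [faithful_iff] at hF
      obtain ⟨φ₂, hφ⟩ := hT.normalizedAction hF h123
      obtain ⟨-, -, -, -, hH⟩ := hφ.sagbi hp hF
      exact hH
    · obtain ⟨-, -, -, -, hH⟩ := sagbi_of_gammaMinor_ne_zero hp h123 h124 h135
      exact hH

end DegenerateCases

end ElemAbelian

/-! ### Assembly of the cases. -/

theorem mainTheorem12 (p : ℕ) [Fact p.Prime] (hp : p ≠ 2) {k : Type*} [Field k] [CharP k p]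
    (M : Matrix (Fin 2) (Fin 3) k) (h123 : ElemAbelian.gammaMinor p M 1 2 3 = 0) :
    -- the ring of invariants is a hypersurface
    (ElemAbelian.Faithful p M → ElemAbelian.IsTypeOneOneOne (ElemAbelian.repV p M) →
      ElemAbelian.IsHypersurface (ElemAbelian.invariantRing p M)) ∧
    -- the degenerate case of a zero first row: a polynomial ring
    ((∀ j, M 0 j = 0) →
      AlgebraicIndependent k
        ![MvPolynomial.X 2, MvPolynomial.X 1, ElemAbelian.orbitProd p M (MvPolynomial.X 0)] ∧
      Algebra.adjoin k (Set.range
        ![MvPolynomial.X 2, MvPolynomial.X 1, ElemAbelian.orbitProd p M (MvPolynomial.X 0)]) =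
        ElemAbelian.invariantRing p M) ∧
    -- the case `γ₁₂₄ ≠ 0`, `γ₁₃₅ ≠ 0`
    (ElemAbelian.gammaMinor p M 1 2 4 ≠ 0 → ElemAbelian.gammaMinor p M 1 3 5 ≠ 0 →
      ∃ h, ElemAbelian.IsInvH p M h ∧
        ElemAbelian.IsSagbiBasis
          (Set.range ![MvPolynomial.X 2, ElemAbelian.invF p M, h,
            ElemAbelian.orbitProd p M (MvPolynomial.X 0)])
          (ElemAbelian.invariantRing p M) ∧
        ElemAbelian.SingleRelationBySubducting
          ![MvPolynomial.X 2, ElemAbelian.invF p M, h,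
            ElemAbelian.orbitProd p M (MvPolynomial.X 0)]
          (ElemAbelian.invariantRing p M)
          (Finsupp.single (1 : Fin 4) (p ^ 2 + p + 2)) (Finsupp.single (2 : Fin 4) p)) ∧
    -- the case `γ₁₂₄ ≠ 0`, `γ₁₃₅ = 0`
    (ElemAbelian.Faithful p M → ElemAbelian.gammaMinor p M 1 2 4 ≠ 0 →
      ElemAbelian.gammaMinor p M 1 3 5 = 0 →
      (∃ α γ T, ElemAbelian.IsNormalizing p M α γ T) ∧
      ∀ α γ T, ElemAbelian.IsNormalizing p M α γ T →
        ∃ g, ElemAbelian.IsInvG p M α γ g ∧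
          ElemAbelian.IsSagbiBasis
            (Set.range ![MvPolynomial.X 2, ElemAbelian.orbitProd p M (ElemAbelian.newY α), g,
              ElemAbelian.orbitProd p M (ElemAbelian.newZ α γ)])
            (ElemAbelian.invariantRing p M) ∧
          ElemAbelian.SingleRelationBySubducting
            ![MvPolynomial.X 2, ElemAbelian.orbitProd p M (ElemAbelian.newY α), g,
              ElemAbelian.orbitProd p M (ElemAbelian.newZ α γ)]
            (ElemAbelian.invariantRing p M)
            (Finsupp.single (1 : Fin 4) (p ^ 2 + 1)) (Finsupp.single (2 : Fin 4) p)) ∧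
    -- the case `γ₁₂₄ = 0`, `γ₁₃₅ ≠ 0`
    (ElemAbelian.gammaMinor p M 1 2 4 = 0 → ElemAbelian.gammaMinor p M 1 3 5 ≠ 0 →
      ElemAbelian.IsSymmetricSquare p M) ∧
    -- the case `γ₁₂₄ = γ₁₃₅ = 0`
    (ElemAbelian.IsTypeOneOneOne (ElemAbelian.repV p M) →
      ElemAbelian.gammaMinor p M 1 2 4 = 0 → ElemAbelian.gammaMinor p M 1 3 5 = 0 →
      ¬ ElemAbelian.Faithful p M) := by
  refine ⟨fun hF h => ElemAbelian.isHypersurface_of_isTypeOneOneOne hp h123 hF h,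
    fun h => ElemAbelian.invariantRing_of_row_zero h, fun h124 h135 => ?_, fun hF h124 h135 => ?_,
    fun h124 h135 => ?_, fun h h124 h135 => ElemAbelian.not_faithful h123 h124 h135 h⟩
  · obtain ⟨h, h1, h2, h3, -⟩ := ElemAbelian.sagbi_of_gammaMinor_ne_zero hp h123 h124 h135
    exact ⟨h, h1, h2, h3⟩
  · refine ⟨ElemAbelian.exists_isNormalizing h124 h135, fun α γ T hT => ?_⟩
    rw [ElemAbelian.faithful_iff] at hF
    obtain ⟨φ₂, hφ⟩ := hT.normalizedAction hF h123
    obtain ⟨g, h1, h2, h3, -⟩ := hφ.sagbi hp hF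
    exact ⟨g, h1, h2, h3⟩
  · obtain ⟨a, hs⟩ := ElemAbelian.exists_rowTwo_eq_mul h123 h124 h135
    exact ElemAbelian.isSymmetricSquare_of_rowTwo_eq hs
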